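/- Let $k=\mathbb F_q$ be a finite field with algebraic closure $\bar k$, $\varphi$ the Frobenius $x\mapsto x^q$ of $\bar k$, $\hat G=\mathrm{Gal}(\bar k/k)$ and $G=\langle\varphi\rangle\cong\mathbb Z$. Let $S$ be a $k$-scheme (e.g. $S=\operatorname{Spec}k$) and $E$ a small full subcategory of the category of $S$-schemes that are separated and of finite type over $k$, such that every scheme which is étale of finite type over a member of $E$, and separated over $k$, belongs to $E$ (up to isomorphism). Equip $E$ with the étale topology and let $\mathcal T_{\hat G}$ be the category of abelian étale sheaves on $E$. For $V\in E$ put $\bar V=V\times_k\bar k$. Let $\bar E$ be the category whose objects are the open and closed subschemes of the schemes $\bar V$, $V\in E$, with morphisms over $\bar k$ and $S$; $G$ acts on it. Let $\mathcal T_G$ be the category of abelian étale sheaves on $\bar E$ with an action of $G$ compatible with the action on $\bar E$. Let $\gamma_*:\mathcal T_G\to\mathcal T_{\hat G}$ be the functor $(\gamma_*F)(V)=F(\bar V)^G$ and $\gamma^*$ its left adjoint (the restriction from $\hat G$- to $G$-sheaves). Let $\mathbb Z,\mathbb Q$ denote constant sheaves (with trivial action). Let $N\in\mathcal T_G$ be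 $\mathbb Z\oplus\mathbb Z$ with $\varphi^a(r,s)=(r+as,s)$, and $e\in\operatorname{Ext}^1_G(\mathbb Z,\mathbb Z)$ the class of $0\to\mathbb Z\to N\to\mathbb Z\to0$ (up to sign). For a complex $F$ in $\mathcal T_G$, cup product with $e$ is the map $F\to F[1]$ in the derived category given by the connecting map of $0\to F\to F\otimes N\to F\to0$, and it induces $e\cup-:R\gamma_*F\to R\gamma_*F[1]$. Then $\gamma_*\mathbb Z\cong\mathbb Z$. Moreover the total right derived functor $R\gamma_*:D(\mathcal T_G)\to D(\mathcal T_{\hat G})$ (compatible with shifts) exists, and the following hold. 1. $R^1\gamma_*\mathbb Z\cong\mathbb Q$, and $R\gamma_*\mathbb Q\cong\mathbb Q\oplus\mathbb Q[-1]$. 2. For every complex $\mathcal G$ of sheaves in $\mathcal T_{\hat G}$, the canonical map $u:\mathcal G\to R\gamma_*\gamma^*\mathcal G$ given by adjunction fits into a distinguished triangle $$\mathcal G\xrightarrow{u}R\gamma_*\gamma^*\mathcal G\to(\mathcal G\otimes\mathbb Q)[-1]\xrightarrow{\delta}\mathcal G[1].$$ 3. If all cohomology sheaves of $\mathcal G$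 are torsion, then $u:\mathcal G\to R\gamma_*\gamma^*\mathcal G$ is an isomorphism. 4. If all cohomology sheaves of $\mathcal G$ are sheaves of $\mathbb Q$-vector spaces, then there is an isomorphism $\Phi:R\gamma_*\gamma^*\mathcal G\cong\mathcal G\oplus\mathcal G[-1]$ such that $\Phi\circ u$ is the inclusion of the first summand and such that, under $\Phi$, cup product with $e$ is multiplication by the matrix $\begin{pmatrix}0&0\\1&0\end{pmatrix}$, i.e. the composite $\mathcal G\oplus\mathcal G[-1]\to\mathcal G=(\mathcal G[-1])[1]\to(\mathcal G\oplus\mathcal G[-1])[1]$ of the projection and the inclusion. -/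

import Mathlib

open CategoryTheory Limits AlgebraicGeometry

universe w₁ w₂ u

set_option linter.unusedSectionVars false

namespace WeilEtale

section Geometry

variable (k : Type u) [Field k] [Fintype k] (K : Type u) [Field K] [Algebra k K]
  [IsAlgClosure k K]

/-- The arithmetic Frobenius `φ : x ↦ x ^ q` in the Galois group of `K` over `k = 𝔽_q`. -/
noncomputable def frob : Gal(K/k) := FiniteField.frobeniusAlgEquivOfAlgebraic k K

/-- The automorphism of `Spec K` given by the ring automorphism `φ ^ (-n)` of `K`. -/
noncomputable def frobSpec (n : ℤ) : Spec (.of K) ⟶ Spec (.of K) :=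
  Spec.map (CommRingCat.ofHom ((frob k K ^ (-n) : Gal(K/k)) : K →+* K))

/-- The structure morphism `Spec K ⟶ Spec k`. -/
noncomputable def specBase : Spec (.of K) ⟶ Spec (.of k) :=
  Spec.map (CommRingCat.ofHom (algebraMap k K))

lemma frobSpec_zero : frobSpec k K 0 = 𝟙 _ := by
  have : CommRingCat.ofHom ((frob k K ^ (-0 : ℤ) : Gal(K/k)) : K →+* K) = 𝟙 _ := by
    ext x; simp
  rw [frobSpec, this, Spec.map_id]

lemma frobSpec_add (m n : ℤ) : frobSpec k K (m + n) = frobSpec k K m ≫ frobSpec k K n := by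
  rw [frobSpec, frobSpec, frobSpec, ← Spec.map_comp]
  congr 1
  ext x
  have : (frob k K) ^ (-(m + n)) = frob k K ^ (-m) * frob k K ^ (-n) := by
    rw [← zpow_add]; congr 1; ring
  rw [this]
  rfl

lemma frobSpec_specBase (n : ℤ) : frobSpec k K n ≫ specBase k K = specBase k K := by
  rw [frobSpec, specBase, ← Spec.map_comp]
  congr 1
  ext x
  exact (frob k K ^ (-n)).commutes x

end Geometry

section Sites

variable {k : Type u} [Field k] [Fintype k]
  {S : Scheme.{u}} (s : S ⟶ Spec (.of k)) {E : Type u} [SmallCategory E] (ι : E ⥤ Over S)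

/-- `ι` identifies `E` with a full subcategory of the category of `S`-schemes which are separated
and of finite type over the finite field `k`, such that every `U` which is étale and of finite type
over a member of `E` (and separated over `k`) belongs to `E`. -/
class IsEtaleFamily : Prop where
  full : ι.Full
  faithful : ι.Faithful
  separated (V : E) : IsSeparated ((ι.obj V).hom ≫ s)
  locallyOfFiniteType (V : E) : LocallyOfFiniteType ((ι.obj V).hom ≫ s)
  quasiCompact (V : E) : QuasiCompact ((ι.obj V).hom ≫ s)
  etale_mem (V : E) (U : Over S) (f : U ⟶ ι.obj V) : Etale f.left → QuasiCompact f.left →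
    IsSeparated (U.hom ≫ s) → ι.essImage U

/-- The étale topology on `E`: the coverings are the jointly surjective families of étale
morphisms. -/
def etaleTopology : GrothendieckTopology E :=
  (Scheme.etalePrecoverage.comap (ι ⋙ Over.forget S)).toGrothendieck

variable (K : Type u) [Field K] [Algebra k K] [IsAlgClosure k K]

/-- The base change `V̄ = V ×_k K`. -/
noncomputable def bar (V : E) : Scheme.{u} :=
  pullback ((ι.obj V).hom ≫ s) (specBase k K)

/-- The projection `V̄ ⟶ V`. -/
noncomputable def barFst (V : E) : bar s ι K V ⟶ (ι.obj V).left := pullback.fst _ _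

/-- The projection `V̄ ⟶ Spec K`. -/
noncomputable def barSnd (V : E) : bar s ι K V ⟶ Spec (.of K) := pullback.snd _ _

lemma bar_isPullback (V : E) :
    IsPullback (barSnd s ι K V) (barFst s ι K V) (specBase k K) ((ι.obj V).hom ≫ s) :=
  (IsPullback.of_hasPullback _ _).flip

/-- The objects of the geometric site: open and closed subschemes `Z` of the base changes `V̄` of
members `V` of `E` (that is, unions of connected components of the schemes `V̄`). -/
structure Geom where
  V : E
  Z : (bar s ι K V).Opens
  isClosed : IsClosed (Z : Set (bar s ι K V))

namespace Geom

variable {s ι K}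

/-- The underlying scheme. -/
noncomputable def scheme (U : Geom s ι K) : Scheme.{u} := U.Z.toScheme

/-- The inclusion into `V̄`. -/
noncomputable def toBar (U : Geom s ι K) : U.scheme ⟶ bar s ι K U.V := U.Z.ι

/-- The structure morphism to `Spec K`. -/
noncomputable def toK (U : Geom s ι K) : U.scheme ⟶ Spec (.of K) := U.toBar ≫ barSnd s ι K U.V

/-- The structure morphism to `S`. -/
noncomputable def toS (U : Geom s ι K) : U.scheme ⟶ S :=
  U.toBar ≫ barFst s ι K U.V ≫ (ι.obj U.V).hom

/-- Morphisms `U ⟶ U'`: an integer `n` and a morphism of `S`-schemes `U ⟶ U'` lying over the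
automorphism of `Spec K` given by the `n`-th power of the Frobenius. Those with `n = 0` are the
morphisms of schemes over `K` (and `S`); the other ones encode the action of the group `G ≅ ℤ`
generated by the Frobenius, so that presheaves on this category are the presheaves on the geometric
category together with an action of `G`. -/
@[ext]
structure Hom (U U' : Geom s ι K) where
  deg : ℤ
  left : U.scheme ⟶ U'.scheme
  comp_toK : left ≫ U'.toK = U.toK ≫ frobSpec k K deg
  comp_toS : left ≫ U'.toS = U.toS

noncomputable instance : SmallCategory (Geom s ι K) where
  Hom U U' := Hom U U'
  id U := ⟨0, 𝟙 _, by simp [frobSpec_zero], by simp⟩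
  comp f g := ⟨f.deg + g.deg, f.left ≫ g.left, by
    rw [Category.assoc, g.comp_toK, reassoc_of% f.comp_toK, frobSpec_add], by
    rw [Category.assoc, g.comp_toS, f.comp_toS]⟩
  id_comp f := Hom.ext (zero_add _) (Category.id_comp _)
  comp_id f := Hom.ext (add_zero _) (Category.comp_id _)
  assoc f g h := Hom.ext (add_assoc _ _ _) (Category.assoc _ _ _)

/-- The power of `φ` through which a morphism acts on `K`. -/
def deg {U U' : Geom s ι K} (f : U ⟶ U') : ℤ := Hom.deg f

/-- The morphism of schemes underlying a morphism. -/
noncomputable def left {U U' : Geom s ι K} (f : U ⟶ U') : U.scheme ⟶ U'.scheme := Hom.left f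

lemma left_toK {U U' : Geom s ι K} (f : U ⟶ U') :
    left f ≫ U'.toK = U.toK ≫ frobSpec k K (deg f) := Hom.comp_toK f

lemma left_toS {U U' : Geom s ι K} (f : U ⟶ U') : left f ≫ U'.toS = U.toS := Hom.comp_toS f

lemma hom_ext {U U' : Geom s ι K} {f g : U ⟶ U'} (h : deg f = deg g)
    (h' : left f = left g) : f = g := Hom.ext h h'

@[simp] lemma deg_id (U : Geom s ι K) : deg (𝟙 U) = 0 := rfl
@[simp] lemma left_id (U : Geom s ι K) : left (𝟙 U) = 𝟙 _ := rfl
@[simp] lemma deg_comp {U U' U'' : Geom s ι K} (f : U ⟶ U') (g : U' ⟶ U'') :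
    deg (f ≫ g) = deg f + deg g := rfl
@[simp] lemma left_comp {U U' U'' : Geom s ι K} (f : U ⟶ U') (g : U' ⟶ U'') :
    left (f ≫ g) = left f ≫ left g := rfl

variable (s ι K) in
/-- The functor to schemes. -/
@[simps]
noncomputable def forget : Geom s ι K ⥤ Scheme.{u} where
  obj U := U.scheme
  map f := left f

end Geom

/-- The étale topology on the geometric category: the coverings are the jointly surjective families
of étale morphisms. Sheaves for it are the étale sheaves on the geometric category together with
an action of the group generated by the Frobenius. -/
noncomputable def weilTopology : GrothendieckTopology (Geom s ι K) :=
  (Scheme.etalePrecoverage.comap (Geom.forget s ι K)).toGrothendieck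

/-- The base change `V̄` as an object of the geometric category. -/
noncomputable def barObj (V : E) : Geom s ι K := ⟨V, ⊤, isClosed_univ⟩

/-- The underlying scheme of `barObj V` is `V̄`. -/
noncomputable def barIso (V : E) : (barObj s ι K V).scheme ≅ bar s ι K V :=
  Scheme.topIso _

lemma barObj_toK (V : E) :
    (barObj s ι K V).toK = (barIso s ι K V).hom ≫ barSnd s ι K V := rfl

lemma barObj_toS (V : E) :
    (barObj s ι K V).toS = (barIso s ι K V).hom ≫ barFst s ι K V ≫ (ι.obj V).hom := rfl

/-- The morphism `V̄ ⟶ V̄'` induced by `f : V ⟶ V'` and the `n`-th power of the Frobenius of `K`. -/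
noncomputable def barMap {V V' : E} (f : V ⟶ V') (n : ℤ) : bar s ι K V ⟶ bar s ι K V' :=
  (bar_isPullback s ι K V').lift (barSnd s ι K V ≫ frobSpec k K n)
    (barFst s ι K V ≫ (ι.map f).left)
    (by simp [frobSpec_specBase, (bar_isPullback s ι K V).w])

@[simp]
lemma barMap_snd {V V' : E} (f : V ⟶ V') (n : ℤ) :
    barMap s ι K f n ≫ barSnd s ι K V' = barSnd s ι K V ≫ frobSpec k K n := by
  simp [barMap]

@[simp]
lemma barMap_fst {V V' : E} (f : V ⟶ V') (n : ℤ) :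
    barMap s ι K f n ≫ barFst s ι K V' = barFst s ι K V ≫ (ι.map f).left := by
  simp [barMap]

@[simp]
lemma barMap_snd_assoc {V V' : E} (f : V ⟶ V') (n : ℤ) {T : Scheme.{u}} (h : _ ⟶ T) :
    barMap s ι K f n ≫ barSnd s ι K V' ≫ h = barSnd s ι K V ≫ frobSpec k K n ≫ h := by
  rw [← Category.assoc, barMap_snd, Category.assoc]

@[simp]
lemma barMap_fst_assoc {V V' : E} (f : V ⟶ V') (n : ℤ) {T : Scheme.{u}} (h : _ ⟶ T) :
    barMap s ι K f n ≫ barFst s ι K V' ≫ h = barFst s ι K V ≫ (ι.map f).left ≫ h := by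
  rw [← Category.assoc, barMap_fst, Category.assoc]

lemma barMap_comp {V V' V'' : E} (f : V ⟶ V') (g : V' ⟶ V'') (m n : ℤ) :
    barMap s ι K (f ≫ g) (m + n) = barMap s ι K f m ≫ barMap s ι K g n := by
  apply (bar_isPullback s ι K V'').hom_ext <;> simp [frobSpec_add]

lemma barMap_id (V : E) : barMap s ι K (𝟙 V) 0 = 𝟙 _ := by
  apply (bar_isPullback s ι K V).hom_ext <;> simp [frobSpec_zero]

/-- `barMap f n` as a morphism of the geometric category. -/
noncomputable def twist {V V' : E} (f : V ⟶ V') (n : ℤ) : barObj s ι K V ⟶ barObj s ι K V' where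
  deg := n
  left := (barIso s ι K V).hom ≫ barMap s ι K f n ≫ (barIso s ι K V').inv
  comp_toK := by simp [barObj_toK]
  comp_toS := by simp [barObj_toS]

@[simp] lemma deg_twist {V V' : E} (f : V ⟶ V') (n : ℤ) : Geom.deg (twist s ι K f n) = n := rfl

@[simp] lemma left_twist {V V' : E} (f : V ⟶ V') (n : ℤ) : Geom.left (twist s ι K f n) =
    (barIso s ι K V).hom ≫ barMap s ι K f n ≫ (barIso s ι K V').inv := rfl

lemma twist_comp {V V' V'' : E} (f : V ⟶ V') (g : V' ⟶ V'') (m n : ℤ) :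
    twist s ι K (f ≫ g) (m + n) = twist s ι K f m ≫ twist s ι K g n := by
  apply Geom.hom_ext
  · rfl
  · simp [barMap_comp]

/-- The functor `V ↦ V̄`. -/
noncomputable def barFunctor : E ⥤ Geom s ι K where
  obj V := barObj s ι K V
  map f := twist s ι K f 0
  map_id V := Geom.hom_ext rfl (by simp [barMap_id])
  map_comp f g := twist_comp s ι K f g 0 0

lemma barFunctor_map_left {V V' : E} (f : V ⟶ V') :
    Geom.left ((barFunctor s ι K).map f) =
      (barIso s ι K V).hom ≫ barMap s ι K f 0 ≫ (barIso s ι K V').inv := rfl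

/-- The Frobenius automorphism of `V̄ = V ×_k K` (acting through the factor `K`). -/
noncomputable def frobBar : barFunctor s ι K ⟶ barFunctor s ι K where
  app V := twist s ι K (𝟙 V) 1
  naturality V V' f := by
    dsimp [barFunctor]
    rw [← twist_comp, ← twist_comp]
    simp

lemma barMap_isPullback {V V' : E} (f : V ⟶ V') :
    IsPullback (barMap s ι K f 0) (barFst s ι K V) (barFst s ι K V') (ι.map f).left := by
  refine IsPullback.of_right ?_ (barMap_fst s ι K f 0) (bar_isPullback s ι K V')
  simpa [frobSpec_zero] using bar_isPullback s ι K V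

lemma barMap_square {P Y Z X : E} {p : P ⟶ Y} {q : P ⟶ Z} {f : Y ⟶ X} {g : Z ⟶ X}
    (h : IsPullback (ι.map p).left (ι.map q).left (ι.map f).left (ι.map g).left) :
    IsPullback (barMap s ι K p 0) (barMap s ι K q 0) (barMap s ι K f 0) (barMap s ι K g 0) := by
  refine (IsPullback.of_right (h₁₂ := barFst s ι K Z) (h₂₂ := barFst s ι K X)
    (v₁₃ := (ι.map g).left) (h₁₁ := barMap s ι K q 0) (h₂₁ := barMap s ι K f 0) ?_ ?_ ?_).flip
  · have := (barMap_isPullback s ι K p).flip.paste_horiz h.flip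
    simpa using this
  · apply (bar_isPullback s ι K X).hom_ext
    · simp
    · simpa using congrArg (barFst s ι K P ≫ ·) h.w.symm
  · exact (barMap_isPullback s ι K g).flip

lemma barFunctor_isPullback {P Y Z X : E} {p : P ⟶ Y} {q : P ⟶ Z} {f : Y ⟶ X} {g : Z ⟶ X}
    (w : p ≫ f = q ≫ g)
    (h : IsPullback (ι.map p).left (ι.map q).left (ι.map f).left (ι.map g).left) :
    IsPullback ((barFunctor s ι K).map p) ((barFunctor s ι K).map q)
      ((barFunctor s ι K).map f) ((barFunctor s ι K).map g) := by
  have H : IsPullback (Geom.left ((barFunctor s ι K).map p)) (Geom.left ((barFunctor s ι K).map q))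
      (Geom.left ((barFunctor s ι K).map f)) (Geom.left ((barFunctor s ι K).map g)) :=
    (barMap_square s ι K h).of_iso (barIso s ι K P).symm (barIso s ι K Y).symm
      (barIso s ι K Z).symm (barIso s ι K X).symm (by simp [barFunctor]) (by simp [barFunctor])
      (by simp [barFunctor]) (by simp [barFunctor])
  have hd {A B : E} (a : A ⟶ B) : Geom.deg ((barFunctor s ι K).map a) = 0 := rfl
  have key (T : Geom s ι K) (a : T ⟶ (barFunctor s ι K).obj Y) (b : T ⟶ (barFunctor s ι K).obj Z)
      (hab : a ≫ (barFunctor s ι K).map f = b ≫ (barFunctor s ι K).map g) :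
      ∃ l : T ⟶ (barFunctor s ι K).obj P,
        l ≫ (barFunctor s ι K).map p = a ∧ l ≫ (barFunctor s ι K).map q = b := by
    have c : Geom.left a ≫ Geom.left ((barFunctor s ι K).map f) =
      Geom.left b ≫ Geom.left ((barFunctor s ι K).map g) := congrArg Geom.left hab
    have d : Geom.deg a = Geom.deg b := by simpa [hd] using congrArg Geom.deg hab
    refine ⟨⟨Geom.deg a, H.lift _ _ c, ?_, ?_⟩, ?_, ?_⟩
    · have := Geom.left_toK ((barFunctor s ι K).map p)
      rw [hd, frobSpec_zero, Category.comp_id] at this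
      rw [← this, H.lift_fst_assoc]
      exact Geom.left_toK a
    · rw [← Geom.left_toS ((barFunctor s ι K).map p), H.lift_fst_assoc]
      exact Geom.left_toS a
    · exact Geom.hom_ext (add_zero _) (H.lift_fst _ _ _)
    · exact Geom.hom_ext ((add_zero _).trans d) (H.lift_snd _ _ _)
  choose l hl₁ hl₂ using key
  refine ⟨⟨by simp only [← Functor.map_comp, w]⟩, ⟨PullbackCone.IsLimit.mk _
    (fun t ↦ l t.pt t.fst t.snd t.condition) (fun t ↦ hl₁ _ _ _ _) (fun t ↦ hl₂ _ _ _ _) ?_⟩⟩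
  intro t m h₁ h₂
  refine Geom.hom_ext ?_ (H.hom_ext ?_ ?_)
  · simpa [hd] using congrArg Geom.deg (h₁.trans (hl₁ t.pt t.fst t.snd t.condition).symm)
  · exact congrArg Geom.left (h₁.trans (hl₁ t.pt t.fst t.snd t.condition).symm)
  · exact congrArg Geom.left (h₂.trans (hl₂ t.pt t.fst t.snd t.condition).symm)

variable [IsEtaleFamily s ι]

lemma exists_isPullback (hE : IsEtaleFamily s ι) {Y Z X : E} (f : Y ⟶ X) (g : Z ⟶ X) (hg : Etale (ι.map g).left) :
    ∃ (P : E) (p : P ⟶ Y) (q : P ⟶ Z), IsPullback p q f g ∧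
      IsPullback (ι.map p).left (ι.map q).left (ι.map f).left (ι.map g).left := by
  have := hE.full
  have := hE.faithful
  have := hE.separated
  have := hE.quasiCompact
  have e : (ι.map g).left ≫ (ι.obj X).hom ≫ s = (ι.obj Z).hom ≫ s := by simp
  have : IsSeparated (ι.map g).left := by
    have : IsSeparated ((ι.map g).left ≫ (ι.obj X).hom ≫ s) := by rw [e]; infer_instance
    exact IsSeparated.of_comp _ ((ι.obj X).hom ≫ s)
  have : QuasiCompact (ι.map g).left := by
    have : QuasiCompact ((ι.map g).left ≫ (ι.obj X).hom ≫ s) := by rw [e]; infer_instance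
    exact QuasiCompact.of_comp _ ((ι.obj X).hom ≫ s)
  let U : Over S := Over.mk (pullback.fst (ι.map f).left (ι.map g).left ≫ (ι.obj Y).hom)
  let a : U ⟶ ι.obj Y := Over.homMk (pullback.fst _ _) rfl
  let b : U ⟶ ι.obj Z := Over.homMk (pullback.snd _ _) (by
    simp [U, ← Over.w (ι.map f), ← Over.w (ι.map g), pullback.condition_assoc, -Over.w])
  obtain ⟨P, ⟨e⟩⟩ := hE.etale_mem Y U a (inferInstanceAs (Etale (pullback.fst _ _)))
    (inferInstanceAs (QuasiCompact (pullback.fst _ _))) (by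
      simp only [U, Over.mk_hom, Category.assoc]; infer_instance)
  have e' : e.inv.left ≫ e.hom.left = 𝟙 _ := by
    rw [← Over.comp_left, e.inv_hom_id, Over.id_left]
  have h1 : IsPullback (ι.map (ι.preimage (e.hom ≫ a))).left (ι.map (ι.preimage (e.hom ≫ b))).left
      (ι.map f).left (ι.map g).left := by
    refine (IsPullback.of_hasPullback (ι.map f).left (ι.map g).left).of_iso
      ((Over.forget S).mapIso e.symm) (Iso.refl _) (Iso.refl _) (Iso.refl _) ?_ ?_ ?_ ?_
    · rw [ι.map_preimage, Over.comp_left]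
      change _ ≫ 𝟙 _ = e.inv.left ≫ e.hom.left ≫ pullback.fst _ _
      rw [reassoc_of% e', Category.comp_id]
    · rw [ι.map_preimage, Over.comp_left]
      change _ ≫ 𝟙 _ = e.inv.left ≫ e.hom.left ≫ pullback.snd _ _
      rw [reassoc_of% e', Category.comp_id]
    all_goals simp
  have w : ι.preimage (e.hom ≫ a) ≫ f = ι.preimage (e.hom ≫ b) ≫ g := by
    apply ι.map_injective
    apply (Over.forget S).map_injective
    simpa using h1.w
  refine ⟨P, _, _, ?_, h1⟩
  exact IsPullback.of_map (ι ⋙ Over.forget S) w h1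


lemma hasPullback_and_preserves {Y Z X : E} (f : Y ⟶ X) (g : Z ⟶ X)
    (hg : Etale (ι.map g).left) :
    HasPullback f g ∧ Nonempty (PreservesLimit (cospan f g) (barFunctor s ι K)) := by
  obtain ⟨P, p, q, h, h'⟩ := exists_isPullback s ι ‹_› f g hg
  exact ⟨h.hasPullback, ⟨preservesLimit_of_preserves_limit_cone h.isLimit
    ((isLimitMapConePullbackConeEquiv (barFunctor s ι K) h.w).symm
      (barFunctor_isPullback s ι K h.w h').isLimit)⟩⟩

lemma barObj_isPullback {V V' : E} (f : V ⟶ V') :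
    IsPullback (Geom.left (twist s ι K f 0)) ((barIso s ι K V).hom ≫ barFst s ι K V)
      ((barIso s ι K V').hom ≫ barFst s ι K V') (ι.map f).left :=
  (barMap_isPullback s ι K f).of_iso (barIso s ι K _).symm (barIso s ι K _).symm
      (Iso.refl _) (Iso.refl _) (by simp) (by simp) (by simp) (by simp)

instance : Scheme.etalePrecoverage.{u}.IsStableUnderBaseChange :=
  have := Scheme.isJointlySurjectivePreserving.{u} @Etale.{u}
  Scheme.instIsStableUnderBaseChangePrecoverageOfIsJointlySurjectivePreservingOfIsStableUnderBaseChange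
    @Etale.{u}

instance : (barFunctor s ι K).IsContinuous (etaleTopology ι) (weilTopology s ι K) where
  op_comp_isSheaf_of_types := by
    rintro ⟨G, hG⟩
    rw [isSheaf_iff_isSheaf_of_type] at hG
    rw [etaleTopology, Precoverage.isSheaf_toGrothendieck_iff]
    intro X Y f R hR
    obtain ⟨I, Z, g, rfl⟩ := R.exists_eq_ofArrows
    rw [Precoverage.mem_comap_iff, Presieve.map_ofArrows] at hR
    have hR2 : ∀ i, Etale (ι.map (g i)).left :=
      ((Scheme.ofArrows_mem_precoverage_iff _).1 hR).2
    choose P p q h h' using fun i ↦ exists_isPullback s ι ‹_› f (g i) (hR2 i)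
    have hP := Precoverage.mem_coverings_of_isPullback _ hR (ι.map f).left
      (fun i ↦ (ι.map (p i)).left) (fun i ↦ (ι.map (q i)).left) h'
    have he : ∀ i, Etale (ι.map (p i)).left := ((Scheme.ofArrows_mem_precoverage_iff _).1 hP).2
    rw [← Sieve.ofArrows, ← Sieve.ofArrows_eq_pullback_of_isPullback _ h, Sieve.ofArrows,
      ← Presieve.isSheafFor_iff_generate]
    have : (Presieve.ofArrows P p).HasPairwisePullbacks :=
      ⟨by rintro _ _ _ ⟨i⟩ _ ⟨j⟩; exact (hasPullback_and_preserves s ι K _ _ (he j)).1⟩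
    have : (barFunctor s ι K).PreservesPairwisePullbacks (Presieve.ofArrows P p) :=
      ⟨by rintro _ _ _ _ ⟨i⟩ ⟨j⟩; exact (hasPullback_and_preserves s ι K _ _ (he j)).2.some⟩
    rw [Presieve.IsSheafFor.comp_iff_of_preservesPairwisePullbacks, Presieve.map_ofArrows]
    apply hG.isSheafFor_of_mem_precoverage
    rw [Precoverage.mem_comap_iff, Presieve.map_ofArrows]
    refine Precoverage.mem_coverings_of_isPullback _ hP
      ((barIso s ι K Y).hom ≫ barFst s ι K Y) _
      (fun i ↦ (barIso s ι K (P i)).hom ≫ barFst s ι K (P i)) (fun i ↦ ?_)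
    exact barObj_isPullback s ι K (p i)

end Sites
section Invariants

variable {C : Type*} {D : Type*} [Category C] [Category D] {L : C ⥤ D} {R : D ⥤ C}
  (adj : L ⊣ R) (τ : R ⟶ R) [HasEqualizers C] [HasCoequalizers D]

lemma homEquiv_conjugate {X : C} {Y : D} (f : L.obj X ⟶ Y) :
    adj.homEquiv X Y (((conjugateEquiv adj adj).symm τ).app X ≫ f) =
      adj.homEquiv X Y f ≫ τ.app Y := by
  have := unit_conjugateEquiv_symm adj adj τ X
  rw [Adjunction.homEquiv_unit, Adjunction.homEquiv_unit, Functor.map_comp,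
    ← Category.assoc, ← this, Category.assoc, Category.assoc, τ.naturality]

/-- The invariants are computed objectwise. -/
noncomputable def equalizerAppIsLimit (τ : R ⟶ R) (Y : D) :
    IsLimit (Fork.ofι ((equalizer.ι τ (𝟙 R)).app Y)
      (show _ ≫ τ.app Y = _ ≫ 𝟙 (R.obj Y) from congr_app (equalizer.condition τ (𝟙 R)) Y)) :=
  isLimitForkMapOfIsLimit ((evaluation D C).obj Y) _ (equalizerIsEqualizer τ (𝟙 R))

/-- The coinvariants are computed objectwise. -/
noncomputable def coequalizerAppIsColimit (σ : L ⟶ L) (X : C) :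
    IsColimit (Cofork.ofπ ((coequalizer.π σ (𝟙 L)).app X)
      (show σ.app X ≫ _ = 𝟙 (L.obj X) ≫ _ from
        congr_app (coequalizer.condition σ (𝟙 L)) X)) :=
  isColimitCoforkMapOfIsColimit ((evaluation C D).obj X) _ (coequalizerIsCoequalizer σ (𝟙 L))

/-- The bijection on morphisms for `equalizerAdjunction`. -/
noncomputable def equalizerHomEquiv (X : C) (Y : D) :
    ((coequalizer ((conjugateEquiv adj adj).symm τ) (𝟙 L)).obj X ⟶ Y) ≃
      (X ⟶ (equalizer τ (𝟙 R)).obj Y) where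
  toFun f := Fork.IsLimit.lift (equalizerAppIsLimit τ Y)
    (adj.homEquiv X Y ((coequalizer.π ((conjugateEquiv adj adj).symm τ) (𝟙 L)).app X ≫ f)) (by
      rw [← homEquiv_conjugate, Category.comp_id]
      congr 1
      have := congr_app (coequalizer.condition ((conjugateEquiv adj adj).symm τ) (𝟙 L)) X
      rw [NatTrans.comp_app, NatTrans.comp_app, NatTrans.id_app, Category.id_comp] at this
      rw [← Category.assoc, this])
  invFun g := Cofork.IsColimit.desc
    (coequalizerAppIsColimit ((conjugateEquiv adj adj).symm τ) X)
    ((adj.homEquiv X Y).symm (g ≫ (equalizer.ι τ (𝟙 R)).app Y)) (by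
      apply (adj.homEquiv X Y).injective
      have := congr_app (equalizer.condition τ (𝟙 R)) Y
      rw [NatTrans.comp_app, NatTrans.comp_app, NatTrans.id_app, Category.comp_id] at this
      rw [homEquiv_conjugate, Category.id_comp, Equiv.apply_symm_apply, Category.assoc, this])
  left_inv f := by
    apply Cofork.IsColimit.hom_ext (coequalizerAppIsColimit ((conjugateEquiv adj adj).symm τ) X)
    rw [Cofork.IsColimit.π_desc']
    apply (adj.homEquiv X Y).injective
    rw [Equiv.apply_symm_apply]
    exact Fork.IsLimit.lift_ι' (equalizerAppIsLimit τ Y) _ _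
  right_inv g := by
    apply Fork.IsLimit.hom_ext (equalizerAppIsLimit τ Y)
    rw [Fork.IsLimit.lift_ι']
    apply (adj.homEquiv X Y).symm.injective
    rw [Equiv.symm_apply_apply]
    exact Cofork.IsColimit.π_desc'
      (coequalizerAppIsColimit ((conjugateEquiv adj adj).symm τ) X) _ _

lemma equalizerHomEquiv_ι {X : C} {Y : D}
    (f : (coequalizer ((conjugateEquiv adj adj).symm τ) (𝟙 L)).obj X ⟶ Y) :
    equalizerHomEquiv adj τ X Y f ≫ (equalizer.ι τ (𝟙 R)).app Y = adj.homEquiv X Y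
      ((coequalizer.π ((conjugateEquiv adj adj).symm τ) (𝟙 L)).app X ≫ f) :=
  Fork.IsLimit.lift_ι' (equalizerAppIsLimit τ Y) _ _

/-- If `L` is left adjoint to `R`, the coinvariants on `L` of an endomorphism are left adjoint to
the invariants on `R` of the conjugate endomorphism. -/
noncomputable def equalizerAdjunction :
    coequalizer ((conjugateEquiv adj adj).symm τ) (𝟙 L) ⊣ equalizer τ (𝟙 R) :=
  Adjunction.mkOfHomEquiv
    { homEquiv := equalizerHomEquiv adj τ
      homEquiv_naturality_left_symm := by
        intro X' X Y f g
        apply (equalizerHomEquiv adj τ X' Y).injective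
        rw [Equiv.apply_symm_apply]
        apply Fork.IsLimit.hom_ext (equalizerAppIsLimit τ Y)
        obtain ⟨g, rfl⟩ := (equalizerHomEquiv adj τ X Y).surjective g
        rw [Equiv.symm_apply_apply]
        change (_ ≫ _) ≫ (equalizer.ι τ (𝟙 R)).app Y = _ ≫ (equalizer.ι τ (𝟙 R)).app Y
        rw [Category.assoc, equalizerHomEquiv_ι, equalizerHomEquiv_ι, ← NatTrans.naturality_assoc,
          Adjunction.homEquiv_naturality_left]
      homEquiv_naturality_right := by
        intro X Y Y' f g
        apply Fork.IsLimit.hom_ext (equalizerAppIsLimit τ Y')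
        change _ ≫ (equalizer.ι τ (𝟙 R)).app Y' = (_ ≫ _) ≫ (equalizer.ι τ (𝟙 R)).app Y'
        rw [Category.assoc, NatTrans.naturality, ← Category.assoc, equalizerHomEquiv_ι,
          equalizerHomEquiv_ι, ← Category.assoc, Adjunction.homEquiv_naturality_right] }

lemma additive_equalizer [Preadditive C] [Preadditive D] [R.Additive] :
    (equalizer τ (𝟙 R)).Additive where
  map_add {X Y f g} := by
    apply Fork.IsLimit.hom_ext (equalizerAppIsLimit τ Y)
    change _ ≫ (equalizer.ι τ (𝟙 R)).app Y = _ ≫ (equalizer.ι τ (𝟙 R)).app Y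
    rw [Preadditive.add_comp, NatTrans.naturality, NatTrans.naturality, NatTrans.naturality,
      Functor.map_add, Preadditive.comp_add]

end Invariants

section TensorN

variable {k : Type u} [Field k] [Fintype k]
  {S : Scheme.{u}} (s : S ⟶ Spec (.of k)) {E : Type u} [SmallCategory E] (ι : E ⥤ Over S)
  (K : Type u) [Field K] [Algebra k K] [IsAlgClosure k K]

/-- The category of abelian étale sheaves on `E`. -/
abbrev EtaleSheaf := Sheaf (etaleTopology ι) AddCommGrpCat.{u}
/-- The category of abelian étale sheaves on the geometric category with an action of the group
`G ≅ ℤ` generated by the Frobenius. -/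
abbrev WeilSheaf := Sheaf (weilTopology s ι K) AddCommGrpCat.{u}

variable {s ι K}

/-- The presheaf `F ⊗ N`, where `N` is the constant sheaf `ℤ ⊕ ℤ` on which the `n`-th power of the
Frobenius acts by `(r, s) ↦ (r + n s, s)`: its sections are `F(U) ⊕ F(U)`, and a morphism lying over
the `n`-th power of the Frobenius acts by `(r, s) ↦ (f^* r + n f^* s, f^* s)`. -/
noncomputable def tensorNPresheaf (F : (Geom s ι K)ᵒᵖ ⥤ AddCommGrpCat.{u}) :
    (Geom s ι K)ᵒᵖ ⥤ AddCommGrpCat.{u} where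
  obj U := .of (F.obj U × F.obj U)
  map f := AddCommGrpCat.ofHom (AddMonoidHom.mk'
    (fun x ↦ (F.map f x.1 + Geom.deg f.unop • F.map f x.2, F.map f x.2))
    (fun x y ↦ by ext <;> simp; abel))
  map_id U := by ext x <;> simp
  map_comp f g := by
    ext x
    · simp [add_smul]; abel
    · simp

@[simp] lemma tensorNPresheaf_map_fst (F : (Geom s ι K)ᵒᵖ ⥤ AddCommGrpCat.{u}) {U V}
    (f : U ⟶ V) (x : (F.obj U × F.obj U :)) :
  ((tensorNPresheaf F).map f x).1 = F.map f x.1 + Geom.deg f.unop • F.map f x.2 := rfl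

@[simp] lemma tensorNPresheaf_map_snd (F : (Geom s ι K)ᵒᵖ ⥤ AddCommGrpCat.{u}) {U V}
    (f : U ⟶ V) (x : (F.obj U × F.obj U :)) :
  ((tensorNPresheaf F).map f x).2 = F.map f x.2 := rfl

lemma tensorNPresheaf_isSheaf (F : WeilSheaf s ι K) :
    Presheaf.IsSheaf (weilTopology s ι K) (tensorNPresheaf F.obj) := by
  have hF := F.property
  rw [Presheaf.isSheaf_iff_isSheaf_forget (s := CategoryTheory.forget AddCommGrpCat.{u}),
    isSheaf_iff_isSheaf_of_type] at hF ⊢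
  intro X T hT
  have hT' := hF T hT
  intro x hx
  rw [Presieve.compatible_iff_sieveCompatible] at hx
  let x' : ∀ ⦃Y⦄ (f : Y ⟶ X), T f → F.obj.obj (.op Y) × F.obj.obj (.op Y) := fun Y f hf ↦ x f hf
  have hx1 : ∀ ⦃Y Z⦄ (f : Y ⟶ X) (g : Z ⟶ Y) (hf : T f),
    (x' (g ≫ f) (T.downward_closed hf g)).1 = F.obj.map g.op (x' f hf).1 +
      Geom.deg g • F.obj.map g.op (x' f hf).2 := fun Y Z f g hf ↦ congrArg Prod.fst (hx f g hf)
  have hx2 : ∀ ⦃Y Z⦄ (f : Y ⟶ X) (g : Z ⟶ Y) (hf : T f),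
    (x' (g ≫ f) (T.downward_closed hf g)).2 = F.obj.map g.op (x' f hf).2 :=
    fun Y Z f g hf ↦ congrArg Prod.snd (hx f g hf)
  have key : ∀ y : ∀ ⦃Y⦄ (f : Y ⟶ X), T f → F.obj.obj (.op Y),
    (∀ ⦃Y Z⦄ (f : Y ⟶ X) (g : Z ⟶ Y) (hf : T f),
      y (g ≫ f) (T.downward_closed hf g) = F.obj.map g.op (y f hf)) →
      ∃! t : F.obj.obj (.op X), ∀ ⦃Y⦄ (f : Y ⟶ X) (hf : T f), F.obj.map f.op t = y f hf := by
    intro y hy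
    exact hT' y ((Presieve.compatible_iff_sieveCompatible _).2 fun Y Z f g hf ↦ hy f g hf)
  obtain ⟨b, hb, hb'⟩ := key (fun Y f hf ↦ (x' f hf).2) hx2
  obtain ⟨a, ha, ha'⟩ := key (fun Y f hf ↦ (x' f hf).1 - Geom.deg f • (x' f hf).2) (by
    intro Y Z f g hf
    dsimp only
    rw [hx1 f g hf, hx2 f g hf, Geom.deg_comp]
    simp only [map_sub, map_zsmul, add_smul]
    abel)
  refine ⟨((a, b) : F.obj.obj (.op X) × F.obj.obj (.op X)), ?_, ?_⟩
  · intro Y f hf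
    change ((F.obj.map f.op a + Geom.deg f • F.obj.map f.op b, F.obj.map f.op b) :
      F.obj.obj (.op Y) × F.obj.obj (.op Y)) = x' f hf
    rw [ha f hf, hb f hf]
    ext <;> simp
  · rintro ⟨a', b'⟩ h
    have h1 : ∀ ⦃Y⦄ (f : Y ⟶ X) (hf : T f), F.obj.map f.op a' +
      Geom.deg f • F.obj.map f.op b' = (x' f hf).1 := fun Y f hf ↦ congrArg Prod.fst (h f hf)
    have h2 : ∀ ⦃Y⦄ (f : Y ⟶ X) (hf : T f), F.obj.map f.op b' = (x' f hf).2 :=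
      fun Y f hf ↦ congrArg Prod.snd (h f hf)
    obtain rfl := hb' b' h2
    obtain rfl := ha' a' (fun Y f hf ↦ by
      dsimp only
      rw [← h1 f hf, ← h2 f hf]; abel)
    rfl

variable (s ι K)

/-- The functor `F ↦ F ⊗ N`. -/
noncomputable def tensorN : WeilSheaf s ι K ⥤ WeilSheaf s ι K where
  obj F := ⟨tensorNPresheaf F.obj, tensorNPresheaf_isSheaf F⟩
  map {F F'} a := ⟨{
    app U := AddCommGrpCat.ofHom (AddMonoidHom.prodMap (a.hom.app U).hom (a.hom.app U).hom)
    naturality U V f := by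
      refine AddCommGrpCat.hom_ext (AddMonoidHom.ext fun x ↦ ?_)
      have h (y : F.obj.obj U) : a.hom.app V (F.obj.map f y) = F'.obj.map f (a.hom.app U y) :=
        NatTrans.naturality_apply a.hom f y
      refine Prod.ext ?_ (h x.2)
      change a.hom.app V (F.obj.map f x.1 + Geom.deg f.unop • F.obj.map f x.2) =
        F'.obj.map f (a.hom.app U x.1) + Geom.deg f.unop • F'.obj.map f (a.hom.app U x.2)
      rw [map_add, map_zsmul, h, h] }⟩
  map_id F := by ext U x; rfl
  map_comp a b := by ext U x; rfl

instance : (tensorN s ι K).Additive where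
  map_add := by intros; ext U x; rfl

/-- The inclusion `F ⟶ F ⊗ N`. -/
noncomputable def toTensorN : 𝟭 _ ⟶ tensorN s ι K where
  app F := ⟨{
    app U := AddCommGrpCat.ofHom (AddMonoidHom.inl (F.obj.obj U) (F.obj.obj U))
    naturality U V f := by
      refine AddCommGrpCat.hom_ext (AddMonoidHom.ext fun x ↦ Prod.ext ?_ ?_)
      · change F.obj.map f x = F.obj.map f x + Geom.deg f.unop • F.obj.map f 0
        rw [map_zero, smul_zero, add_zero]
      · change 0 = F.obj.map f 0
        rw [map_zero] }⟩
  naturality F F' f := by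
    ext U x
    exact Prod.ext rfl (map_zero (f.hom.app U).hom).symm

/-- The projection `F ⊗ N ⟶ F`. -/
noncomputable def ofTensorN : tensorN s ι K ⟶ 𝟭 _ where
  app F := ⟨{
    app U := AddCommGrpCat.ofHom (AddMonoidHom.snd (F.obj.obj U) (F.obj.obj U))
    naturality U V f := by ext x; rfl }⟩
  naturality F F' f := by ext U x; rfl

/-- The sequence `0 ⟶ F ⟶ F ⊗ N ⟶ F ⟶ 0`. -/
noncomputable def tensorNSequence (F : WeilSheaf s ι K) : ShortComplex (WeilSheaf s ι K) :=
  ShortComplex.mk ((toTensorN s ι K).app F) ((ofTensorN s ι K).app F) (by ext U x; rfl)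

lemma tensorNSequence_shortExact (F : WeilSheaf s ι K) :
    (tensorNSequence s ι K F).ShortExact := by
  have hmono : Mono (tensorNSequence s ι K F).f := by
    refine ⟨fun {Z} a b h ↦ ?_⟩
    ext U x
    exact congrArg Prod.fst (ConcreteCategory.congr_hom (congr_app (congrArg (·.hom) h) U) x)
  have hker : Nonempty (IsLimit (KernelFork.ofι _ (tensorNSequence s ι K F).zero)) := by
    have key : ∀ {Z : WeilSheaf s ι K} (a : Z ⟶ (tensorN s ι K).obj F)
        (_ : a ≫ (ofTensorN s ι K).app F = 0) (U) (z : Z.obj.obj U),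
          (show F.obj.obj U × F.obj.obj U from a.hom.app U z).2 = 0 := fun a ha U z ↦
      ConcreteCategory.congr_hom (congr_app (congrArg (·.hom) ha) U) z
    have key' : ∀ {Z : WeilSheaf s ι K} (a : Z ⟶ (tensorN s ι K).obj F)
        (_ : a ≫ (ofTensorN s ι K).app F = 0), ∃ b, b ≫ (toTensorN s ι K).app F = a := by
      intro Z a ha
      refine ⟨⟨{
        app U := AddCommGrpCat.ofHom
          ((AddMonoidHom.fst (F.obj.obj U) (F.obj.obj U)).comp (a.hom.app U).hom)
        naturality U V f := ?_ }⟩, ?_⟩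
      · ext z
        have h1 : a.hom.app V (Z.obj.map f z) = ((tensorN s ι K).obj F).obj.map f (a.hom.app U z) :=
          NatTrans.naturality_apply a.hom f z
        refine (congrArg Prod.fst h1).trans ?_
        change F.obj.map f _ + Geom.deg f.unop • F.obj.map f _ = _
        erw [key a ha U z]
        rw [map_zero, smul_zero, add_zero]
        rfl
      · ext U z
        exact Prod.ext rfl (key a ha U z).symm
    choose l hl using fun (Z : WeilSheaf s ι K) a ha ↦ key' (Z := Z) a ha
    exact ⟨KernelFork.IsLimit.ofι _ _ (fun {Z} a ha ↦ l Z a ha) (fun {Z} a ha ↦ hl Z a ha)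
      (fun {Z} a ha m hm ↦ hmono.right_cancellation _ _ (hm.trans (hl Z a ha).symm))⟩
  have hepi : Epi (tensorNSequence s ι K F).g := by
    have : Epi ((sheafToPresheaf _ _).map (tensorNSequence s ι K F).g) := by
      rw [NatTrans.epi_iff_epi_app]
      intro U
      rw [AddCommGrpCat.epi_iff_surjective]
      exact fun x ↦ ⟨(0, x), rfl⟩
    exact (sheafToPresheaf _ _).epi_of_epi_map this
  exact { exact := ShortComplex.exact_of_f_is_kernel _ hker.some }

/-- The inclusion `F ⟶ F ⊗ N` for a complex `F`. -/
noncomputable def toTensorNComplex (F : CochainComplex (WeilSheaf s ι K) ℤ) :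
    F ⟶ ((tensorN s ι K).mapHomologicalComplex (ComplexShape.up ℤ)).obj F where
  f i := (toTensorN s ι K).app (F.X i)
  comm' i j _ := ((toTensorN s ι K).naturality (F.d i j)).symm

/-- The projection `F ⊗ N ⟶ F` for a complex `F`. -/
noncomputable def ofTensorNComplex (F : CochainComplex (WeilSheaf s ι K) ℤ) :
    ((tensorN s ι K).mapHomologicalComplex (ComplexShape.up ℤ)).obj F ⟶ F where
  f i := (ofTensorN s ι K).app (F.X i)
  comm' i j _ := ((ofTensorN s ι K).naturality (F.d i j)).symm

/-- The sequence `0 ⟶ F ⟶ F ⊗ N ⟶ F ⟶ 0` for a complex `F`. -/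
noncomputable def tensorNComplexSequence (F : CochainComplex (WeilSheaf s ι K) ℤ) :
    ShortComplex (CochainComplex (WeilSheaf s ι K) ℤ) :=
  ShortComplex.mk (toTensorNComplex s ι K F) (ofTensorNComplex s ι K F)
    (HomologicalComplex.hom_ext _ _ fun i ↦ (tensorNSequence s ι K (F.X i)).zero)

lemma tensorNComplexSequence_shortExact (F : CochainComplex (WeilSheaf s ι K) ℤ) :
    (tensorNComplexSequence s ι K F).ShortExact :=
  HomologicalComplex.shortExact_of_degreewise_shortExact _
    (fun i ↦ tensorNSequence_shortExact s ι K (F.X i))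

variable [HasDerivedCategory.{w₁} (WeilSheaf s ι K)]

/-- Cup product with the class `e ∈ Ext¹_G(ℤ, ℤ)` of `0 ⟶ ℤ ⟶ N ⟶ ℤ ⟶ 0`: the connecting
morphism `F ⟶ F[1]` of the sequence `0 ⟶ F ⟶ F ⊗ N ⟶ F ⟶ 0`. -/
noncomputable def cupE (F : CochainComplex (WeilSheaf s ι K) ℤ) :
    DerivedCategory.Q.obj F ⟶ (DerivedCategory.Q.obj F)⟦(1 : ℤ)⟧ :=
  DerivedCategory.triangleOfSESδ (tensorNComplexSequence_shortExact s ι K F)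

end TensorN

section Constant

variable {C : Type u} [SmallCategory C] (J : GrothendieckTopology C)

/-- The constant sheaf `ℤ`. -/
noncomputable def constZ : Sheaf J AddCommGrpCat.{u} :=
  (constantSheaf J AddCommGrpCat.{u}).obj (.of (ULift.{u} ℤ))

/-- The constant sheaf `ℚ`. -/
noncomputable def constQ : Sheaf J AddCommGrpCat.{u} :=
  (constantSheaf J AddCommGrpCat.{u}).obj (.of (ULift.{u} ℚ))

open scoped TensorProduct in
/-- The functor `A ↦ A ⊗ ℚ` on abelian groups. -/
noncomputable def tensorQGroup : AddCommGrpCat.{u} ⥤ AddCommGrpCat.{u} where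
  obj A := .of (A ⊗[ℤ] ℚ)
  map f := AddCommGrpCat.ofHom (TensorProduct.map f.hom.toIntLinearMap LinearMap.id).toAddMonoidHom
  map_id A := by
    refine AddCommGrpCat.hom_ext (AddMonoidHom.ext fun x ↦ ?_)
    exact LinearMap.congr_fun (TensorProduct.map_id (R := ℤ) (M := A) (N := ℚ)) x
  map_comp {A B C} f g := by
    refine AddCommGrpCat.hom_ext (AddMonoidHom.ext fun x ↦ ?_)
    exact LinearMap.congr_fun (TensorProduct.map_comp g.hom.toIntLinearMap
      (LinearMap.id (R := ℤ) (M := ℚ)) f.hom.toIntLinearMap LinearMap.id) x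

instance : tensorQGroup.{u}.Additive where
  map_add {A B f g} := by
    refine AddCommGrpCat.hom_ext (AddMonoidHom.ext fun x ↦ ?_)
    exact LinearMap.congr_fun (TensorProduct.map_add_left f.hom.toIntLinearMap
      g.hom.toIntLinearMap (LinearMap.id (R := ℤ) (M := ℚ))) x

/-- The functor `G ↦ G ⊗ ℚ` on sheaves. -/
noncomputable def tensorQ : Sheaf J AddCommGrpCat.{u} ⥤ Sheaf J AddCommGrpCat.{u} :=
  sheafToPresheaf J _ ⋙ (Functor.whiskeringRight _ _ _).obj tensorQGroup ⋙ presheafToSheaf J _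

instance : (tensorQ J).Additive := by
  have : ((Functor.whiskeringRight Cᵒᵖ _ _).obj tensorQGroup.{u}).Additive :=
    ⟨by intros; ext U : 2; exact tensorQGroup.map_add⟩
  have : (presheafToSheaf J AddCommGrpCat.{u}).Additive := inferInstance
  unfold tensorQ
  infer_instance

/-- A torsion sheaf: all its sections are torsion. -/
def IsTorsionSheaf (G : Sheaf J AddCommGrpCat.{u}) : Prop :=
  ∀ V, IsAddTorsion (G.obj.obj V)

/-- A sheaf of `ℚ`-vector spaces. (A `ℚ`-vector space structure on an abelian group is unique if it
exists, and it is preserved by all homomorphisms.) -/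
def IsRationalSheaf (G : Sheaf J AddCommGrpCat.{u}) : Prop :=
  ∀ V, Nonempty (Module ℚ (G.obj.obj V))

end Constant

section Derived

universe v₁ v₂ u₁ u₂
variable {A : Type u₁} [Category.{v₁} A] [Abelian A] [HasDerivedCategory.{w₁} A]
  {B : Type u₂} [Category.{v₂} B] [Abelian B] [HasDerivedCategory.{w₂} B]

/-- The total right derived functor `RF` on the unbounded derived category of an additive functor
`F` between abelian categories: a functor `RF` between the derived categories, commuting with the
shifts, with a natural transformation `Q ∘ F ⟶ RF ∘ Q` (compatible with the shifts) which is
universal, i.e. `RF` is the left Kan extension of `Q ∘ F` along `Q`. -/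
structure TotalRightDerivedFunctor (F : A ⥤ B) [F.Additive] where
  functor : DerivedCategory A ⥤ DerivedCategory B
  [commShift : functor.CommShift ℤ]
  unit : F.mapHomologicalComplex (ComplexShape.up ℤ) ⋙ DerivedCategory.Q ⟶
    DerivedCategory.Q ⋙ functor
  isRightDerived : functor.IsRightDerivedFunctor unit
    (HomologicalComplex.quasiIso A (ComplexShape.up ℤ))
  unit_commShift : NatTrans.CommShift unit ℤ

attribute [instance] TotalRightDerivedFunctor.commShift

end Derived

section Gamma

open DerivedCategory

variable {k : Type u} [Field k] [Fintype k]
  {S : Scheme.{u}} (s : S ⟶ Spec (.of k)) {E : Type u} [SmallCategory E] (ι : E ⥤ Over S)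
  [IsEtaleFamily s ι]
  (K : Type u) [Field K] [Algebra k K] [IsAlgClosure k K]

/-- The functor `F ↦ (V ↦ F(V̄))`. -/
noncomputable def barPush : WeilSheaf s ι K ⥤ EtaleSheaf ι :=
  (barFunctor s ι K).sheafPushforwardContinuous _ _ _

/-- The left adjoint of `F ↦ (V ↦ F(V̄))`. -/
noncomputable def barPull : EtaleSheaf ι ⥤ WeilSheaf s ι K :=
  (barFunctor s ι K).sheafPullback _ _ _

/-- The adjunction between them. -/
noncomputable def barAdj : barPull s ι K ⊣ barPush s ι K :=
  (barFunctor s ι K).sheafAdjunctionContinuous _ _ _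

/-- The action of the Frobenius of `V̄` on `F(V̄)`. -/
noncomputable def frobPush : barPush s ι K ⟶ barPush s ι K :=
  Functor.sheafPushforwardContinuousNatTrans (frobBar s ι K) _ _ _

/-- The action of the Frobenius on the pull-back, conjugate to the one above. -/
noncomputable def frobPull : barPull s ι K ⟶ barPull s ι K :=
  (conjugateEquiv (barAdj s ι K) (barAdj s ι K)).symm (frobPush s ι K)

/-- The functor `γ_*`: one has `(γ_* F)(V) = F(V̄)^G`, the sections of `F` over `V̄` which are
invariant under the Frobenius. -/
noncomputable def gammaPush : WeilSheaf s ι K ⥤ EtaleSheaf ι := equalizer (frobPush s ι K) (𝟙 _)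

/-- The functor `γ^*`, left adjoint to `γ_*` (see `gammaAdj`). -/
noncomputable def gammaPull : EtaleSheaf ι ⥤ WeilSheaf s ι K := coequalizer (frobPull s ι K) (𝟙 _)

/-- `γ^*` is left adjoint to `γ_*`. -/
noncomputable def gammaAdj : gammaPull s ι K ⊣ gammaPush s ι K :=
  equalizerAdjunction (barAdj s ι K) (frobPush s ι K)

instance : (gammaPush s ι K).Additive :=
  have : (barPush s ι K).Additive := ⟨rfl⟩
  additive_equalizer (frobPush s ι K)

instance : (gammaPull s ι K).Additive := (gammaAdj s ι K).left_adjoint_additive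

variable [HasDerivedCategory.{w₁} (WeilSheaf s ι K)] [HasDerivedCategory.{w₂} (EtaleSheaf ι)]

/-- The complex `γ^* G`. -/
noncomputable def gammaPullComplex (G : CochainComplex (EtaleSheaf ι) ℤ) :
    CochainComplex (WeilSheaf s ι K) ℤ :=
  ((gammaPull s ι K).mapHomologicalComplex _).obj G

/-- The unit of the adjunction, for a complex `G`. -/
noncomputable def unitComplex (G : CochainComplex (EtaleSheaf ι) ℤ) :
    G ⟶ ((gammaPush s ι K).mapHomologicalComplex _).obj (gammaPullComplex s ι K G) where
  f i := (gammaAdj s ι K).unit.app (G.X i)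
  comm' i j _ := ((gammaAdj s ι K).unit.naturality (G.d i j)).symm

variable {s ι K}

/-- The canonical morphism `G ⟶ Rγ_* γ^* G`. -/
noncomputable def derivedUnit (R : TotalRightDerivedFunctor (gammaPush s ι K))
    (G : CochainComplex (EtaleSheaf ι) ℤ) :
    Q.obj G ⟶ R.functor.obj (Q.obj (gammaPullComplex s ι K G)) :=
  Q.map (unitComplex s ι K G) ≫ R.unit.app (gammaPullComplex s ι K G)

/-- Cup product with `e` on `Rγ_* F`. -/
noncomputable def derivedCupE (R : TotalRightDerivedFunctor (gammaPush s ι K))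
    (F : CochainComplex (WeilSheaf s ι K) ℤ) :
    R.functor.obj (Q.obj F) ⟶ (R.functor.obj (Q.obj F))⟦(1 : ℤ)⟧ :=
  R.functor.map (cupE s ι K F) ≫ (R.functor.commShiftIso (1 : ℤ)).hom.app (Q.obj F)

end Gamma
end WeilEtale

open WeilEtale DerivedCategory Pretriangulated

/-! Let `B` be the functor `barPush`, `F ↦ (V ↦ F(V̄))`, with its Frobenius `φ`; by construction
`γ_*` is the kernel of `φ - 1` on `B`. The theorem rests on three facts.

(a) `B` is exact. By quasi-compactness and limit arguments, a covering of `V̄` is refined by one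
defined over a finite subextension `L`; after `V` is replaced by an étale covering, `V̄` is the
disjoint union of the `[L : k]` Frobenius translates of a piece `V ×_L K`, and each translate
factors through the given covering (`Level.splitSieve_mem`). Sections on the translates can be
lifted independently of each other. Consequently `Rγ_* F` is the fibre of `φ - 1 : B F ⟶ B F`. To
obtain this for unbounded complexes, one uses the coinduced sheaf `coind F = Hom(ℤ[G], F)`: `φ - 1`
is onto on it, `γ_* (coind F) ≅ B F`, and the exact sequence `0 ⟶ F ⟶ coind F ⟶ coind F ⟶ 0` has a
second map which becomes `φ - 1` under `γ_*`. The cone of that map is a functorial resolution of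
`F[1]` adapted to `γ_*` (`coindResolution`, `derivedIso`).

(b) `G ⟶ γ_* γ^* G` is an isomorphism. The sections of `γ^* G` are locally sums of pull-backs of
sections of `G`, so the invariant ones descend; injectivity is tested by mapping `γ^* G` to a sheaf
built from a Kan extension of `G` (`eq_zero_of_hatSec`).

(c) The coinvariants of `φ` on `B (γ^* G)` are `G ⊗ ℚ` (`gammaCoinvIso`). Sections are locally fixed
by some `φ^n`, so traces show that `G ⟶ coinv` has torsion kernel and cokernel. As `V̄` can be cut
into a number of pieces divisible by any given integer, and a section whose trace over the pieces
vanishes has the form `φ z - z`, the coinvariants are uniquely divisible.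

Together these give, in each degree of a complex, the exact sequence `0 ⟶ G ⟶ B γ^* G ⟶ B γ^* G ⟶ G
⊗ ℚ ⟶ 0`, which is the triangle of the theorem (`exists_cone_triangle`). If the cohomology is
torsion, `G ⊗ ℚ` is acyclic. For the cup product, `(r, s) ↦ (r - m s)_m` maps `F ⊗ N` to `coind F`
and shows that `e` is `-toCoind` followed by the connecting morphism of the coinduction sequence
(`cupE_eq`). So `e` has square zero, and `G ⟶ Rγ_* γ^* G ⟶ Rγ_* γ^* G[1] ⟶ G ⊗ ℚ`, with `e` in the
middle, is minus the canonical map. When that map is invertible, the splitting and the matrix of `e`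
are formal (`exists_iso_biprod`). The statements on `ℤ` and `ℚ` follow because `γ^*` of a constant
sheaf is constant. -/

namespace WeilEtale

/-! ### Descent of morphisms and étale schemes from `K` to finite subextensions -/

section Descent

variable (k : Type u) [Field k] (K : Type u) [Field K] [Algebra k K]

/-- The finite subextensions of `K / k`. -/
abbrev FinSub := {L : IntermediateField k K // FiniteDimensional k L}

instance : SemilatticeSup (FinSub k K) :=
  Subtype.semilatticeSup fun {L L'} (_ : FiniteDimensional k L) (_ : FiniteDimensional k L') ↦
    (inferInstance : FiniteDimensional k ↥(L ⊔ L'))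

instance (L : FinSub k K) : FiniteDimensional k L.1 := L.2

instance : Nonempty (FinSub k K) := ⟨⟨⊥, inferInstance⟩⟩

/-- The finite subextensions as a diagram of rings. -/
noncomputable def finSubDiagram : FinSub k K ⥤ CommRingCat.{u} where
  obj L := .of L.1
  map f := CommRingCat.ofHom (IntermediateField.inclusion (leOfHom f)).toRingHom

/-- `K` as a cocone over its finite subextensions. -/
noncomputable def finSubCocone : Cocone (finSubDiagram k K) where
  pt := .of K
  ι := { app L := CommRingCat.ofHom (algebraMap L.1 K) }

variable {K} in
lemma exists_finSub_mem [Algebra.IsAlgebraic k K] (x : K) : ∃ L : FinSub k K, x ∈ L.1 :=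
  ⟨⟨IntermediateField.adjoin k {x}, IntermediateField.adjoin.finiteDimensional
    (Algebra.IsIntegral.isIntegral x)⟩, IntermediateField.mem_adjoin_simple_self k x⟩

/-- An algebraic extension is the filtered colimit of its finite subextensions. -/
noncomputable def finSubCoconeIsColimit [Algebra.IsAlgebraic k K] :
    IsColimit (finSubCocone k K) := by
  have : ReflectsColimit (finSubDiagram k K) (forget CommRingCat.{u}) :=
    reflectsColimit_of_reflectsIsomorphisms _ _
  refine isColimitOfReflects (forget CommRingCat.{u}) ?_
  refine Types.FilteredColimit.isColimitOf _ _ (fun x ↦ ?_) (fun L L' x y h ↦ ?_)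
  · obtain ⟨L, hL⟩ := exists_finSub_mem k (show K from x)
    exact ⟨L, ⟨x, hL⟩, rfl⟩
  · refine ⟨L ⊔ L', homOfLE le_sup_left, homOfLE le_sup_right, ?_⟩
    exact Subtype.ext h

/-- The spectrum of `K` as a cofiltered limit. -/
noncomputable def specConeIsLimit [Algebra.IsAlgebraic k K] :
    IsLimit (Scheme.Spec.mapCone (finSubCocone k K).op) :=
  isLimitOfPreserves Scheme.Spec (finSubCoconeIsColimit k K).op

variable {K}

/-- The structure morphism of the spectrum of an intermediate field. -/
noncomputable def specSub (L : IntermediateField k K) : Spec (.of L) ⟶ Spec (.of k) :=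
  Spec.map (CommRingCat.ofHom (algebraMap k L))

/-- The morphism `Spec K ⟶ Spec L`. -/
noncomputable def specTop (L : IntermediateField k K) : Spec (.of K) ⟶ Spec (.of L) :=
  Spec.map (CommRingCat.ofHom (algebraMap L K))

/-- The morphism `Spec L' ⟶ Spec L` for `L ≤ L'`. -/
noncomputable def specLE {L L' : IntermediateField k K} (h : L ≤ L') :
    Spec (.of L') ⟶ Spec (.of L) :=
  Spec.map (CommRingCat.ofHom (IntermediateField.inclusion h).toRingHom)

@[simp]
lemma specLE_specSub {L L' : IntermediateField k K} (h : L ≤ L') :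
    specLE k h ≫ specSub k L = specSub k L' := by
  rw [specLE, specSub, specSub, ← Spec.map_comp]; rfl

@[simp]
lemma specTop_specLE {L L' : IntermediateField k K} (h : L ≤ L') :
    specTop k L' ≫ specLE k h = specTop k L := by
  rw [specLE, specTop, specTop, ← Spec.map_comp]; rfl

variable (K) in
/-- The morphism `Spec K ⟶ Spec k`. -/
noncomputable def specTopBase : Spec (.of K) ⟶ Spec (.of k) :=
  Spec.map (CommRingCat.ofHom (algebraMap k K))

@[simp]
lemma specTop_specSub (L : IntermediateField k K) : specTop k L ≫ specSub k L = specTopBase k K := by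
  rw [specTop, specSub, specTopBase, ← Spec.map_comp]; rfl

instance (L : IntermediateField k K) [Algebra.IsSeparable k K] [FiniteDimensional k L] :
    Etale (specSub k L) := by
  rw [specSub, HasRingHomProperty.Spec_iff (P := @Etale)]
  simp only [CommRingCat.hom_ofHom, RingHom.etale_algebraMap]
  have : Algebra.FormallyEtale k L := (Algebra.FormallyEtale.iff_isSeparable k L).2 inferInstance
  have : Algebra.FinitePresentation k L := Algebra.FinitePresentation.of_finiteType.1 inferInstance
  exact { }

instance (L : IntermediateField k K) [FiniteDimensional k L] : IsFinite (specSub k L) := by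
  rw [specSub, IsFinite.SpecMap_iff]
  exact RingHom.finite_algebraMap.2 inferInstance

lemma flat_surjective_spec {F F' : Type u} [Field F] [Field F'] (f : F →+* F') :
    Flat (Spec.map (CommRingCat.ofHom f)) ∧ Surjective (Spec.map (CommRingCat.ofHom f)) := by
  algebraize [f]
  constructor
  · rw [Flat.SpecMap_iff]
    exact (inferInstance : Module.Flat F F')
  · constructor
    intro x
    exact ⟨IsLocalRing.closedPoint F', Subsingleton.elim (α := PrimeSpectrum F) _ _⟩

instance (L : IntermediateField k K) : Flat (specTop k L) := (flat_surjective_spec _).1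
instance (L : IntermediateField k K) : Surjective (specTop k L) := (flat_surjective_spec _).2

variable {X : Scheme.{u}} (x : X ⟶ Spec (.of k))

/-- The base change of `X` to an intermediate field. -/
noncomputable abbrev lev (L : IntermediateField k K) : Scheme.{u} := pullback x (specSub k L)

variable (K) in
/-- The base change of `X` to `K`. -/
noncomputable abbrev levTop : Scheme.{u} := pullback x (specTopBase k K)

/-- The transition morphisms between the base changes of `X`. -/
noncomputable def levMap {L L' : IntermediateField k K} (h : L ≤ L') : lev k x L' ⟶ lev k x L :=
  pullback.lift (pullback.fst _ _) (pullback.snd _ _ ≫ specLE k h) (by simp [pullback.condition])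

/-- The projection from the base change to `K` to the base change to an intermediate field. -/
noncomputable def levProj (L : IntermediateField k K) : levTop k K x ⟶ lev k x L :=
  pullback.lift (pullback.fst _ _) (pullback.snd _ _ ≫ specTop k L) (by simp [pullback.condition])

@[simp]
lemma levMap_fst {L L' : IntermediateField k K} (h : L ≤ L') :
    levMap k x h ≫ pullback.fst x (specSub k L) = pullback.fst _ _ := pullback.lift_fst _ _ _

@[simp]
lemma levMap_fst_assoc {L L' : IntermediateField k K} (h : L ≤ L') {T : Scheme.{u}} (t : _ ⟶ T) :
    levMap k x h ≫ pullback.fst x (specSub k L) ≫ t = pullback.fst _ _ ≫ t := by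
  rw [← Category.assoc, levMap_fst]

@[simp]
lemma levMap_snd {L L' : IntermediateField k K} (h : L ≤ L') :
    levMap k x h ≫ pullback.snd x (specSub k L) = pullback.snd _ _ ≫ specLE k h :=
  pullback.lift_snd _ _ _

@[simp]
lemma levMap_snd_assoc {L L' : IntermediateField k K} (h : L ≤ L') {T : Scheme.{u}} (t : _ ⟶ T) :
    levMap k x h ≫ pullback.snd x (specSub k L) ≫ t = pullback.snd _ _ ≫ specLE k h ≫ t := by
  rw [← Category.assoc, levMap_snd, Category.assoc]

@[simp]
lemma levProj_fst (L : IntermediateField k K) :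
    levProj k x L ≫ pullback.fst x (specSub k L) = pullback.fst _ _ := pullback.lift_fst _ _ _

@[simp]
lemma levProj_fst_assoc (L : IntermediateField k K) {T : Scheme.{u}} (t : _ ⟶ T) :
    levProj k x L ≫ pullback.fst x (specSub k L) ≫ t = pullback.fst _ _ ≫ t := by
  rw [← Category.assoc, levProj_fst]

@[simp]
lemma levProj_snd (L : IntermediateField k K) :
    levProj k x L ≫ pullback.snd x (specSub k L) = pullback.snd _ _ ≫ specTop k L :=
  pullback.lift_snd _ _ _

@[simp]
lemma levProj_snd_assoc (L : IntermediateField k K) {T : Scheme.{u}} (t : _ ⟶ T) :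
    levProj k x L ≫ pullback.snd x (specSub k L) ≫ t = pullback.snd _ _ ≫ specTop k L ≫ t := by
  rw [← Category.assoc, levProj_snd, Category.assoc]

lemma levMap_isPullback {L L' : IntermediateField k K} (h : L ≤ L') : IsPullback (levMap k x h)
    (pullback.snd x (specSub k L')) (pullback.snd x (specSub k L)) (specLE k h) := by
  refine IsPullback.of_right ?_ (levMap_snd k x h) (IsPullback.of_hasPullback x (specSub k L))
  rw [levMap_fst, specLE_specSub]
  exact IsPullback.of_hasPullback _ _

lemma levProj_isPullback (L : IntermediateField k K) : IsPullback (levProj k x L)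
    (pullback.snd x (specTopBase k K)) (pullback.snd x (specSub k L)) (specTop k L) := by
  refine IsPullback.of_right ?_ (levProj_snd k x L) (IsPullback.of_hasPullback x (specSub k L))
  rw [levProj_fst, specTop_specSub]
  exact IsPullback.of_hasPullback _ _

/-- The diagram of the base changes of `X` to the finite subextensions. -/
noncomputable def baseDiagram (K : Type u) [Field K] [Algebra k K] :
    (FinSub k K)ᵒᵖ ⥤ Scheme.{u} where
  obj L := lev k x L.unop.1
  map f := levMap k x (leOfHom f.unop)
  map_id L := by
    apply pullback.hom_ext
    · rw [levMap_fst, Category.id_comp]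
    · rw [levMap_snd, Category.id_comp]
      exact (congrArg (pullback.snd x (specSub k L.unop.1) ≫ ·) (Spec.map_id _)).trans
        (Category.comp_id _)
  map_comp f g := by
    apply pullback.hom_ext
    · simp only [levMap_fst, Category.assoc]
    · simp only [levMap_snd, Category.assoc, levMap_snd_assoc]
      rw [specLE, specLE, specLE, ← Spec.map_comp]; rfl

/-- The base change of `X` to `K` as a cone over the base changes to the finite subextensions. -/
noncomputable def baseCone (K : Type u) [Field K] [Algebra k K] : Cone (baseDiagram k x K) where
  pt := levTop k K x
  π :=
  { app L := levProj k x L.unop.1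
    naturality L L' f := by
      dsimp only [Functor.const_obj_obj, Functor.const_obj_map, baseDiagram]
      rw [Category.id_comp]
      apply pullback.hom_ext
      · simp only [levMap_fst, Category.assoc, levProj_fst]
      · simp only [levMap_snd, Category.assoc, levProj_snd, levProj_snd_assoc, specTop_specLE] }

/-- The projections to the spectra of the finite subextensions. -/
noncomputable def baseDiagramSnd (K : Type u) [Field K] [Algebra k K] :
    baseDiagram k x K ⟶ (finSubDiagram k K).op ⋙ Scheme.Spec where
  app L := pullback.snd x (specSub k L.unop.1)
  naturality _ _ f := levMap_snd k x (leOfHom f.unop)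

/-- The base change of `X` to `K` is the limit of the base changes to the finite subextensions. -/
noncomputable def baseConeIsLimit [Algebra.IsAlgebraic k K] : IsLimit (baseCone k x K) :=
  isLimitOfIsPullbackOfIsConnected (baseDiagramSnd k x K) (baseCone k x K)
    (Scheme.Spec.mapCone (finSubCocone k K).op)
    { hom := pullback.snd _ _
      w L := (levProj_snd k x L.unop.1).symm } (fun L ↦ levProj_isPullback k x L.unop.1)
    (specConeIsLimit k K)

/-- A morphism from the base change of `X` to `K` to a scheme locally of finite presentation over
`B` is defined over a finite subextension. -/
lemma exists_finSub_factor [Algebra.IsAlgebraic k K] [QuasiCompact x] [QuasiSeparated x]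
    {W B : Scheme.{u}} (b : Spec (.of k) ⟶ B) (w : W ⟶ B) [LocallyOfFinitePresentation w]
    (g : levTop k K x ⟶ W) (hg : g ≫ w = pullback.fst _ _ ≫ x ≫ b) :
    ∃ (L : FinSub k K) (h : lev k x L.1 ⟶ W),
      levProj k x L.1 ≫ h = g ∧ h ≫ w = pullback.fst _ _ ≫ x ≫ b := by
  have h1 {L L' : (FinSub k K)ᵒᵖ} (f : L ⟶ L') : IsAffineHom ((baseDiagram k x K).map f) :=
    MorphismProperty.of_isPullback (P := @IsAffineHom) (levMap_isPullback k x (leOfHom f.unop)).flip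
      (by rw [specLE]; infer_instance)
  have h2 (L : (FinSub k K)ᵒᵖ) : CompactSpace ((baseDiagram k x K).obj L) := by
    have : CompactSpace (lev k x L.unop.1) :=
      QuasiCompact.compactSpace_of_compactSpace (pullback.snd x (specSub k L.unop.1))
    exact this
  have h3 (L : (FinSub k K)ᵒᵖ) : QuasiSeparatedSpace ((baseDiagram k x K).obj L) := by
    have : QuasiSeparatedSpace (lev k x L.unop.1) :=
      quasiSeparatedSpace_of_quasiSeparated (pullback.snd x (specSub k L.unop.1))
    exact this
  have := ‹LocallyOfFinitePresentation w›
  let t : baseDiagram k x K ⟶ (Functor.const _).obj B :=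
    { app L := pullback.fst _ _ ≫ x ≫ b
      naturality _ _ f := by
        refine (levMap_fst_assoc k x (leOfHom f.unop) _).trans ?_
        exact (Category.comp_id _).symm }
  obtain ⟨L, h, h₁, h₂⟩ := Scheme.exists_π_app_comp_eq_of_locallyOfFinitePresentation
    (baseDiagram k x K) t w (baseCone k x K)
    (baseConeIsLimit k x) g (by
      ext L : 2
      exact (levProj_fst_assoc k x L.unop.1 (x ≫ b)).trans hg.symm)
  exact ⟨L.unop, h, h₁, h₂⟩

/-- Descent of étale algebras to a subring over which their equations are defined. -/
lemma exists_etale_isPushout {A A₁ B : CommRingCat.{u}} (φ : A₁ ⟶ A)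
    (hφ : Function.Injective φ.hom) (β : A ⟶ B) (A₀ : Subring A)
    (hA₀ : A₀ ≤ φ.hom.range) (B₀ : Type u) [CommRing B₀] [Algebra A₀ B₀] [Algebra.Etale A₀ B₀]
    (e : letI := β.hom.toAlgebra; B ≃ₐ[A] TensorProduct A₀ A B₀) :
    ∃ (B₁ : CommRingCat.{u}) (a : A₁ ⟶ B₁) (b : B₁ ⟶ B), a.hom.Etale ∧ IsPushout φ a β b := by
  -- As `φ` is injective, `A₁` is identified with its image; `A₀` then maps to `A₁`, and `A₁ ⊗ B₀`
  -- is the descended algebra.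
  let φ' : A₁ ≃+* φ.hom.range := RingEquiv.ofBijective φ.hom.rangeRestrict
    ⟨fun x y h ↦ hφ (congrArg Subtype.val h), φ.hom.rangeRestrict_surjective⟩
  let ψ : A₀ →+* A₁ := φ'.symm.toRingHom.comp (Subring.inclusion hA₀)
  have hψ : φ.hom.comp ψ = algebraMap A₀ A := by
    ext x
    exact congrArg Subtype.val (φ'.apply_symm_apply (Subring.inclusion hA₀ x))
  let := ψ.toAlgebra
  let := β.hom.toAlgebra
  have h1 := CommRingCat.isPushout_tensorProduct A₀ A₁ B₀
  have h2 : IsPushout (CommRingCat.ofHom (algebraMap A₀ A)) (CommRingCat.ofHom (algebraMap A₀ B₀))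
      β (CommRingCat.ofHom (e.symm.toRingEquiv.toRingHom.comp
        (Algebra.TensorProduct.includeRight : B₀ →ₐ[A₀] TensorProduct A₀ A B₀).toRingHom)) := by
    refine (CommRingCat.isPushout_tensorProduct A₀ A B₀).of_iso (Iso.refl _) (Iso.refl _)
      (Iso.refl _) e.symm.toRingEquiv.toCommRingCatIso (by simp) (by simp) ?_ ?_
    · ext x
      exact e.symm.commutes x
    · ext x; rfl
  have hψ' : CommRingCat.ofHom (algebraMap A₀ A₁) ≫ φ = CommRingCat.ofHom (algebraMap A₀ A) :=
    CommRingCat.hom_ext hψ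
  have hw := h2.w
  rw [← hψ', Category.assoc] at hw
  refine ⟨_, CommRingCat.ofHom (algebraMap A₁ (TensorProduct A₀ A₁ B₀)),
    h1.desc (φ ≫ β) _ hw, RingHom.etale_algebraMap.2 inferInstance,
    IsPushout.of_left ?_ (h1.inl_desc _ _ _).symm h1⟩
  rw [h1.inr_desc, hψ']
  exact h2

instance [IsAffine X] : IsAffine (levTop k K x) := inferInstanceAs (IsAffine (pullback x (specTopBase k K)))
instance (L : IntermediateField k K) [IsAffine X] : IsAffine (lev k x L) :=
  inferInstanceAs (IsAffine (pullback x (specSub k L)))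

instance (L : IntermediateField k K) : Flat (levProj k x L) :=
  MorphismProperty.of_isPullback (P := @Flat) (levProj_isPullback k x L).flip inferInstance

instance (L : IntermediateField k K) : Surjective (levProj k x L) :=
  MorphismProperty.of_isPullback (P := @Surjective) (levProj_isPullback k x L).flip inferInstance

instance (L : IntermediateField k K) : Epi (levProj k x L) := Flat.epi_of_flat_of_surjective _

/-- An affine scheme étale over the base change of an affine scheme to `K` is defined over a finite
subextension. -/
lemma exists_finSub_etale [Algebra.IsAlgebraic k K] [IsAffine X] {U : Scheme.{u}} [IsAffine U]
    (e : U ⟶ levTop k K x) [Etale e] :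
    ∃ (L : FinSub k K) (U' : Scheme.{u}) (_ : IsAffine U') (e' : U' ⟶ lev k x L.1) (_ : Etale e')
      (p : U ⟶ U'), IsPullback p e e' (levProj k x L.1) := by
  have he : e.appTop.hom.Etale :=
    (HasRingHomProperty.iff_of_isAffine (P := @Etale) (f := e)).1 inferInstance
  algebraize [e.appTop.hom]
  -- An étale algebra is defined over a finitely generated subring `A₀`, so only finitely many
  -- generators have to be found at a finite level.
  obtain ⟨A₀, B₀, _, _, hA₀, _, ⟨e₀⟩⟩ :=
    Algebra.Etale.exists_subalgebra_fg ℤ Γ(levTop k K x, ⊤) Γ(U, ⊤)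
  obtain ⟨t, ht⟩ := hA₀
  have hex (a : Γ(levTop k K x, ⊤)) : ∃ (L : FinSub k K) (b : Γ(lev k x L.1, ⊤)),
      (levProj k x L.1).appTop b = a := by
    have (L : (FinSub k K)ᵒᵖ) : IsAffine ((baseDiagram k x K).obj L) :=
      inferInstanceAs (IsAffine (lev k x L.unop.1))
    obtain ⟨L, b, h⟩ := exists_appTop_π_eq_of_isAffine_of_isLimit _ _ (baseConeIsLimit k x) a
    exact ⟨L.unop, b, h⟩
  choose L₀ b hb using hex
  classical
  obtain ⟨L, hL⟩ := Finset.exists_le (t.image L₀)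
  let φ := (levProj k x L.1).appTop
  -- The projection is flat and surjective, hence an epimorphism of schemes; between affine schemes
  -- this makes the ring map a monomorphism.
  have hφ : Function.Injective φ.hom := by
    have : Mono φ := by
      refine ⟨fun {R} g h hgh ↦ Spec.map_injective ?_⟩
      rw [← cancel_epi (lev k x L.1).isoSpec.hom, ← cancel_epi (levProj k x L.1)]
      have (r : R ⟶ Γ(lev k x L.1, ⊤)) : levProj k x L.1 ≫ (lev k x L.1).isoSpec.hom ≫ Spec.map r =
          (levTop k K x).isoSpec.hom ≫ Spec.map (r ≫ φ) := by
        rw [Spec.map_comp, ← Category.assoc, ← Category.assoc, Scheme.isoSpec_hom_naturality]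
      rw [this, this, hgh]
    exact (ConcreteCategory.mono_iff_injective_of_preservesPullback φ).1 this
  have hA : A₀.toSubring ≤ φ.hom.range := by
    intro a ha
    have : A₀ ≤ subalgebraOfSubring φ.hom.range := by
      rw [← ht, Algebra.adjoin_le_iff]
      intro a ha
      refine ⟨(levMap k x (hL _ (Finset.mem_image_of_mem _ ha))).appTop (b a), ?_⟩
      have : levProj k x L.1 ≫ levMap k x (hL _ (Finset.mem_image_of_mem L₀ ha)) =
          levProj k x (L₀ a).1 :=
        (baseCone k x K).w (homOfLE (hL _ (Finset.mem_image_of_mem L₀ ha))).op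
      have h := hb a
      rw [← this, Scheme.Hom.comp_appTop] at h
      exact h
    exact this ha
  obtain ⟨B₁, a, b, ha, hab⟩ := exists_etale_isPushout φ hφ e.appTop A₀.toSubring hA B₀ e₀
  have h1 : IsPullback (U.isoSpec.hom ≫ Spec.map b) e (Spec.map a ≫ (lev k x L.1).isoSpec.inv)
      (levProj k x L.1) := by
    refine (isPullback_SpecMap_of_isPushout _ _ _ _ hab).flip.of_iso (U.isoSpec.symm) (Iso.refl _)
      (levTop k K x).isoSpec.symm (lev k x L.1).isoSpec.symm ?_ ?_ ?_ ?_
    · simp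
    · exact Scheme.isoSpec_inv_naturality _
    · simp
    · exact Scheme.isoSpec_inv_naturality _
  have : Etale (Spec.map a) := (HasRingHomProperty.Spec_iff (P := @Etale)).2 ha
  exact ⟨L, _, inferInstance, _, inferInstance, _, h1⟩

end Descent
end WeilEtale

namespace WeilEtale

/-! ### Powers of the Frobenius on a finite subextension -/

section FrobeniusSub

variable (k : Type u) [Field k] [Fintype k] {K : Type u} [Field K] [Algebra k K]
  [IsAlgClosure k K]

instance : Algebra.IsAlgebraic k K := IsAlgClosure.isAlgebraic

/-- The automorphism of the spectrum of a finite subextension induced by the Frobenius. -/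
noncomputable def frobSub (L : IntermediateField k K) (n : ℤ) : Spec (.of L) ⟶ Spec (.of L) :=
  Spec.map (CommRingCat.ofHom
    ((FiniteField.frobeniusAlgEquivOfAlgebraic k L ^ (-n) : Gal(L/k)) : L →+* L))

lemma coe_frobenius_zpow (L : IntermediateField k K) (n : ℤ) (x : L) :
    (((FiniteField.frobeniusAlgEquivOfAlgebraic k L ^ n : Gal(L/k)) x : L) : K) =
      (frob k K ^ n) (x : K) := by
  have h (x : L) : ((FiniteField.frobeniusAlgEquivOfAlgebraic k L x : L) : K) =
      frob k K (x : K) := by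
    simp [frob]
  have h1 (n : ℕ) : ∀ x : L, (((FiniteField.frobeniusAlgEquivOfAlgebraic k L ^ n : Gal(L/k)) x : L) : K) =
      (frob k K ^ n) (x : K) := by
    induction n with
    | zero => simp
    | succ n ih => intro x; rw [pow_succ, pow_succ, AlgEquiv.mul_apply, AlgEquiv.mul_apply, ih, h]
  obtain ⟨n, rfl | rfl⟩ := n.eq_nat_or_neg
  · simpa using h1 n x
  · rw [zpow_neg, zpow_neg, zpow_natCast, zpow_natCast]
    apply (frob k K ^ n).injective
    rw [← h1, ← AlgEquiv.mul_apply, ← AlgEquiv.mul_apply, mul_inv_cancel, mul_inv_cancel]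
    rfl

lemma frobSpec_specTop (L : IntermediateField k K) (n : ℤ) :
    frobSpec k K n ≫ specTop k L = specTop k L ≫ frobSub k L n := by
  rw [frobSpec, specTop, frobSub, ← Spec.map_comp, ← Spec.map_comp]
  congr 1
  ext x
  exact (coe_frobenius_zpow k L (-n) x).symm

@[simp]
lemma frobSub_specSub (L : IntermediateField k K) (n : ℤ) :
    frobSub k L n ≫ specSub k L = specSub k L := by
  rw [frobSub, specSub, ← Spec.map_comp]
  congr 1
  ext x
  exact congrArg Subtype.val ((FiniteField.frobeniusAlgEquivOfAlgebraic k L ^ (-n)).commutes x)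

lemma frobSub_add (L : IntermediateField k K) (m n : ℤ) :
    frobSub k L (m + n) = frobSub k L m ≫ frobSub k L n := by
  rw [frobSub, frobSub, frobSub, ← Spec.map_comp, neg_add, zpow_add]
  rfl

/-- Holds because the Frobenius has order exactly `[L : k]` in the Galois group of `L`. -/
lemma frobSub_eq_id_iff (L : IntermediateField k K) [FiniteDimensional k L] (n : ℤ) :
    frobSub k L n = 𝟙 _ ↔ (Module.finrank k L : ℤ) ∣ n := by
  have : Finite L := Module.finite_of_finite k
  rw [← FiniteField.orderOf_frobeniusAlgEquivOfAlgebraic k L, ← dvd_neg, orderOf_dvd_iff_zpow_eq_one,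
    frobSub, ← Spec.map_id]
  constructor
  · intro h
    have h := Spec.map_injective h
    ext x : 1
    exact ConcreteCategory.congr_hom h x
  · intro h
    congr 1
    ext x
    exact congrArg Subtype.val (DFunLike.congr_fun h x)

/-- `L` is normal over `k`, so two `k`-embeddings of `L` in a field differ by an automorphism of
`L`, which is a power of the Frobenius. This will locate a point of `V̄` on one of the Frobenius
translates of a piece. -/
lemma exists_eq_frobSub (L : IntermediateField k K) [FiniteDimensional k L] {F : Type u} [Field F]
    (α β : Spec (.of F) ⟶ Spec (.of L)) (h : α ≫ specSub k L = β ≫ specSub k L) :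
    ∃ i < Module.finrank k L, α = β ≫ frobSub k L (-i : ℤ) := by
  obtain ⟨α, rfl⟩ := Spec.map_surjective α
  obtain ⟨β, rfl⟩ := Spec.map_surjective β
  have : Finite L := Module.finite_of_finite k
  let : Algebra L F := β.hom.toAlgebra
  let : Algebra k F := (β.hom.comp (algebraMap k L)).toAlgebra
  have : IsScalarTower k L F := .of_algebraMap_eq fun _ ↦ rfl
  have hα (x : k) : α (algebraMap k L x) = β (algebraMap k L x) := by
    rw [specSub, ← Spec.map_comp, ← Spec.map_comp] at h
    exact ConcreteCategory.congr_hom (Spec.map_injective h) x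
  let α' : L →ₐ[k] F := { α.hom with commutes' := hα }
  have : Normal k L := inferInstance
  obtain ⟨σ, hσ⟩ := (Normal.algHomEquivAut k F L).symm.surjective α'
  obtain ⟨i, hi⟩ := (FiniteField.bijective_frobeniusAlgEquivOfAlgebraic_pow k L).2 σ
  refine ⟨i.1, i.2, ?_⟩
  rw [frobSub, ← Spec.map_comp]
  congr 1
  ext x
  have : α x = β (σ x) := (DFunLike.congr_fun hσ x).symm
  rw [this, ← hi]
  simp

end FrobeniusSub

end WeilEtale

namespace WeilEtale

/-! ### The pieces `V ×_L K` of `V̄` and their Frobenius translates -/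

section Level

variable {k : Type u} [Field k] [Fintype k]
  {S : Scheme.{u}} (s : S ⟶ Spec (.of k)) {E : Type u} [SmallCategory E] (ι : E ⥤ Over S)
  (K : Type u) [Field K] [Algebra k K] [IsAlgClosure k K]

/-- A member of `E` with a morphism to the spectrum of a finite subextension of `K / k`. -/
structure Level where
  V : E
  L : IntermediateField k K
  fin : FiniteDimensional k L
  a : (ι.obj V).left ⟶ Spec (.of L)
  w : a ≫ specSub k L = (ι.obj V).hom ≫ s

namespace Level

attribute [instance] Level.fin
variable {s ι K} (D : Level s ι K)

/-- The degree of the field of definition. -/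
noncomputable abbrev N : ℕ := Module.finrank k D.L

/-- The base change `D ×_L K`. -/
noncomputable abbrev top : Scheme.{u} := pullback D.a (specTop k D.L)

/-- The inclusion of `D ×_L K` into `D ×_k K`. -/
noncomputable def toBar : D.top ⟶ bar s ι K D.V :=
  (bar_isPullback s ι K D.V).lift (pullback.snd _ _) (pullback.fst _ _) (by
    rw [← D.w, pullback.condition_assoc, specTop_specSub]; rfl)

lemma toBar_snd : D.toBar ≫ barSnd s ι K D.V = pullback.snd _ _ :=
  (bar_isPullback s ι K D.V).lift_fst _ _ _

lemma toBar_fst : D.toBar ≫ barFst s ι K D.V = pullback.fst _ _ :=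
  (bar_isPullback s ι K D.V).lift_snd _ _ _

/-- The pullback defining `V̄`, over `Spec L`. -/
noncomputable def barIso' :
    pullback (D.a ≫ specSub k D.L) (specTop k D.L ≫ specSub k D.L) ≅ bar s ι K D.V :=
  pullback.congrHom D.w (specTop_specSub k D.L)

lemma barIso'_fst : D.barIso'.hom ≫ barFst s ι K D.V = pullback.fst _ _ :=
  (pullback.lift_fst _ _ _).trans (Category.comp_id _)

lemma barIso'_snd : D.barIso'.hom ≫ barSnd s ι K D.V = pullback.snd _ _ :=
  (pullback.lift_snd _ _ _).trans (Category.comp_id _)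

lemma toBar_eq : D.toBar = pullback.mapDesc D.a (specTop k D.L) (specSub k D.L) ≫
    D.barIso'.hom := by
  apply (bar_isPullback s ι K D.V).hom_ext
  · rw [toBar_snd, Category.assoc, barIso'_snd, pullback.mapDesc, pullback.map, pullback.lift_snd,
      Category.comp_id]
  · rw [toBar_fst, Category.assoc, barIso'_fst, pullback.mapDesc, pullback.map, pullback.lift_fst,
      Category.comp_id]

/-- A base change of the diagonal of `Spec L` over `Spec k`, which is open because `L` is étale over
`k`. In the next instance it is closed because `Spec L` is separated over `Spec k`. -/
instance : IsOpenImmersion D.toBar := by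
  have h : IsOpenImmersion (pullback.mapDesc D.a (specTop k D.L) (specSub k D.L)) :=
    MorphismProperty.of_isPullback (pullback_map_diagonal_isPullback _ _ _) inferInstance
  rw [toBar_eq, MorphismProperty.cancel_right_of_respectsIso (P := @IsOpenImmersion)]
  exact h

instance : IsClosedImmersion D.toBar := by
  rw [toBar_eq, MorphismProperty.cancel_right_of_respectsIso (P := @IsClosedImmersion)]
  infer_instance

/-- `D ×_L K` as an open and closed subscheme of `D ×_k K`. -/
noncomputable def geom : Geom s ι K where
  V := D.V
  Z := D.toBar.opensRange
  isClosed := D.toBar.isClosedEmbedding.isClosed_range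

/-- The inclusion of `D.geom` into `D ×_k K`. -/
noncomputable def incl : D.geom.scheme ⟶ bar s ι K D.V := D.geom.toBar

instance : IsOpenImmersion D.incl := inferInstanceAs (IsOpenImmersion D.geom.Z.ι)

lemma incl_snd : D.incl ≫ barSnd s ι K D.V = D.geom.toK := rfl

/-- The underlying scheme of `D.geom` is `D ×_L K`. -/
noncomputable def geomIso : D.top ≅ D.geom.scheme := D.toBar.isoOpensRange

lemma geomIso_hom_incl : D.geomIso.hom ≫ D.incl = D.toBar :=
  D.toBar.isoOpensRange_hom_ι

/-- The projection to `D`. -/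
noncomputable def fst : D.geom.scheme ⟶ (ι.obj D.V).left := D.incl ≫ barFst s ι K D.V

lemma fst_hom : D.fst ≫ (ι.obj D.V).hom = D.geom.toS := Category.assoc _ _ _

lemma isPullback : IsPullback D.fst D.geom.toK D.a (specTop k D.L) :=
  (IsPullback.of_hasPullback D.a (specTop k D.L)).of_iso D.geomIso (Iso.refl _) (Iso.refl _)
    (Iso.refl _)
    (by rw [Iso.refl_hom, Category.comp_id, fst, ← Category.assoc, geomIso_hom_incl, toBar_fst])
    (by rw [Iso.refl_hom, Category.comp_id, ← incl_snd, ← Category.assoc, geomIso_hom_incl,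
      toBar_snd])
    (by simp) (by simp)

instance : Flat D.fst := MorphismProperty.of_isPullback (P := @Flat) D.isPullback.flip inferInstance
instance : Surjective D.fst :=
  MorphismProperty.of_isPullback (P := @Surjective) D.isPullback.flip inferInstance
instance : Epi D.fst := Flat.epi_of_flat_of_surjective _

lemma hom_ext {U : Geom s ι K} {f g : U ⟶ D.geom} (h : Geom.deg f = Geom.deg g)
    (h' : Geom.left f ≫ D.fst = Geom.left g ≫ D.fst) : f = g :=
  Geom.hom_ext h (D.isPullback.hom_ext h' (by rw [Geom.left_toK, Geom.left_toK, h]))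

/-- The universal property of `D.geom`. -/
noncomputable def lift {U : Geom s ι K} (n : ℤ) (p : U.scheme ⟶ (ι.obj D.V).left)
    (h : p ≫ (ι.obj D.V).hom = U.toS) (h' : p ≫ D.a = U.toK ≫ specTop k D.L ≫ frobSub k D.L n) :
    U ⟶ D.geom where
  deg := n
  left := D.isPullback.lift p (U.toK ≫ frobSpec k K n)
    (by rw [h', Category.assoc, frobSpec_specTop])
  comp_toK := D.isPullback.lift_snd _ _ _
  comp_toS := by rw [← fst_hom, D.isPullback.lift_fst_assoc, h]

section
variable {U : Geom s ι K} (n : ℤ) (p : U.scheme ⟶ (ι.obj D.V).left)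
    (h : p ≫ (ι.obj D.V).hom = U.toS) (h' : p ≫ D.a = U.toK ≫ specTop k D.L ≫ frobSub k D.L n)

@[simp] lemma deg_lift : Geom.deg (D.lift n p h h') = n := rfl
@[simp] lemma left_lift_fst : Geom.left (D.lift n p h h') ≫ D.fst = p := D.isPullback.lift_fst _ _ _
end

/-- The degree of a morphism to a piece can be read off on the structure map to `Spec L`, modulo `[L
: k]`; the disjointness of the translates rests on this. -/
lemma left_fst_a {U : Geom s ι K} (f : U ⟶ D.geom) :
    (Geom.left f ≫ D.fst) ≫ D.a = U.toK ≫ specTop k D.L ≫ frobSub k D.L (Geom.deg f) := by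
  rw [Category.assoc, D.isPullback.w, ← Category.assoc, Geom.left_toK, Category.assoc,
    frobSpec_specTop]

end Level

/-- The projection from `V̄` to `V`. -/
noncomputable def barProj (V : E) : (barObj s ι K V).scheme ⟶ (ι.obj V).left :=
  (barIso s ι K V).hom ≫ barFst s ι K V

lemma barProj_hom (V : E) : barProj s ι K V ≫ (ι.obj V).hom = (barObj s ι K V).toS := by
  rw [barObj_toS, barProj, Category.assoc]

lemma barProj_isPullback (V : E) : IsPullback (barProj s ι K V) (barObj s ι K V).toK
    ((ι.obj V).hom ≫ s) (specBase k K) :=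
  (bar_isPullback s ι K V).flip.of_iso (barIso s ι K V).symm (Iso.refl _) (Iso.refl _)
    (Iso.refl _) (by simp [barProj]) (by simp [barObj_toK]) (by simp) (by simp)

lemma exists_spec_apply {X : Scheme.{u}} (x : X) :
    ∃ (F : Type u) (_ : Field F) (q : Spec (.of F) ⟶ X), ∀ y, q y = x :=
  ⟨X.residueField x, inferInstance, X.fromSpecResidueField x, X.fromSpecResidueField_apply x⟩

variable {s ι K}

lemma barObj_hom_ext {V : E} {U : Geom s ι K} {f g : U ⟶ barObj s ι K V}
    (h : Geom.deg f = Geom.deg g)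
    (h' : Geom.left f ≫ barProj s ι K V = Geom.left g ≫ barProj s ι K V) : f = g :=
  Geom.hom_ext h ((barProj_isPullback s ι K V).hom_ext h'
    (by rw [Geom.left_toK, Geom.left_toK, h]))

lemma Geom.toK_specBase (U : Geom s ι K) : U.toK ≫ specBase k K = U.toS ≫ s := by
  rw [toK, Category.assoc, (bar_isPullback s ι K U.V).w]
  simp [toS]

/-- The universal property of `V̄`. -/
noncomputable def barLift {V : E} {U : Geom s ι K} (n : ℤ) (p : U.scheme ⟶ (ι.obj V).left)
    (h : p ≫ (ι.obj V).hom = U.toS) : U ⟶ barObj s ι K V where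
  deg := n
  left := (barProj_isPullback s ι K V).lift p (U.toK ≫ frobSpec k K n)
    (by rw [Category.assoc, frobSpec_specBase, reassoc_of% h, Geom.toK_specBase])
  comp_toK := (barProj_isPullback s ι K V).lift_snd _ _ _
  comp_toS := by rw [← barProj_hom, (barProj_isPullback s ι K V).lift_fst_assoc, h]

section
variable {V : E} {U : Geom s ι K} (n : ℤ) (p : U.scheme ⟶ (ι.obj V).left)
    (h : p ≫ (ι.obj V).hom = U.toS)
@[simp] lemma left_barLift : Geom.left (barLift n p h) ≫ barProj s ι K V = p :=
  (barProj_isPullback s ι K V).lift_fst _ _ _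
end

lemma left_barProj_hom {V : E} {U : Geom s ι K} (f : U ⟶ barObj s ι K V) :
    (Geom.left f ≫ barProj s ι K V) ≫ (ι.obj V).hom = U.toS := by
  rw [Category.assoc, barProj_hom, Geom.left_toS]

@[simp] lemma twist_barProj {V V' : E} (f : V ⟶ V') (n : ℤ) :
    Geom.left (twist s ι K f n) ≫ barProj s ι K V' = barProj s ι K V ≫ (ι.map f).left := by
  simp [barProj]

lemma twist_comp_zero {V V' V'' : E} (f : V ⟶ V') (g : V' ⟶ V'') :
    twist s ι K (f ≫ g) 0 = twist s ι K f 0 ≫ twist s ι K g 0 :=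
  twist_comp s ι K f g 0 0

namespace Level

variable (D : Level s ι K)

/-- The inclusion of `D ×_L K` into `D ×_k K`, composed with a power of the Frobenius. -/
noncomputable def tr (n : ℤ) : D.geom ⟶ barObj s ι K D.V := barLift n D.fst D.fst_hom

@[simp] lemma deg_tr (n : ℤ) : Geom.deg (D.tr n) = n := rfl
@[simp] lemma left_tr (n : ℤ) : Geom.left (D.tr n) ≫ barProj s ι K D.V = D.fst := left_barLift _ _ _

lemma tr_twist (n m : ℤ) : D.tr n ≫ twist s ι K (𝟙 D.V) m = D.tr (n + m) :=
  barObj_hom_ext (by simp) (by simp [-left_twist])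

lemma left_tr_zero : Geom.left (D.tr 0) = D.incl ≫ (barIso s ι K D.V).inv := by
  apply (barProj_isPullback s ι K D.V).hom_ext
  · rw [left_tr, barProj, Category.assoc, Iso.inv_hom_id_assoc]; rfl
  · rw [Geom.left_toK, deg_tr, frobSpec_zero, barObj_toK, Category.assoc, Iso.inv_hom_id_assoc,
      Category.comp_id]; rfl

instance (V : E) (n : ℤ) : IsIso (twist s ι K (𝟙 V) n) :=
  ⟨twist s ι K (𝟙 V) (-n), barObj_hom_ext (by simp) (by simp [-left_twist]),
    barObj_hom_ext (by simp) (by simp [-left_twist])⟩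

instance {U U' : Geom s ι K} (f : U ⟶ U') [IsIso f] : IsIso (Geom.left f) :=
  inferInstanceAs (IsIso ((Geom.forget s ι K).map f))

instance (n : ℤ) : IsOpenImmersion (Geom.left (D.tr n)) := by
  have : IsOpenImmersion (Geom.left (D.tr 0)) := by
    rw [left_tr_zero]
    infer_instance
  rw [← zero_add n, ← tr_twist, Geom.left_comp]
  infer_instance

lemma eq_of_tr {U : Geom s ι K} {f g : U ⟶ D.geom} {n : ℤ} (h : f ≫ D.tr n = g ≫ D.tr n) :
    f = g := by
  refine D.hom_ext (by simpa using congrArg Geom.deg h) ?_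
  simpa using congrArg (fun t ↦ Geom.left t ≫ barProj s ι K D.V) h

/-- The translates by different powers of the Frobenius are disjoint. -/
lemma dvd_of_tr_eq {U : Geom s ι K} {f g : U ⟶ D.geom} {n m : ℤ}
    (h : f ≫ D.tr n = g ≫ D.tr m) (x : U.scheme) : (D.N : ℤ) ∣ n - m := by
  have h1 : Geom.left f ≫ D.fst = Geom.left g ≫ D.fst := by
    simpa using congrArg (fun t ↦ Geom.left t ≫ barProj s ι K D.V) h
  have h2 : Geom.deg f + n = Geom.deg g + m := by simpa using congrArg Geom.deg h
  have h3 := D.left_fst_a f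
  rw [h1, D.left_fst_a g] at h3
  -- At a point, `L` embeds in the residue field, so the equality of two composites with powers of
  -- the Frobenius is an equality of these powers on `L`. On an empty `U` nothing could be
  -- concluded.
  obtain ⟨F, _, q, hq⟩ := exists_spec_apply x
  obtain ⟨r, hr⟩ := Spec.map_surjective (q ≫ U.toK ≫ specTop k D.L)
  have h4 := congrArg (q ≫ ·) h3
  simp only [← Category.assoc] at h4
  rw [Category.assoc q, ← hr, frobSub, frobSub, ← Spec.map_comp, ← Spec.map_comp] at h4
  have h5 := Spec.map_injective h4
  have hr' : Function.Injective r := RingHom.injective (R := D.L) (S := F) r.hom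
  have h6 (x : D.L) : (FiniteField.frobeniusAlgEquivOfAlgebraic k D.L ^ (-Geom.deg g)) x =
      (FiniteField.frobeniusAlgEquivOfAlgebraic k D.L ^ (-Geom.deg f)) x :=
    hr' (ConcreteCategory.congr_hom h5 x)
  have h7 : frobSub k D.L (Geom.deg g) = frobSub k D.L (Geom.deg f) := by
    rw [frobSub, frobSub]
    congr 2
    ext x
    exact congrArg Subtype.val (h6 x)
  rw [← frobSub_eq_id_iff, show n - m = Geom.deg g + - Geom.deg f by omega, frobSub_add, h7,
    ← frobSub_add, add_neg_cancel, frobSub_eq_id_iff]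
  exact dvd_zero _

/-- The translates by powers of the Frobenius cover. -/
lemma exists_tr_apply (x : (barObj s ι K D.V).scheme) :
    ∃ i < D.N, ∃ y, Geom.left (D.tr i) y = x := by
  obtain ⟨F, _, q, hq⟩ := exists_spec_apply x
  -- A point of `V̄` gives two embeddings of `L` in the residue field, through `V` and through `K`;
  -- the power of the Frobenius between them is the index of the translate.
  obtain ⟨i, hi, h⟩ := exists_eq_frobSub k D.L (q ≫ barProj s ι K D.V ≫ D.a)
    (q ≫ (barObj s ι K D.V).toK ≫ specTop k D.L) (by
      rw [Category.assoc, Category.assoc, Category.assoc, Category.assoc, D.w, specTop_specSub,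
        (barProj_isPullback s ι K D.V).w]; rfl)
  have h' : (q ≫ barProj s ι K D.V) ≫ D.a =
      (q ≫ (barObj s ι K D.V).toK ≫ frobSpec k K (-i)) ≫ specTop k D.L := by
    rw [Category.assoc, h, Category.assoc, Category.assoc, Category.assoc, Category.assoc,
      frobSpec_specTop]
  let y : Spec (.of F) := IsLocalRing.closedPoint F
  refine ⟨i, hi, D.isPullback.lift _ _ h' y, ?_⟩
  have h2 : D.isPullback.lift _ _ h' ≫ Geom.left (D.tr i) = q := by
    apply (barProj_isPullback s ι K D.V).hom_ext
    · simp
    · rw [Category.assoc, Geom.left_toK, D.isPullback.lift_snd_assoc]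
      simp [← frobSpec_add, frobSpec_zero]
  rw [← Scheme.Hom.comp_apply, h2, hq]

lemma frobSub_eq_id {n : ℤ} (h : (D.N : ℤ) ∣ n) : frobSub k D.L n = 𝟙 _ :=
  (frobSub_eq_id_iff k D.L n).2 h

lemma fst_a {n : ℤ} (h : (D.N : ℤ) ∣ n) :
    D.fst ≫ D.a = D.geom.toK ≫ specTop k D.L ≫ frobSub k D.L n := by
  rw [D.frobSub_eq_id h, Category.comp_id, D.isPullback.w]

/-- The automorphism of `D ×_L K` given by a power of the Frobenius which is trivial on `L`. -/
noncomputable def psi (n : ℤ) (h : (D.N : ℤ) ∣ n) : D.geom ⟶ D.geom :=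
  D.lift n D.fst D.fst_hom (D.fst_a h)

@[simp] lemma deg_psi (n : ℤ) (h : (D.N : ℤ) ∣ n) : Geom.deg (D.psi n h) = n := rfl
@[simp] lemma left_psi_fst (n : ℤ) (h : (D.N : ℤ) ∣ n) : Geom.left (D.psi n h) ≫ D.fst = D.fst :=
  D.left_lift_fst _ _ _ _

lemma psi_tr (n : ℤ) (h : (D.N : ℤ) ∣ n) (m : ℤ) : D.psi n h ≫ D.tr m = D.tr (n + m) :=
  barObj_hom_ext (by simp) (by simp)

/-- Morphisms of levels. -/
@[ext]
structure Map (D D' : Level s ι K) where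
  f : D.V ⟶ D'.V
  le : D'.L ≤ D.L
  w : D.a ≫ specLE k le = (ι.map f).left ≫ D'.a

variable {D} {D' : Level s ι K}

/-- The morphism `D ×_L K ⟶ D' ×_L' K` induced by a morphism of levels. -/
noncomputable def map (h : Map D D') : D.geom ⟶ D'.geom :=
  D'.lift 0 (D.fst ≫ (ι.map h.f).left) (by rw [Category.assoc, Over.w, fst_hom]) (by
    rw [D'.frobSub_eq_id (dvd_zero _), Category.comp_id, Category.assoc, ← h.w,
      D.isPullback.w_assoc, specTop_specLE])

@[simp] lemma deg_map (h : Map D D') : Geom.deg (map h) = 0 := rfl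
@[simp] lemma left_map_fst (h : Map D D') :
    Geom.left (map h) ≫ D'.fst = D.fst ≫ (ι.map h.f).left := left_lift_fst _ _ _ _ _

lemma map_tr (h : Map D D') (n : ℤ) : map h ≫ D'.tr n = D.tr n ≫ twist s ι K h.f 0 :=
  barObj_hom_ext (by simp) (by
    simp only [Geom.left_comp, Category.assoc, left_tr, left_map_fst, twist_barProj]
    rw [← Category.assoc, left_tr])

lemma dvd_of_le {L L' : IntermediateField k K} (h : L ≤ L') [FiniteDimensional k L'] :
    Module.finrank k L ∣ Module.finrank k L' :=
  IntermediateField.finrank_dvd_of_le_right h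

lemma Map.dvd (h : Map D D') : D'.N ∣ D.N := dvd_of_le h.le

lemma map_psi (h : Map D D') (n : ℤ) (hn : (D.N : ℤ) ∣ n) :
    D.psi n hn ≫ map h =
      map h ≫ D'.psi n ((Int.natCast_dvd_natCast.2 h.dvd).trans hn) :=
  D'.hom_ext (by simp) (by
    simp only [Geom.left_comp, Category.assoc, left_psi_fst, left_map_fst]
    rw [← Category.assoc, left_psi_fst])

/-- Composition of morphisms of levels. -/
def Map.comp {D'' : Level s ι K} (h : Map D D') (h' : Map D' D'') : Map D D'' where
  f := h.f ≫ h'.f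
  le := h'.le.trans h.le
  w := by
    rw [Functor.map_comp, Over.comp_left, Category.assoc, ← h'.w, ← reassoc_of% h.w]
    congr 1
    rw [specLE, specLE, specLE, ← Spec.map_comp]; rfl

lemma map_comp {D'' : Level s ι K} (h : Map D D') (h' : Map D' D'') :
    map (h.comp h') = map h ≫ map h' :=
  D''.hom_ext (by simp) (by
    simp only [Geom.left_comp, Category.assoc, left_map_fst, Map.comp, Functor.map_comp,
      Over.comp_left]
    rw [← Category.assoc, ← left_map_fst, Category.assoc])

/-- The identity morphism of a level. -/
def Map.id (D : Level s ι K) : Map D D where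
  f := 𝟙 _
  le := le_rfl
  w := by
    have : specLE k (le_refl D.L) = 𝟙 _ := Spec.map_id _
    simp [this]

lemma map_id (D : Level s ι K) : map (.id D) = 𝟙 _ := D.hom_ext (by simp) (by simp [Map.id])

end Level
end Level
end WeilEtale

namespace WeilEtale

/-! ### Étale neighbourhoods of pieces are defined over finite extensions -/

section Covers

variable {k : Type u} [Field k] [Fintype k]
  {S : Scheme.{u}} {s : S ⟶ Spec (.of k)} {E : Type u} [SmallCategory E] {ι : E ⥤ Over S}
  {K : Type u} [Field K] [Algebra k K] [IsAlgClosure k K]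

/-- A sieve containing étale morphisms through every point is a covering. -/
lemma mem_etaleTopology {V : E} {T : Sieve V}
    (h : ∀ v : (ι.obj V).left, ∃ (W : E) (f : W ⟶ V), T f ∧ Etale (ι.map f).left ∧
      ∃ w, (ι.map f).left w = v) : T ∈ etaleTopology ι V := by
  choose W f hT hf w hw using h
  have : Sieve.generate (Presieve.ofArrows W f) ∈ etaleTopology ι V := by
    refine Precoverage.generate_mem_toGrothendieck ?_
    rw [Precoverage.mem_comap_iff, Presieve.map_ofArrows]
    exact (Scheme.ofArrows_mem_precoverage_iff _).2 ⟨fun v ↦ ⟨v, w v, hw v⟩, hf⟩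
  refine GrothendieckTopology.superset_covering _ ?_ this
  rw [Sieve.generate_le_iff]
  rintro _ _ ⟨v⟩
  exact hT v

/-- A sieve containing étale morphisms through every point is a covering. -/
lemma mem_weilTopology {V : Geom s ι K} {T : Sieve V}
    (h : ∀ v : V.scheme, ∃ (W : Geom s ι K) (f : W ⟶ V), T f ∧ Etale (Geom.left f) ∧
      ∃ w, Geom.left f w = v) : T ∈ weilTopology s ι K V := by
  choose W f hT hf w hw using h
  have : Sieve.generate (Presieve.ofArrows W f) ∈ weilTopology s ι K V := by
    refine Precoverage.generate_mem_toGrothendieck ?_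
    rw [Precoverage.mem_comap_iff, Presieve.map_ofArrows]
    exact (Scheme.ofArrows_mem_precoverage_iff _).2 ⟨fun v ↦ ⟨v, w v, hw v⟩, hf⟩
  refine GrothendieckTopology.superset_covering _ ?_ this
  rw [Sieve.generate_le_iff]
  rintro _ _ ⟨v⟩
  exact hT v

/-- A morphism of the geometric category is an isomorphism if the underlying morphism of schemes
is. -/
lemma isIso_of_left {U U' : Geom s ι K} (f : U ⟶ U') [IsIso (Geom.left f)] : IsIso f := by
  let g : U' ⟶ U :=
    { deg := -Geom.deg f
      left := inv (Geom.left f)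
      comp_toK := by
        rw [IsIso.inv_comp_eq, ← Category.assoc, Geom.left_toK, Category.assoc, ← frobSpec_add,
          add_neg_cancel, frobSpec_zero, Category.comp_id]
      comp_toS := by rw [IsIso.inv_comp_eq, Geom.left_toS] }
  exact ⟨g, Geom.hom_ext (add_neg_cancel _) (IsIso.hom_inv_id (Geom.left f)),
    Geom.hom_ext (neg_add_cancel _) (IsIso.inv_hom_id (Geom.left f))⟩

instance etale_specLE {L L' : IntermediateField k K} (h : L ≤ L') [FiniteDimensional k L]
    [FiniteDimensional k L'] : Etale (specLE k h) := by
  have : Etale (specLE k h ≫ specSub k L) := by rw [specLE_specSub]; infer_instance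
  exact Etale.of_comp _ (specSub k L)

instance surjective_specLE {L L' : IntermediateField k K} (h : L ≤ L') :
    Surjective (specLE k h) := (flat_surjective_spec _).2

section

variable {L : IntermediateField k K} [FiniteDimensional k L] {X P : Scheme.{u}}
  {x : X ⟶ Spec (.of L)} {f : P ⟶ X} {t : P ⟶ Spec (.of K)}

lemma finiteDimensional_restrictScalars (L' : IntermediateField L K) [FiniteDimensional L L'] :
    FiniteDimensional k (L'.restrictScalars k) :=
  have : FiniteDimensional k L' := FiniteDimensional.trans k L L'
  this

lemma le_restrictScalars (L' : IntermediateField L K) : L ≤ L'.restrictScalars k :=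
  fun x hx ↦ L'.algebraMap_mem ⟨x, hx⟩

/-- A morphism from the base change of `X` to `K` to a scheme locally of finite presentation is
defined over a finite extension. -/
lemma exists_factor_of_isPullback [QuasiCompact x] [QuasiSeparated x]
    (hP : IsPullback f t x (specTop k L)) {W B : Scheme.{u}} (b : Spec (.of L) ⟶ B) (w : W ⟶ B)
    [LocallyOfFinitePresentation w] (g : P ⟶ W) (hg : g ≫ w = f ≫ x ≫ b) :
    ∃ (L' : IntermediateField k K) (_ : FiniteDimensional k L') (hL : L ≤ L'),
      ∀ {Q : Scheme.{u}} (f' : Q ⟶ X) (t' : Q ⟶ Spec (.of L')) (_ : f' ≫ x = t' ≫ specLE k hL),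
        ∃ h : Q ⟶ W, ∀ q : P ⟶ Q, q ≫ f' = f → q ≫ t' = t ≫ specTop k L' → q ≫ h = g := by
  have : Algebra.IsAlgebraic L K := Algebra.IsAlgebraic.tower_top (K := k) L
  have hP' : IsPullback f t x (specTopBase L K) := hP
  let j : levTop L K x ⟶ P := hP'.lift _ _ pullback.condition
  have hj₁ : j ≫ f = pullback.fst _ _ := hP'.lift_fst _ _ _
  let j' : P ⟶ levTop L K x := pullback.lift f t hP'.w
  have hj'₁ : j' ≫ pullback.fst _ _ = f := pullback.lift_fst _ _ _
  have hj'₂ : j' ≫ pullback.snd _ _ = t := pullback.lift_snd _ _ _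
  have hj : j' ≫ j = 𝟙 _ := hP'.hom_ext (by simp [j, hj'₁]) (by simp [j, hj'₂])
  obtain ⟨L'', h, h₁, h₂⟩ := exists_finSub_factor (k := L) (K := K) x b w (j ≫ g) (by
    rw [Category.assoc, hg, reassoc_of% hj₁])
  refine ⟨L''.1.restrictScalars k, finiteDimensional_restrictScalars _, le_restrictScalars _,
    fun {Q} f' t' ht' ↦ ?_⟩
  let t'' : Q ⟶ Spec (.of L''.1) := t'
  have ht'' : f' ≫ x = t'' ≫ specSub L L''.1 := ht'
  -- An arbitrary `Q` is allowed because members of `E` represent the base changes only up to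
  -- isomorphism.
  refine ⟨pullback.lift f' t'' ht'' ≫ h, fun q h1 h2 ↦ ?_⟩
  have h3 : q ≫ t'' = t ≫ specTop L L''.1 := h2
  have : q ≫ pullback.lift f' t'' ht'' = j' ≫ levProj L x L''.1 := by
    apply pullback.hom_ext
    · rw [Category.assoc, pullback.lift_fst, h1, Category.assoc, levProj_fst, hj'₁]
    · rw [Category.assoc, pullback.lift_snd, h3, Category.assoc, levProj_snd, reassoc_of% hj'₂]
  rw [reassoc_of% this, h₁, reassoc_of% hj]

/-- An affine scheme étale over the base change of an affine scheme to `K` is defined over a finite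
extension. -/
lemma exists_etale_of_isPullback [IsAffine X] (hP : IsPullback f t x (specTop k L))
    {U : Scheme.{u}} [IsAffine U] (e : U ⟶ P) [Etale e] :
    ∃ (L' : IntermediateField k K) (_ : FiniteDimensional k L') (hL : L ≤ L') (U' : Scheme.{u})
      (_ : IsAffine U') (f' : U' ⟶ X) (_ : Etale f') (a : U' ⟶ Spec (.of L')) (p : U ⟶ U'),
      a ≫ specLE k hL = f' ≫ x ∧ IsPullback p (e ≫ t) a (specTop k L') ∧ p ≫ f' = e ≫ f := by
  have : Algebra.IsAlgebraic L K := Algebra.IsAlgebraic.tower_top (K := k) L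
  have : Algebra.IsSeparable L K := Algebra.isSeparable_tower_top_of_isSeparable k L K
  have hP' : IsPullback f t x (specTopBase L K) := hP
  let j : P ≅ levTop L K x := hP'.isoPullback
  have hj₁ : j.hom ≫ pullback.fst _ _ = f := hP'.isoPullback_hom_fst
  have hj₂ : j.hom ≫ pullback.snd _ _ = t := hP'.isoPullback_hom_snd
  obtain ⟨L'', U', _, e', _, p, hp⟩ := exists_finSub_etale L x (e ≫ j.hom)
  have H := hp.paste_vert (levProj_isPullback L x L''.1)
  rw [Category.assoc, hj₂] at H
  have h1 : p ≫ e' ≫ pullback.fst x (specSub L L''.1) = e ≫ f := by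
    rw [hp.w_assoc, levProj_fst, Category.assoc, hj₁]
  have h2 : (e' ≫ pullback.snd x (specSub L L''.1)) ≫ specSub L L''.1 =
      (e' ≫ pullback.fst x (specSub L L''.1)) ≫ x := by
    rw [Category.assoc, Category.assoc, pullback.condition]
  have h3 : Etale (pullback.fst x (specSub L L''.1)) := inferInstance
  have h4 : Etale (e' ≫ pullback.fst x (specSub L L''.1)) := inferInstance
  exact ⟨L''.1.restrictScalars k, finiteDimensional_restrictScalars _, le_restrictScalars _, U', ‹_›,
    e' ≫ pullback.fst x (specSub L L''.1), h4, e' ≫ pullback.snd x (specSub L L''.1), p, h2, H, h1⟩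

end

variable [hE : IsEtaleFamily s ι]

lemma exists_iso_of_etale {V : E} {U : Scheme.{u}} (f : U ⟶ (ι.obj V).left) [Etale f]
    [QuasiCompact f] [IsSeparated (f ≫ (ι.obj V).hom ≫ s)] :
    ∃ (W : E) (g : W ⟶ V) (e : (ι.obj W).left ≅ U), (ι.map g).left = e.hom ≫ f := by
  have := hE.full
  obtain ⟨W, ⟨e⟩⟩ := hE.etale_mem V (Over.mk (f ≫ (ι.obj V).hom)) (Over.homMk f rfl)
    ‹_› ‹_› (by simpa)
  refine ⟨W, ι.preimage (e.hom ≫ Over.homMk f rfl), (Over.forget S).mapIso e, ?_⟩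
  rw [ι.map_preimage]
  rfl

namespace Level

instance (V : E) : QuasiCompact ((ι.obj V).hom ≫ s) := hE.quasiCompact V
instance (V : E) : IsSeparated ((ι.obj V).hom ≫ s) := hE.separated V
instance (V : E) : LocallyOfFiniteType ((ι.obj V).hom ≫ s) := hE.locallyOfFiniteType V

instance (D : Level s ι K) : QuasiCompact D.a := by
  have : QuasiCompact (D.a ≫ specSub k D.L) := by rw [D.w]; infer_instance
  exact QuasiCompact.of_comp _ (specSub k D.L)

instance (D : Level s ι K) : QuasiSeparated D.a := by
  have : QuasiSeparated (D.a ≫ specSub k D.L) := by rw [D.w]; infer_instance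
  exact QuasiSeparated.of_comp _ (specSub k D.L)

/-- Base change of a level along a finite extension. -/
lemma exists_baseChange (D : Level s ι K) (L : IntermediateField k K) [FiniteDimensional k L]
    (h : D.L ≤ L) : ∃ (W : E) (f : W ⟶ D.V) (a : (ι.obj W).left ⟶ Spec (.of L)),
      IsPullback (ι.map f).left a D.a (specLE k h) := by
  have : IsFinite (specLE k h) := by
    have : IsFinite (specLE k h ≫ specSub k D.L) := by rw [specLE_specSub]; infer_instance
    exact IsFinite.of_comp _ (specSub k D.L)
  have : IsSeparated (pullback.fst D.a (specLE k h) ≫ (ι.obj D.V).hom ≫ s) := inferInstance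
  obtain ⟨W, f, e, he⟩ := exists_iso_of_etale (s := s) (V := D.V) (pullback.fst D.a (specLE k h))
  refine ⟨W, f, e.hom ≫ pullback.snd _ _, ?_⟩
  exact (IsPullback.of_hasPullback D.a (specLE k h)).of_iso e.symm (Iso.refl _) (Iso.refl _)
    (Iso.refl _) (by simp [he]) (by simp) (by simp) (by simp)

/-- Enlarging the field of a level by base change does not alter the piece: `(V ×_L L') ×_{L'} K = V
×_L K`. Hence fields of definition may be enlarged at will. -/
lemma isIso_map {D' D : Level s ι K} (m : Map D' D)
    (h : IsPullback (ι.map m.f).left D'.a D.a (specLE k m.le)) : IsIso (map m) := by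
  have h1 := D'.isPullback.flip.paste_vert h.flip
  rw [specTop_specLE] at h1
  have : Geom.left (map m) = (IsPullback.isoIsPullback _ _ h1.flip D.isPullback).hom := by
    apply D.isPullback.hom_ext
    · rw [left_map_fst, IsPullback.isoIsPullback_hom_fst]
    · rw [Geom.left_toK, IsPullback.isoIsPullback_hom_snd, deg_map, frobSpec_zero,
        Category.comp_id]
  have : IsIso (Geom.left (map m)) := by rw [this]; infer_instance
  exact isIso_of_left _

lemma left_map_toK {D' D : Level s ι K} (m : Map D' D) :
    Geom.left (map m) ≫ D.geom.toK = D'.geom.toK := by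
  rw [Geom.left_toK, deg_map, frobSpec_zero, Category.comp_id]

/-- Base change of a level along a finite extension. -/
lemma exists_map_baseChange (D : Level s ι K) (L : IntermediateField k K) [FiniteDimensional k L]
    (h : D.L ≤ L) : ∃ (D' : Level s ι K) (m : Map D' D), D'.L = L ∧ Etale (ι.map m.f).left ∧
      Surjective (ι.map m.f).left ∧ IsIso (map m) ∧
        IsPullback (ι.map m.f).left D'.a D.a (specLE k m.le) := by
  obtain ⟨W, f, a, hf⟩ := D.exists_baseChange L h
  let D' : Level s ι K := ⟨W, L, inferInstance, a, by
    rw [← specLE_specSub k h, ← hf.w_assoc, D.w, Over.w_assoc]⟩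
  let m : Map D' D := ⟨f, h, hf.w.symm⟩
  exact ⟨D', m, rfl, MorphismProperty.of_isPullback (P := @Etale) hf.flip (etale_specLE h),
    MorphismProperty.of_isPullback (P := @Surjective) hf.flip (surjective_specLE h),
    isIso_map m hf, hf⟩

lemma locallyOfFinitePresentation (W : E) :
    LocallyOfFinitePresentation ((ι.obj W).hom ≫ s) := by
  have : IsNoetherianRing (CommRingCat.of k) := inferInstanceAs (IsNoetherianRing k)
  rw [LocallyOfFinitePresentation.iff_locallyOfFiniteType]
  infer_instance

/-- A morphism over `S` from `D ×_L K` to a member of `E` is defined over a finite extension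
of `L`. -/
lemma exists_factor (D : Level s ι K) {W : E} (g : D.geom.scheme ⟶ (ι.obj W).left)
    (hg : g ≫ (ι.obj W).hom = D.geom.toS) :
    ∃ (D' : Level s ι K) (m : Map D' D) (h : D'.V ⟶ W), Etale (ι.map m.f).left ∧
      Surjective (ι.map m.f).left ∧ IsIso (map m) ∧
        D'.fst ≫ (ι.map h).left = Geom.left (map m) ≫ g := by
  have := hE.full
  have := locallyOfFinitePresentation (s := s) (ι := ι) W
  obtain ⟨L, _, hL, H⟩ := exists_factor_of_isPullback D.isPullback (specSub k D.L)
    ((ι.obj W).hom ≫ s) g (by rw [D.w, reassoc_of% hg, ← fst_hom, Category.assoc])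
  obtain ⟨D', m, hD', hm₁, hm₂, hm₃, hm₄⟩ := D.exists_map_baseChange L hL
  subst hD'
  obtain ⟨h, hh⟩ := H (ι.map m.f).left D'.a m.w.symm
  have hfac : D'.fst ≫ h = Geom.left (map m) ≫ g := by
    rw [← hh (inv (Geom.left (map m)) ≫ D'.fst), Category.assoc, IsIso.hom_inv_id_assoc]
    · rw [Category.assoc, ← left_map_fst, IsIso.inv_hom_id_assoc]
    · rw [Category.assoc, D'.isPullback.w, ← left_map_toK m, Category.assoc,
        IsIso.inv_hom_id_assoc]
  -- Being a morphism over `S` may be checked after composition with the epimorphism `D'.fst`.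
  have hS : h ≫ (ι.obj W).hom = (ι.obj D'.V).hom := by
    rw [← cancel_epi D'.fst, ← Category.assoc, hfac, Category.assoc, hg, Geom.left_toS, fst_hom]
  refine ⟨D', m, ι.preimage (Over.homMk h hS), hm₁, hm₂, hm₃, ?_⟩
  rw [ι.map_preimage]
  exact hfac

/-- Étale neighbourhoods of points of `D ×_L K` are refined by étale neighbourhoods which are
defined over a finite extension of `L`. -/
lemma exists_lift_etale (D : Level s ι K) {U : Scheme.{u}} (e : U ⟶ D.geom.scheme) [Etale e]
    (y : U) : ∃ (D' : Level s ι K) (m : Map D' D) (q : D'.geom.scheme ⟶ U),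
      Etale (ι.map m.f).left ∧ q ≫ e = Geom.left (map m) ∧ ∃ z, q z = y := by
  -- The descent of étale schemes was established for affine schemes, so the base and the
  -- neighbourhood are both shrunk to affine opens around the given points.
  obtain ⟨V', hV', hy, -⟩ := (ι.obj D.V).left.isBasis_affineOpens.exists_subset_of_mem_open
    (Set.mem_univ (D.fst (e y))) isOpen_univ
  obtain ⟨V', hV', rfl⟩ : ∃ V'' : (ι.obj D.V).left.Opens, IsAffineOpen V'' ∧ V'' = V' := hV'
  have : IsAffine V'.toScheme := hV'
  let i := pullback.fst D.fst V'.ι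
  have hP : IsPullback (pullback.snd D.fst V'.ι) (i ≫ D.geom.toK) (V'.ι ≫ D.a) (specTop k D.L) :=
    ((IsPullback.of_hasPullback D.fst V'.ι).paste_horiz D.isPullback.flip).flip
  obtain ⟨z₀, hz₀, -⟩ := Scheme.Pullback.exists_preimage_pullback (f := D.fst) (g := V'.ι) (e y)
    ⟨D.fst (e y), hy⟩ rfl
  obtain ⟨y₀, hy₀, -⟩ := Scheme.Pullback.exists_preimage_pullback (f := e) (g := i) y z₀ hz₀.symm
  obtain ⟨U₁, hU₁, hyU, -⟩ := (pullback e i).isBasis_affineOpens.exists_subset_of_mem_open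
    (Set.mem_univ y₀) isOpen_univ
  obtain ⟨U₁, hU₁, rfl⟩ : ∃ U'' : (pullback e i).Opens, IsAffineOpen U'' ∧ U'' = U₁ := hU₁
  have : IsAffine U₁.toScheme := hU₁
  obtain ⟨L, _, hL, U', _, f', _, a, p, ha, hp, hpf⟩ := exists_etale_of_isPullback hP
    (U₁.ι ≫ pullback.snd e i)
  have : QuasiCompact (f' ≫ V'.ι) := by
    have : QuasiCompact ((f' ≫ V'.ι) ≫ (ι.obj D.V).hom ≫ s) := inferInstance
    exact QuasiCompact.of_comp _ ((ι.obj D.V).hom ≫ s)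
  obtain ⟨W, g, eW, hg⟩ := exists_iso_of_etale (s := s) (V := D.V) (f' ≫ V'.ι)
  have hag : (eW.hom ≫ a) ≫ specLE k hL = (ι.map g).left ≫ D.a := by
    rw [Category.assoc, ha, hg, Category.assoc, Category.assoc]
  let D' : Level s ι K := ⟨W, L, ‹_›, eW.hom ≫ a, by
    rw [← specLE_specSub k hL, ← Category.assoc, hag, Category.assoc, D.w, Over.w_assoc]⟩
  let m : Map D' D := ⟨g, hL, hag⟩
  let q₀ : D'.geom.scheme ⟶ U₁ := hp.lift (D'.fst ≫ eW.hom) D'.geom.toK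
    ((Category.assoc _ _ _).trans D'.isPullback.w)
  have hq₁ : q₀ ≫ p = D'.fst ≫ eW.hom := hp.lift_fst _ _ _
  have hq₂ : q₀ ≫ (U₁.ι ≫ pullback.snd e i) ≫ i ≫ D.geom.toK = D'.geom.toK := hp.lift_snd _ _ _
  let r : U₁.toScheme ⟶ D'.geom.scheme := D'.isPullback.lift (p ≫ eW.inv)
    ((U₁.ι ≫ pullback.snd e i) ≫ i ≫ D.geom.toK) (by
      rw [Category.assoc]
      exact (congrArg (p ≫ ·) (eW.inv_hom_id_assoc a)).trans hp.w)
  -- A one-sided inverse suffices, as it only serves to lift the chosen point to `D'.geom`.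
  have hr : r ≫ q₀ = 𝟙 _ := by
    apply hp.hom_ext
    · rw [Category.assoc, hq₁, Category.id_comp, D'.isPullback.lift_fst_assoc, Category.assoc,
        Iso.inv_hom_id, Category.comp_id]
    · rw [Category.assoc, hq₂, Category.id_comp, D'.isPullback.lift_snd]
  let y₁ : U₁.toScheme := ⟨y₀, hyU⟩
  refine ⟨D', m, q₀ ≫ U₁.ι ≫ pullback.fst e i, ?_, ?_, r y₁, ?_⟩
  · change Etale (ι.map g).left
    rw [hg]
    infer_instance
  · apply D.isPullback.hom_ext
    · rw [left_map_fst, Category.assoc, Category.assoc, Category.assoc, pullback.condition_assoc,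
        pullback.condition]
      simp only [Category.assoc] at hpf
      rw [← reassoc_of% hpf, reassoc_of% hq₁, ← hg]
    · rw [left_map_toK, ← hq₂]
      simp only [Category.assoc, pullback.condition_assoc]
  · have : r ≫ q₀ ≫ U₁.ι ≫ pullback.fst e i = U₁.ι ≫ pullback.fst e i := by
      rw [reassoc_of% hr]
    rw [← Scheme.Hom.comp_apply, this]
    exact hy₀

end Level
end Covers
end WeilEtale

/-! ### Splitting coverings of `V̄` over étale coverings of `V` -/

namespace WeilEtale

/-- Lets the number of pieces of a splitting be divisible by a prescribed integer, which is the
source of the unique divisibility of the coinvariants. -/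
lemma exists_finrank_eq (k : Type u) [Field k] (K : Type u) [Field K] [Algebra k K]
    [IsAlgClosure k K] (n : ℕ) [NeZero n] [Finite k] :
    ∃ L : IntermediateField k K, FiniteDimensional k L ∧ Module.finrank k L = n := by
  obtain ⟨p, _⟩ := CharP.exists k
  have : Fact p.Prime := ⟨CharP.char_is_prime k p⟩
  have : IsAlgClosed K := IsAlgClosure.isAlgClosed k
  let f : FiniteField.Extension k p n →ₐ[k] K := IsAlgClosed.lift
  let e := AlgEquiv.ofInjectiveField f
  exact ⟨f.fieldRange, e.toLinearEquiv.finiteDimensional,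
    e.toLinearEquiv.finrank_eq.symm.trans (FiniteField.finrank_extension ..)⟩

section Refine

variable {k : Type u} [Field k] [Fintype k]
  {S : Scheme.{u}} {s : S ⟶ Spec (.of k)} {E : Type u} [SmallCategory E] {ι : E ⥤ Over S}
  {K : Type u} [Field K] [Algebra k K] [IsAlgClosure k K]
variable [hE : IsEtaleFamily s ι]

namespace Level

lemma toK_eq {Z Y : Geom s ι K} (g : Z ⟶ Y) :
    Z.toK = Geom.left g ≫ Y.toK ≫ frobSpec k K (-Geom.deg g) := by
  rw [← Category.assoc, Geom.left_toK, Category.assoc, ← frobSpec_add, add_neg_cancel,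
    frobSpec_zero, Category.comp_id]

/-- Coverings in the geometric category are refined, locally around a given point, by étale
neighbourhoods which are defined over a finite extension. -/
lemma exists_map_mem {Y : Geom s ι K} {T : Sieve Y} (hT : T ∈ weilTopology s ι K Y)
    (D : Level s ι K) (f : D.geom ⟶ Y) (z : D.geom.scheme) :
    ∃ (D' : Level s ι K) (m : Map D' D), Etale (ι.map m.f).left ∧
      (∃ z', Geom.left (map m) z' = z) ∧ T (map m ≫ f) := by
  replace hT : Precoverage.Saturate _ Y T := hT
  -- The induction follows the generation of the topology. The level, the morphism and the point
  -- must vary, since the pullback and transitivity cases apply the hypothesis to other ones.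
  induction hT generalizing D with
  | of Y R hR =>
    obtain ⟨I, Z, g, rfl⟩ := R.exists_eq_ofArrows
    rw [Precoverage.mem_comap_iff, Presieve.map_ofArrows] at hR
    obtain ⟨h₁, h₂⟩ := (Scheme.ofArrows_mem_precoverage_iff _).1 hR
    obtain ⟨i, w, hw⟩ := h₁ (Geom.left f z)
    have : Etale (Geom.left (g i)) := h₂ i
    obtain ⟨y, hy, -⟩ := Scheme.Pullback.exists_preimage_pullback (f := Geom.left f)
      (g := Geom.left (g i)) z w hw.symm
    obtain ⟨D', m, q, hm, hq, z', hz'⟩ :=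
      D.exists_lift_etale (pullback.fst (Geom.left f) (Geom.left (g i))) y
    have hq' : q ≫ pullback.snd _ _ ≫ Geom.left (g i) = Geom.left (map m) ≫ Geom.left f := by
      rw [← pullback.condition, reassoc_of% hq]
    -- The degree is forced by additivity of degrees under composition.
    let h : D'.geom ⟶ Z i :=
      { deg := Geom.deg f - Geom.deg (g i)
        left := q ≫ pullback.snd _ _
        comp_toK := by
          rw [toK_eq (g i), Category.assoc, reassoc_of% hq', ← Category.assoc (Geom.left f),
            Geom.left_toK f, ← Category.assoc, ← Category.assoc, left_map_toK, Category.assoc,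
            ← frobSpec_add, sub_eq_add_neg]
        comp_toS := by
          rw [← Geom.left_toS (g i), Category.assoc, reassoc_of% hq', Geom.left_toS,
            Geom.left_toS] }
    refine ⟨D', m, hm, ⟨z', by rw [← hq, Scheme.Hom.comp_apply, hz', hy]⟩, ?_⟩
    refine ⟨Z i, h, g i, ⟨i⟩, Geom.hom_ext ?_ ?_⟩
    · change Geom.deg f - Geom.deg (g i) + Geom.deg (g i) = 0 + Geom.deg f
      ring
    · change (q ≫ pullback.snd _ _) ≫ Geom.left (g i) = _
      rw [Category.assoc, hq']
      rfl
  | top Y => exact ⟨D, .id D, by simp [Map.id]; infer_instance, ⟨z, by rw [map_id]; rfl⟩, trivial⟩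
  | pullback Y T _ Y' g ih =>
    obtain ⟨D', m, h₁, h₂, h₃⟩ := ih D (f ≫ g) z
    exact ⟨D', m, h₁, h₂, by simpa using h₃⟩
  | transitive Y R T _ _ ih₁ ih₂ =>
    obtain ⟨D', m, h₁, ⟨z', rfl⟩, h₃⟩ := ih₁ D f z
    obtain ⟨D'', m', h₁', ⟨z'', rfl⟩, h₃'⟩ := ih₂ h₃ D' (𝟙 _) z'
    refine ⟨D'', m'.comp m, ?_, ⟨z'', ?_⟩, ?_⟩
    · simp only [Map.comp, Functor.map_comp, Over.comp_left]
      infer_instance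
    · rw [map_comp, Geom.left_comp, Scheme.Hom.comp_apply]
    · simpa [map_comp] using h₃'

variable (s ι K) in
/-- A member of `E` as a level over `k`. -/
noncomputable abbrev bot (V : E) : Level s ι K where
  V := V
  L := ⊥
  fin := inferInstance
  a := ((ι.obj V).hom ≫ s) ≫
    Spec.map (CommRingCat.ofHom (IntermediateField.botEquiv k K).toRingEquiv.toRingHom)
  w := by
    rw [Category.assoc, specSub, ← Spec.map_comp]
    refine (congrArg (_ ≫ ·) ?_).trans (Category.comp_id _)
    rw [← Spec.map_id]
    congr 1
    ext x
    exact (IntermediateField.botEquiv k K).commutes x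

variable (s ι K) in
/-- The isomorphism from the geometric object of `bot V` to `V̄`, composed with a power of the
Frobenius. -/
noncomputable def botTr (V : E) (n : ℤ) : (bot s ι K V).geom ⟶ barObj s ι K V :=
  (bot s ι K V).tr n

instance (V : E) (n : ℤ) : IsOpenImmersion (Geom.left (botTr s ι K V n)) :=
  inferInstanceAs (IsOpenImmersion (Geom.left ((bot s ι K V).tr n)))

/-- Over `k` itself there is a single translate, so the piece is all of `V̄`. -/
lemma botTr_surjective (V : E) (n : ℤ) : Surjective (Geom.left (botTr s ι K V n)) := by
  have h0 : Surjective (Geom.left (botTr s ι K V 0)) := by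
    refine ⟨fun x ↦ ?_⟩
    obtain ⟨i, hi, y, h⟩ := (bot s ι K V).exists_tr_apply x
    have : i = 0 := by
      have : (bot s ι K V).N = 1 := IntermediateField.finrank_bot
      omega
    subst this
    exact ⟨y, h⟩
  have h : botTr s ι K V n = botTr s ι K V 0 ≫ twist s ι K (𝟙 V) n := by
    have := tr_twist (bot s ι K V) 0 n
    rw [zero_add] at this
    exact this.symm
  rw [h, Geom.left_comp]
  infer_instance

/-- The level given by a morphism to a level. -/
noncomputable abbrev restr (D : Level s ι K) {W : E} (f : W ⟶ D.V) : Level s ι K where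
  V := W
  L := D.L
  fin := D.fin
  a := (ι.map f).left ≫ D.a
  w := by rw [Category.assoc, D.w, Over.w_assoc]

lemma specLE_refl (L : IntermediateField k K) (h : L ≤ L) : specLE k h = 𝟙 _ := Spec.map_id _

/-- Coverings of `V̄` are refined, locally around a given point, by étale neighbourhoods which are
defined over a given finite extension. -/
lemma exists_level_mem {V : E} {T : Sieve (barObj s ι K V)}
    (hT : T ∈ weilTopology s ι K (barObj s ι K V)) (z : (barObj s ι K V).scheme) :
    ∃ (D : Level s ι K) (f : D.V ⟶ V), Etale (ι.map f).left ∧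
      (∃ z', Geom.left (D.tr 0 ≫ twist s ι K f 0) z' = z) ∧
        T (D.tr 0 ≫ twist s ι K f 0) := by
  obtain ⟨z₀, rfl⟩ := (botTr_surjective (s := s) (ι := ι) (K := K) V 0).surj z
  obtain ⟨D, m, h₁, ⟨z', rfl⟩, h₃⟩ := (bot s ι K V).exists_map_mem hT (botTr s ι K V 0) z₀
  have : map m ≫ botTr s ι K V 0 = D.tr 0 ≫ twist s ι K m.f 0 := map_tr m 0
  rw [this] at h₃
  exact ⟨D, m.f, h₁, ⟨z', by rw [← this]; rfl⟩, h₃⟩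

/-- The sieve of the members of `E` over `V` over which the given covering of `V̄` is split. -/
def splitSieve {V : E} (T : Sieve (barObj s ι K V)) (n : ℕ) : Sieve V where
  arrows W f := ∃ (D : Level s ι K) (g : W ⟶ D.V) (h : D.V ⟶ V), g ≫ h = f ∧ n ∣ D.N ∧
    ∀ i < D.N, T (D.tr i ≫ twist s ι K h 0)
  downward_closed := by
    rintro W W' _ ⟨D, g, h, rfl, hn, hT⟩ l
    exact ⟨D, l ≫ g, h, by simp, hn, hT⟩

/-- The level with twisted structure morphism. -/
noncomputable abbrev twisted (D : Level s ι K) (n : ℤ) : Level s ι K where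
  V := D.V
  L := D.L
  fin := D.fin
  a := D.a ≫ frobSub k D.L n
  w := by rw [Category.assoc, frobSub_specSub, D.w]

/-- The comparison of a level with its twist. -/
noncomputable def toTwisted (D : Level s ι K) (n : ℤ) : D.geom ⟶ (D.twisted n).geom :=
  (D.twisted n).lift n D.fst D.fst_hom (by
    change D.fst ≫ D.a ≫ frobSub k D.L n = _
    rw [D.isPullback.w_assoc])

/-- The comparison of a level with its twist. -/
noncomputable def ofTwisted (D : Level s ι K) (n : ℤ) : (D.twisted n).geom ⟶ D.geom :=
  D.lift (-n) (D.twisted n).fst (D.twisted n).fst_hom (by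
    have h := (D.twisted n).isPullback.w
    have h1 : (D.twisted n).a = D.a ≫ frobSub k D.L n := rfl
    have h2 : frobSub k D.L n ≫ frobSub k D.L (-n) = 𝟙 _ := by
      rw [← frobSub_add, add_neg_cancel]; exact D.frobSub_eq_id (dvd_zero _)
    calc _ = (D.twisted n).fst ≫ D.a ≫ frobSub k D.L n ≫ frobSub k D.L (-n) := by
          rw [h2, Category.comp_id]
      _ = _ := by
          rw [h1] at h
          exact (congrArg (· ≫ frobSub k D.L (-n)) h).trans (Category.assoc _ _ _) )

lemma toTwisted_tr (D : Level s ι K) (n m : ℤ) :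
    D.toTwisted n ≫ (D.twisted n).tr m = D.tr (n + m) :=
  barObj_hom_ext (by simp [toTwisted]) (by simp [toTwisted])

lemma ofTwisted_tr (D : Level s ι K) (n m : ℤ) :
    D.ofTwisted n ≫ D.tr m = (D.twisted n).tr (-n + m) :=
  barObj_hom_ext (by simp [ofTwisted]) (by simp [ofTwisted])

lemma mono_specSub_bot : Mono (specSub k (⊥ : IntermediateField k K)) := by
  have : specSub k (⊥ : IntermediateField k K) ≫
      Spec.map (CommRingCat.ofHom (IntermediateField.botEquiv k K).toRingEquiv.toRingHom) = 𝟙 _ := by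
    rw [specSub, ← Spec.map_comp, ← Spec.map_id]
    congr 1
    ext x
    obtain ⟨x, rfl⟩ := (IntermediateField.botEquiv k K).symm.surjective x
    exact congrArg (fun t ↦ ((IntermediateField.botEquiv k K).symm t : K))
      ((IntermediateField.botEquiv k K).apply_symm_apply x)
  exact mono_of_mono_fac this

/-- `V̄` is quasi-compact and étale morphisms are open, so finitely many neighbourhoods from
`exists_level_mem` suffice. One finite extension contains their fields of definition together with
an extension of degree `n`. -/
lemma exists_uniform_level_mem {V : E} {T : Sieve (barObj s ι K V)}
    (hT : T ∈ weilTopology s ι K (barObj s ι K V)) (n : ℕ) (hn : n ≠ 0) :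
    ∃ (L : IntermediateField k K) (hL : FiniteDimensional k L), n ∣ Module.finrank k L ∧
      ∀ x : (barObj s ι K V).scheme, ∃ (W : E) (f : W ⟶ V) (a : (ι.obj W).left ⟶ Spec (.of L))
        (w : a ≫ specSub k L = (ι.obj W).hom ≫ s), Etale (ι.map f).left ∧
        (∃ z', Geom.left ((Level.mk W L hL a w).tr 0 ≫ twist s ι K f 0) z' = x) ∧
        T ((Level.mk W L hL a w).tr 0 ≫ twist s ι K f 0) := by
  have : NeZero n := ⟨hn⟩
  obtain ⟨L₀, _, rfl⟩ := exists_finrank_eq k K n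
  have H := fun z ↦ exists_level_mem hT z
  choose D f hf hz hD using H
  choose z' hz using hz
  have hopen (z) : IsOpen (Set.range (Geom.left ((D z).tr 0 ≫ twist s ι K (f z) 0))) := by
    have h1 : Etale (Geom.left (twist s ι K (f z) 0)) :=
      MorphismProperty.of_isPullback (P := @Etale) (barObj_isPullback s ι K (f z)).flip (hf z)
    have : Etale (Geom.left ((D z).tr 0 ≫ twist s ι K (f z) 0)) := by
      rw [Geom.left_comp]; infer_instance
    exact (Scheme.Hom.isOpenMap _).isOpen_range
  have : CompactSpace (barObj s ι K V).scheme := by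
    have : QuasiCompact (barObj s ι K V).toK :=
      MorphismProperty.of_isPullback (P := @QuasiCompact) (barProj_isPullback s ι K V) inferInstance
    exact QuasiCompact.compactSpace_of_compactSpace (barObj s ι K V).toK
  obtain ⟨t, ht⟩ := isCompact_univ.elim_finite_subcover _ hopen
    (fun z _ ↦ Set.mem_iUnion.2 ⟨z, z' z, hz z⟩)
  classical
  obtain ⟨L, hL⟩ := Finset.exists_le (α := FinSub k K)
    (insert ⟨L₀, ‹_›⟩ (t.image fun z ↦ ⟨(D z).L, (D z).fin⟩))
  have hL₀ : L₀ ≤ L.1 := hL _ (Finset.mem_insert_self _ _)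
  refine ⟨L.1, L.2, dvd_of_le hL₀, fun x ↦ ?_⟩
  obtain ⟨z, hzt, w, hw⟩ : ∃ z ∈ t, ∃ w,
      Geom.left ((D z).tr 0 ≫ twist s ι K (f z) 0) w = x := by
    simpa using ht (Set.mem_univ x)
  have hzL : (D z).L ≤ L.1 :=
    hL ⟨(D z).L, (D z).fin⟩ (Finset.mem_insert_of_mem (Finset.mem_image_of_mem _ hzt))
  obtain ⟨D', m, hD', h₁, h₂, h₃, -⟩ := (D z).exists_map_baseChange L.1 hzL
  obtain ⟨w', rfl⟩ : ∃ w', Geom.left (map m) w' = w :=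
    (Geom.left (map m)).surjective w
  have hm : D'.tr 0 ≫ twist s ι K (m.f ≫ f z) 0 =
      map m ≫ (D z).tr 0 ≫ twist s ι K (f z) 0 := by
    rw [twist_comp_zero, ← Category.assoc, ← map_tr, Category.assoc]
  obtain ⟨W, L', fin, a, ha⟩ := D'
  obtain rfl : L' = _ := hD'
  have := hf z
  refine ⟨W, m.f ≫ f z, a, ha, ?_, ⟨w', ?_⟩, ?_⟩
  · rw [Functor.map_comp, Over.comp_left]
    infer_instance
  · rw [hm, ← hw, Geom.left_comp, Scheme.Hom.comp_apply]
  · rw [hm]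
    exact T.downward_closed (hD z) _

/-- Every covering of `V̄` is split over a covering of `V`. -/
theorem splitSieve_mem {V : E} {T : Sieve (barObj s ι K V)}
    (hT : T ∈ weilTopology s ι K (barObj s ι K V)) (n : ℕ) (hn : n ≠ 0) :
    splitSieve T n ∈ etaleTopology ι V := by
  have := hE.full
  have := hE.faithful
  obtain ⟨L, _, hnL, H⟩ := exists_uniform_level_mem hT n hn
  -- `VL` is `V ×_k L`, an étale covering of `V` with a structure map to `Spec L`; the corresponding
  -- piece is still all of `V̄`.
  obtain ⟨D, m, hD, h₁, h₂, h₃, hpb⟩ := (bot s ι K V).exists_map_baseChange L bot_le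
  obtain ⟨VL, L', _, a, ha⟩ := D
  obtain rfl : L' = _ := hD
  let D : Level s ι K := ⟨VL, L', ‹_›, a, ha⟩
  let q : VL ⟶ V := m.f
  have hq : Etale (ι.map q).left := h₁
  refine (etaleTopology ι).transitive (S := Sieve.generate (Presieve.singleton q))
    (mem_etaleTopology fun v ↦ ?_) _ ?_
  · obtain ⟨w, hw⟩ := h₂.surj v
    exact ⟨VL, q, ⟨_, 𝟙 _, q, Presieve.singleton_self q, Category.id_comp _⟩, hq, w, hw⟩
  rintro Y _ ⟨_, g, _, ⟨_⟩, rfl⟩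
  rw [Sieve.pullback_comp]
  refine (etaleTopology ι).pullback_stable _ ?_
  -- The morphisms to `VL` whose `i`-th translate lies in `T`, for the structure map to `Spec L`
  -- inherited from `VL`.
  let T' (i : ℕ) : Sieve VL :=
    { arrows W h := T ((D.restr h).tr i ≫ twist s ι K (h ≫ q) 0)
      downward_closed := by
        intro W W' h hh g
        let m' : Map (D.restr (g ≫ h)) (D.restr h) :=
          ⟨g, le_rfl, by simp [specLE_refl]⟩
        have e : (D.restr (g ≫ h)).tr i ≫ twist s ι K ((g ≫ h) ≫ q) 0 =
            map m' ≫ (D.restr h).tr i ≫ twist s ι K (h ≫ q) 0 := by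
          rw [Category.assoc, twist_comp_zero, ← Category.assoc, ← Category.assoc]
          exact congrArg (· ≫ twist s ι K (h ≫ q) 0) (map_tr m' i).symm
        rw [e]
        exact T.downward_closed hh _ }
  have hT' (i : ℕ) : T' i ∈ etaleTopology ι VL := by
    refine mem_etaleTopology fun v ↦ ?_
    obtain ⟨z, rfl⟩ := D.fst.surjective v
    -- The neighbourhood is taken at the `i`-th translate of `z`. Twisting its map to `Spec L` by
    -- the `-i`-th power of the Frobenius turns its `0`-th translate, which lies in `T`, into the
    -- `i`-th one, and determines a morphism to `VL`.
    obtain ⟨W, f, b, hb, hf, ⟨z', hz'⟩, hTf⟩ := H (Geom.left (map m ≫ botTr s ι K V i) z)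
    have hl : (ι.map f).left ≫ (bot s ι K V).a = (b ≫ frobSub k L' (-i)) ≫ specLE k m.le := by
      have := mono_specSub_bot (k := k) (K := K)
      rw [← cancel_mono (specSub k (⊥ : IntermediateField k K)), Category.assoc, (bot s ι K V).w,
        Category.assoc, specLE_specSub, Category.assoc, frobSub_specSub, hb, Over.w_assoc]
    have hS : hpb.lift _ _ hl ≫ (ι.obj VL).hom = (ι.obj W).hom := by
      rw [← Over.w (ι.map q), hpb.lift_fst_assoc, Over.w]
    let h : W ⟶ VL := ι.preimage (Over.homMk (hpb.lift _ _ hl) hS)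
    have hh : (ι.map h).left = hpb.lift _ _ hl := by rw [ι.map_preimage]; rfl
    have hhq : h ≫ q = f := by
      apply ι.map_injective
      apply (Over.forget S).map_injective
      rw [Functor.map_comp, Functor.map_comp, Over.forget_map, Over.forget_map, hh]
      exact hpb.lift_fst _ _ _
    have hha : (ι.map h).left ≫ a = b ≫ frobSub k L' (-i) := by
      rw [hh]; exact hpb.lift_snd _ _ _
    let B : Level s ι K := ⟨W, L', ‹_›, b, hb⟩
    let m' : Map (B.twisted (-i)) D := ⟨h, le_rfl, by rw [specLE_refl, Category.comp_id, hha]⟩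
    have key : ∀ (a' : (ι.obj W).left ⟶ Spec (.of L')) (w' : a' ≫ specSub k L' = (ι.obj W).hom ≫ s),
        a' = b ≫ frobSub k L' (-i) →
        T ((Level.mk W L' ‹_› a' w').tr i ≫ twist s ι K f 0) := by
      rintro _ w' rfl
      have := ofTwisted_tr B (-i) 0
      rw [neg_neg, add_zero] at this
      have h := T.downward_closed hTf (B.ofTwisted (-i))
      rw [← Category.assoc] at h
      rw [← this]
      exact h
    refine ⟨W, h, ?_, ?_, (B.twisted (-i)).fst (Geom.left (B.toTwisted (-i)) z'), ?_⟩
    · change T ((D.restr h).tr i ≫ twist s ι K (h ≫ q) 0)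
      rw [hhq]
      exact key _ _ hha
    · have : Etale ((ι.map h).left ≫ (ι.map q).left) := by
        rw [← Over.comp_left, ← Functor.map_comp, hhq]; exact hf
      exact Etale.of_comp _ (ι.map q).left
    · have e : B.toTwisted (-i) ≫ map m' ≫ map m ≫ botTr s ι K V i =
          B.tr 0 ≫ twist s ι K f 0 := by
        have e₁ : map m ≫ botTr s ι K V i = D.tr i ≫ twist s ι K q 0 := map_tr m i
        have e₂ : map m' ≫ D.tr i = (B.twisted (-i)).tr i ≫ twist s ι K h 0 :=
          map_tr m' i
        have e₃ := B.toTwisted_tr (-i) i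
        rw [neg_add_cancel] at e₃
        rw [e₁, ← Category.assoc (map m'), e₂, Category.assoc, ← twist_comp_zero, hhq,
          ← Category.assoc, e₃]
      have e' : Geom.left (map m') (Geom.left (B.toTwisted (-i)) z') = z := by
        have : IsOpenImmersion (Geom.left (map m ≫ botTr s ι K V i)) := by
          rw [Geom.left_comp]; infer_instance
        apply (Geom.left (map m ≫ botTr s ι K V i)).isOpenEmbedding.injective
        rw [← hz', ← e]
        rfl
      have e'' : (B.twisted (-i)).fst ≫ (ι.map h).left = Geom.left (map m') ≫ D.fst :=
        (left_map_fst m').symm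
      rw [← e', ← Scheme.Hom.comp_apply, e'', Scheme.Hom.comp_apply]
  -- Only finitely many translates have to lie in `T`, so a finite intersection of covering sieves
  -- is enough.
  have hN (N : ℕ) : ∃ R ∈ etaleTopology ι VL, ∀ ⦃W⦄ (h : W ⟶ VL), R h → ∀ i < N, T' i h := by
    induction N with
    | zero => exact ⟨⊤, GrothendieckTopology.top_mem _ _, by simp⟩
    | succ N ih =>
      obtain ⟨R, hR, hR'⟩ := ih
      refine ⟨R ⊓ T' N, GrothendieckTopology.intersection_covering _ hR (hT' N), ?_⟩
      intro W h hh i hi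
      obtain hi | rfl := Nat.lt_succ_iff_lt_or_eq.1 hi
      · exact hR' h hh.1 i hi
      · exact hh.2
  obtain ⟨R, hR, hR'⟩ := hN D.N
  refine GrothendieckTopology.superset_covering _ ?_ hR
  exact fun W h hh ↦ ⟨D.restr h, 𝟙 _, h ≫ q, Category.id_comp _, hnL, hR' h hh⟩

end Level
end Refine
end WeilEtale

namespace WeilEtale

/-! ### Local sections of abelian sheaves -/

section Sections

variable {C : Type u} [SmallCategory C]

/-- The sections of a presheaf. -/
abbrev Sec (F : Cᵒᵖ ⥤ AddCommGrpCat.{u}) (U : C) : Type u := F.obj (.op U)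

/-- The restriction of sections. -/
def res (F : Cᵒᵖ ⥤ AddCommGrpCat.{u}) {U V : C} (f : U ⟶ V) : Sec F V →+ Sec F U :=
  (F.map f.op).hom

/-- The map on sections given by a morphism of presheaves. -/
def ev {F G : Cᵒᵖ ⥤ AddCommGrpCat.{u}} (α : F ⟶ G) (U : C) : Sec F U →+ Sec G U :=
  (α.app (.op U)).hom

variable {F G H : Cᵒᵖ ⥤ AddCommGrpCat.{u}}

@[simp] lemma res_id {U : C} (x : Sec F U) : res F (𝟙 U) x = x := by
  simp [res]

lemma res_comp {U V W : C} (f : U ⟶ V) (g : V ⟶ W) (x : Sec F W) :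
    res F (f ≫ g) x = res F f (res F g x) := by
  simp [res]

lemma ev_res (α : F ⟶ G) {U V : C} (f : U ⟶ V) (x : Sec F V) :
    ev α U (res F f x) = res G f (ev α V x) :=
  NatTrans.naturality_apply α f.op x

@[simp] lemma ev_comp (α : F ⟶ G) (β : G ⟶ H) (U : C) (x : Sec F U) :
    ev (α ≫ β) U x = ev β U (ev α U x) := rfl

lemma ev_ext {α β : F ⟶ G} (h : ∀ U x, ev α U x = ev β U x) : α = β := by
  ext U x
  exact h U.unop x

/-- A morphism of presheaves from a compatible family of maps on sections. -/
def homOfSec (a : ∀ U, Sec F U →+ Sec G U)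
    (h : ∀ {U V : C} (f : U ⟶ V) (x : Sec F V), a U (res F f x) = res G f (a V x)) : F ⟶ G where
  app U := AddCommGrpCat.ofHom (a U.unop)
  naturality U V f := by
    ext x
    exact h f.unop x

variable {J : GrothendieckTopology C}

lemma sec_ext (hF : Presheaf.IsSheaf J F) {U : C} {T : Sieve U} (hT : T ∈ J U) {x y : Sec F U}
    (h : ∀ ⦃W⦄ (f : W ⟶ U), T f → res F f x = res F f y) : x = y := by
  rw [Presheaf.isSheaf_iff_isSheaf_forget (s := CategoryTheory.forget AddCommGrpCat.{u}),
    isSheaf_iff_isSheaf_of_type] at hF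
  exact (hF T hT).isSeparatedFor.ext h

lemma exists_glue (hF : Presheaf.IsSheaf J F) {U : C} {I : Type*} {W : I → C} (f : ∀ i, W i ⟶ U)
    (hf : Sieve.ofArrows W f ∈ J U) (x : ∀ i, Sec F (W i))
    (hx : ∀ i j (Z : C) (a : Z ⟶ W i) (b : Z ⟶ W j), a ≫ f i = b ≫ f j →
      res F a (x i) = res F b (x j)) :
    ∃ y : Sec F U, ∀ i, res F (f i) y = x i := by
  rw [Presheaf.isSheaf_iff_isSheaf_forget (s := CategoryTheory.forget AddCommGrpCat.{u}),
    isSheaf_iff_isSheaf_of_type] at hF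
  have := (Presieve.isSheafFor_iff_generate (Presieve.ofArrows W f)).2 (hF _ hf)
  rw [Presieve.isSheafFor_arrows_iff] at this
  obtain ⟨y, hy, -⟩ := this x hx
  exact ⟨y, hy⟩

lemma sec_ext_ofArrows (hF : Presheaf.IsSheaf J F) {U : C} {I : Type*} {W : I → C}
    (f : ∀ i, W i ⟶ U) (hf : Sieve.ofArrows W f ∈ J U) {x y : Sec F U}
    (hx : ∀ i, res F (f i) x = res F (f i) y) : x = y := by
  refine sec_ext hF hf ?_
  rintro Z g ⟨_, a, _, ⟨i⟩, rfl⟩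
  rw [res_comp, res_comp, hx]

lemma bijective_of_isIso {F G : Sheaf J AddCommGrpCat.{u}} (α : F ⟶ G) [IsIso α] (U : C) :
    Function.Bijective (ev α.hom U) := by
  have : IsIso (α.hom.app (.op U)) :=
    inferInstanceAs (IsIso (((sheafToPresheaf J _).map α).app (.op U)))
  exact ConcreteCategory.bijective_of_isIso (α.hom.app (.op U))

lemma exists_of_isLocallySurjective (α : F ⟶ G) [Presheaf.IsLocallySurjective J α] {U : C}
    (y : Sec G U) : ∃ T ∈ J U, ∀ ⦃W⦄ (f : W ⟶ U), T f → ∃ x, ev α W x = res G f y :=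
  ⟨_, Presheaf.imageSieve_mem J α (U := .op U) y, fun _ _ h ↦ h⟩

lemma isLocallySurjective_of_exists (α : F ⟶ G) (h : ∀ (U : C) (y : Sec G U),
    ∃ T ∈ J U, ∀ ⦃W⦄ (f : W ⟶ U), T f → ∃ x, ev α W x = res G f y) :
    Presheaf.IsLocallySurjective J α where
  imageSieve_mem {U} y := by
    obtain ⟨T, hT, h⟩ := h U y
    exact J.superset_covering (fun W f hf ↦ h f hf) hT

lemma isLocallyInjective_of_forall (α : F ⟶ G) (h : ∀ (U : C) (x : Sec F U), ev α U x = 0 →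
    ∃ T ∈ J U, ∀ ⦃W⦄ (f : W ⟶ U), T f → res F f x = 0) :
    Presheaf.IsLocallyInjective J α where
  equalizerSieve_mem {U} x y hxy := by
    obtain ⟨T, hT, h⟩ := h U.unop (x - y) (by rw [map_sub, sub_eq_zero]; exact hxy)
    refine J.superset_covering (fun W f hf ↦ ?_) hT
    have := h f hf
    rw [map_sub, sub_eq_zero] at this
    exact this

lemma exists_of_isLocallyInjective (α : F ⟶ G) [Presheaf.IsLocallyInjective J α] {U : C}
    (x : Sec F U) (hx : ev α U x = 0) : ∃ T ∈ J U, ∀ ⦃W⦄ (f : W ⟶ U), T f → res F f x = 0 := by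
  refine ⟨_, Presheaf.equalizerSieve_mem J α (X := .op U) x 0 (hx.trans (map_zero _).symm),
    fun W f h ↦ ?_⟩
  exact (h : res F f x = res F f 0).trans (map_zero _)

lemma exists_of_epi {F G : Sheaf J AddCommGrpCat.{u}} (α : F ⟶ G) [Epi α] {U : C}
    (y : Sec G.obj U) : ∃ T ∈ J U, ∀ ⦃W⦄ (f : W ⟶ U), T f → ∃ x, ev α.hom W x = res G.obj f y := by
  have := (Sheaf.isLocallySurjective_iff_epi' AddCommGrpCat.{u} α).2 inferInstance
  exact exists_of_isLocallySurjective α.hom y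

lemma epi_of_exists {F G : Sheaf J AddCommGrpCat.{u}} (α : F ⟶ G) (h : ∀ (U : C) (y : Sec G.obj U),
    ∃ T ∈ J U, ∀ ⦃W⦄ (f : W ⟶ U), T f → ∃ x, ev α.hom W x = res G.obj f y) : Epi α :=
  (Sheaf.isLocallySurjective_iff_epi' AddCommGrpCat.{u} α).1 (isLocallySurjective_of_exists α.hom h)

lemma ev_injective_of_mono {F G : Sheaf J AddCommGrpCat.{u}} (α : F ⟶ G) [Mono α] (U : C) :
    Function.Injective (ev α.hom U) := by
  have : Mono (α.hom.app (.op U)) :=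
    inferInstanceAs (Mono (((sheafToPresheaf J _).map α).app (.op U)))
  exact (AddCommGrpCat.mono_iff_injective _).1 this

lemma mono_of_ev_injective {F G : Sheaf J AddCommGrpCat.{u}} (α : F ⟶ G)
    (h : ∀ (U : C) (x : Sec F.obj U), ev α.hom U x = 0 → x = 0) : Mono α :=
  Preadditive.mono_of_cancel_zero _ fun {Z} b hb ↦ by
    ext : 1
    exact ev_ext fun U x ↦ h _ _ (congrArg (fun c ↦ ev c.hom U x) hb)

lemma isIso_of_locally {F G : Sheaf J AddCommGrpCat.{u}} (α : F ⟶ G)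
    (h : ∀ (U : C) (x : Sec F.obj U), ev α.hom U x = 0 → x = 0)
    (h' : ∀ (U : C) (y : Sec G.obj U),
      ∃ T ∈ J U, ∀ ⦃W⦄ (f : W ⟶ U), T f → ∃ x, ev α.hom W x = res G.obj f y) : IsIso α := by
  have := mono_of_ev_injective α h
  have := epi_of_exists α h'
  exact isIso_of_mono_of_epi α

/-- The map to the cycles is an epimorphism, hence locally surjective, while taking sections
commutes with the kernel defining the cycles. -/
lemma exists_of_exact {S : ShortComplex (Sheaf J AddCommGrpCat.{u})} (hS : S.Exact) {U : C}
    (x : Sec S.X₂.obj U) (hx : ev S.g.hom U x = 0) :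
    ∃ T ∈ J U, ∀ ⦃W⦄ (f : W ⟶ U), T f → ∃ z, ev S.f.hom W z = res S.X₂.obj f x := by
  have : Epi S.toCycles := hS.epi_toCycles
  let Γ := sheafToPresheaf J AddCommGrpCat.{u} ⋙ (evaluation _ _).obj (.op U)
  have : PreservesLimit (parallelPair S.g 0) Γ := inferInstance
  have hΓ := ((ShortComplex.mk _ _ S.iCycles_g).exact_of_f_is_kernel S.cyclesIsKernel)
  have hΓ' := (ShortComplex.ab_exact_iff _).1 (hΓ.map_of_mono_of_preservesKernel Γ
    inferInstance inferInstance)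
  obtain ⟨y, hy⟩ : ∃ y : Sec S.cycles.obj U, ev S.iCycles.hom U y = x := hΓ' x hx
  obtain ⟨T, hT, h⟩ := exists_of_epi S.toCycles (U := U) y
  refine ⟨T, hT, fun W f hf ↦ ?_⟩
  obtain ⟨z, hz⟩ := h f hf
  refine ⟨z, ?_⟩
  rw [← hy, ← ev_res, ← hz, ← ev_comp]
  change _ = ev (S.toCycles ≫ S.iCycles).hom W z
  rw [S.toCycles_i]

end Sections

end WeilEtale

namespace WeilEtale

/-! ### Tensoring with `ℚ` -/

section TensorQGroup

open scoped TensorProduct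

/-- Reduction to a common denominator. -/
lemma exists_eq_tmul {A : Type*} [AddCommGroup A] (x : A ⊗[ℤ] ℚ) :
    ∃ (a : A) (n : ℕ), 0 < n ∧ x = a ⊗ₜ (1 / n : ℚ) := by
  have smul_tmul' (m : ℤ) (a : A) (q : ℚ) : (m • a) ⊗ₜ[ℤ] q = a ⊗ₜ ((m : ℚ) * q) := by
    rw [TensorProduct.smul_tmul, zsmul_eq_mul]
  induction x with
  | zero => exact ⟨0, 1, one_pos, by simp⟩
  | tmul a q =>
    refine ⟨q.num • a, q.den, q.den_pos, ?_⟩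
    rw [smul_tmul', mul_one_div, Rat.num_div_den]
  | add x y hx hy =>
    obtain ⟨a, n, hn, rfl⟩ := hx
    obtain ⟨b, m, hm, rfl⟩ := hy
    refine ⟨(m : ℤ) • a + (n : ℤ) • b, n * m, Nat.mul_pos hn hm, ?_⟩
    rw [TensorProduct.add_tmul, smul_tmul', smul_tmul']
    congr 2 <;> · push_cast; field_simp

/-- `A ⊗ ℚ` is the localization of `A` at the nonzero integers, so the kernel of `A ⟶ A ⊗ ℚ` is
torsion. -/
lemma exists_nsmul_eq_zero_of_tmul {A : Type*} [AddCommGroup A] {a : A} {q : ℚ} (hq : q ≠ 0)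
    (h : a ⊗ₜ[ℤ] q = 0) : ∃ n : ℕ, 0 < n ∧ n • a = 0 := by
  have hloc : IsLocalizedModule (nonZeroDivisors ℤ) (TensorProduct.mk ℤ ℚ A 1) :=
    (isLocalizedModule_iff_isBaseChange _ ℚ _).2 (TensorProduct.isBaseChange ℤ A ℚ)
  have h1 : TensorProduct.mk ℤ ℚ A 1 a = 0 := by
    have := congrArg (fun z ↦ q⁻¹ • TensorProduct.comm ℤ A ℚ z) h
    simpa [TensorProduct.smul_tmul', hq] using this
  obtain ⟨c, hc⟩ := (IsLocalizedModule.eq_zero_iff (nonZeroDivisors ℤ) _).1 h1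
  refine ⟨c.1.natAbs, Int.natAbs_pos.2 (nonZeroDivisors.ne_zero c.2), ?_⟩
  have hc' : c.1 • a = 0 := hc
  rcases Int.natAbs_eq c.1 with h | h
  · rw [h] at hc'
    simpa using hc'
  · rw [h] at hc'
    simpa using hc'

/-- The map `A ⟶ A ⊗ ℚ`. -/
noncomputable def tmulOne (A : Type*) [AddCommGroup A] : A →+ A ⊗[ℤ] ℚ :=
  ((TensorProduct.mk ℤ A ℚ).flip 1).toAddMonoidHom

/-- The natural map `A ⟶ A ⊗ ℚ`. -/
noncomputable def toTensorQGroup : 𝟭 AddCommGrpCat.{u} ⟶ tensorQGroup.{u} where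
  app A := AddCommGrpCat.ofHom (tmulOne A)
  naturality A B f := by
    ext a
    rfl

end TensorQGroup

section TensorQ

variable {C : Type u} [SmallCategory C] {J : GrothendieckTopology C}

open scoped TensorProduct

/-- Kernel and cokernel which are locally torsion disappear after tensoring with `ℚ`, so the map
becomes locally bijective. Presheaves are allowed in order to cover the sheafification map of a
constant presheaf. -/
lemma isIso_presheafToSheaf_tensorQ {F G : Cᵒᵖ ⥤ AddCommGrpCat.{u}} (ψ : F ⟶ G)
    (h : ∀ (U : C) (x : Sec F U), ev ψ U x = 0 →
      ∃ T ∈ J U, ∀ ⦃W⦄ (f : W ⟶ U), T f → ∃ n : ℕ, 0 < n ∧ n • res F f x = 0)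
    (h' : ∀ (U : C) (y : Sec G U),
      ∃ T ∈ J U, ∀ ⦃W⦄ (f : W ⟶ U), T f → ∃ n : ℕ, 0 < n ∧ ∃ x, ev ψ W x = n • res G f y) :
    IsIso ((presheafToSheaf J _).map (Functor.whiskerRight ψ tensorQGroup)) := by
  have hF {U V : C} (f : U ⟶ V) (x : Sec F V) (q : ℚ) :
    res (F ⋙ tensorQGroup) f (x ⊗ₜ[ℤ] q : Sec F V ⊗[ℤ] ℚ) =
      (res F f x ⊗ₜ[ℤ] q : Sec F U ⊗[ℤ] ℚ) := rfl
  have hG {U V : C} (f : U ⟶ V) (x : Sec G V) (q : ℚ) :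
    res (G ⋙ tensorQGroup) f (x ⊗ₜ[ℤ] q : Sec G V ⊗[ℤ] ℚ) =
      (res G f x ⊗ₜ[ℤ] q : Sec G U ⊗[ℤ] ℚ) := rfl
  have hψ {U : C} (x : Sec F U) (q : ℚ) :
    ev (Functor.whiskerRight ψ tensorQGroup) U (x ⊗ₜ[ℤ] q : Sec F U ⊗[ℤ] ℚ) =
      (ev ψ U x ⊗ₜ[ℤ] q : Sec G U ⊗[ℤ] ℚ) := rfl
  have h₁ : Presheaf.IsLocallyInjective J (Functor.whiskerRight ψ tensorQGroup) := by
    refine isLocallyInjective_of_forall _ fun U x hx ↦ ?_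
    obtain ⟨a, n, hn, rfl⟩ := exists_eq_tmul (A := Sec F U) x
    rw [hψ] at hx
    obtain ⟨m, hm, hm'⟩ := exists_nsmul_eq_zero_of_tmul (by positivity) hx
    rw [← map_nsmul] at hm'
    obtain ⟨T, hT, hT'⟩ := h U _ hm'
    refine ⟨T, hT, fun W f hf ↦ ?_⟩
    obtain ⟨l, hl, hl'⟩ := hT' f hf
    rw [map_nsmul, smul_smul] at hl'
    rw [hF]
    have e : (1 / n : ℚ) = (l * m : ℕ) • (1 / (l * m * n) : ℚ) := by
      rw [nsmul_eq_mul]; push_cast; field_simp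
    rw [e, ← TensorProduct.smul_tmul, hl', TensorProduct.zero_tmul]
    rfl
  have h₂ : Presheaf.IsLocallySurjective J (Functor.whiskerRight ψ tensorQGroup) := by
    refine isLocallySurjective_of_exists _ fun U y ↦ ?_
    obtain ⟨a, n, hn, rfl⟩ := exists_eq_tmul (A := Sec G U) y
    obtain ⟨T, hT, hT'⟩ := h' U a
    refine ⟨T, hT, fun W f hf ↦ ?_⟩
    obtain ⟨l, hl, x, hx⟩ := hT' f hf
    refine ⟨(x ⊗ₜ[ℤ] (1 / (l * n) : ℚ) : Sec F W ⊗[ℤ] ℚ), ?_⟩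
    rw [hψ, hG, hx, TensorProduct.smul_tmul]
    congr 1
    rw [nsmul_eq_mul]; field_simp
  exact (J.W_iff _).1 (J.W_of_isLocallyBijective _)

lemma isIso_tensorQ_map {F G : Sheaf J AddCommGrpCat.{u}} (ψ : F ⟶ G)
    (h : ∀ (U : C) (x : Sec F.obj U), ev ψ.hom U x = 0 →
      ∃ T ∈ J U, ∀ ⦃W⦄ (f : W ⟶ U), T f → ∃ n : ℕ, 0 < n ∧ n • res F.obj f x = 0)
    (h' : ∀ (U : C) (y : Sec G.obj U), ∃ T ∈ J U, ∀ ⦃W⦄ (f : W ⟶ U), T f →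
      ∃ n : ℕ, 0 < n ∧ ∃ x, ev ψ.hom W x = n • res G.obj f y) :
    IsIso ((tensorQ J).map ψ) :=
  isIso_presheafToSheaf_tensorQ ψ.hom h h'

variable (J) in
/-- The natural map `G ⟶ G ⊗ ℚ`. -/
noncomputable def toTensorQ : 𝟭 _ ⟶ tensorQ J where
  app G := ⟨Functor.whiskerLeft G.obj toTensorQGroup ≫ toSheafify J (G.obj ⋙ tensorQGroup)⟩
  naturality G H f := by
    ext : 1
    change f.hom ≫ Functor.whiskerLeft H.obj toTensorQGroup ≫ toSheafify J (H.obj ⋙ tensorQGroup) =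
      (Functor.whiskerLeft G.obj toTensorQGroup ≫ toSheafify J (G.obj ⋙ tensorQGroup)) ≫
        ((presheafToSheaf J _).map (Functor.whiskerRight f.hom tensorQGroup)).hom
    have := toSheafify_naturality J (Functor.whiskerRight f.hom tensorQGroup)
    rw [Category.assoc]
    refine Eq.trans ?_ (congrArg (Functor.whiskerLeft G.obj toTensorQGroup ≫ ·) this)
    rw [← Category.assoc, ← Category.assoc]
    congr 1

/-- Uniquely divisible sheaves. -/
def UniquelyDivisible (G : Sheaf J AddCommGrpCat.{u}) : Prop :=
  ∀ (U : C) (n : ℕ), 0 < n → Function.Bijective fun x : Sec G.obj U ↦ n • x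

/-- By unique division `a ↦ a ⊗ 1` is bijective on sections before any sheafification. -/
lemma UniquelyDivisible.isIso {G : Sheaf J AddCommGrpCat.{u}} (hG : UniquelyDivisible G) :
    IsIso ((toTensorQ J).app G) := by
  have e {U : C} (x : Sec G.obj U) :
    ev (Functor.whiskerLeft G.obj toTensorQGroup) U x = (x ⊗ₜ[ℤ] 1 : Sec G.obj U ⊗[ℤ] ℚ) := rfl
  have h₁ : Presheaf.IsLocallyInjective J (Functor.whiskerLeft G.obj toTensorQGroup) := by
    refine isLocallyInjective_of_forall _ fun U x hx ↦ ⟨⊤, J.top_mem _, fun W f _ ↦ ?_⟩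
    rw [e] at hx
    obtain ⟨n, hn, hn'⟩ := exists_nsmul_eq_zero_of_tmul one_ne_zero hx
    rw [(hG U n hn).1 (hn'.trans (smul_zero _).symm), map_zero]
  have h₂ : Presheaf.IsLocallySurjective J (Functor.whiskerLeft G.obj toTensorQGroup) := by
    refine isLocallySurjective_of_exists _ fun U y ↦ ⟨⊤, J.top_mem _, fun W f _ ↦ ?_⟩
    obtain ⟨a, n, hn, hy⟩ := exists_eq_tmul (A := Sec G.obj W) (res (G.obj ⋙ tensorQGroup) f y)
    obtain ⟨b, rfl⟩ := (hG W n hn).2 a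
    refine ⟨b, ?_⟩
    rw [e, hy]
    dsimp only
    rw [TensorProduct.smul_tmul, nsmul_eq_mul]
    congr 1
    field_simp
  refine (Sheaf.isLocallyBijective_iff_isIso _).1 ⟨?_, ?_⟩
  · exact inferInstanceAs (Presheaf.IsLocallyInjective J
      (Functor.whiskerLeft G.obj toTensorQGroup ≫ toSheafify J (G.obj ⋙ tensorQGroup)))
  · exact inferInstanceAs (Presheaf.IsLocallySurjective J
      (Functor.whiskerLeft G.obj toTensorQGroup ≫ toSheafify J (G.obj ⋙ tensorQGroup)))

lemma IsRationalSheaf.uniquelyDivisible {G : Sheaf J AddCommGrpCat.{u}} (hG : IsRationalSheaf J G) :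
    UniquelyDivisible G := by
  intro U n hn
  obtain ⟨_⟩ := hG (.op U)
  have hn' : (n : ℚ) ≠ 0 := by positivity
  have e (x : Sec G.obj U) : n • x = (n : ℚ) • x := (Nat.cast_smul_eq_nsmul ℚ n x).symm
  simp only [e]
  exact ⟨fun x y h ↦ by simpa [hn'] using congrArg ((n : ℚ)⁻¹ • ·) h,
    fun y ↦ ⟨(n : ℚ)⁻¹ • y, by simp [smul_smul, hn']⟩⟩

lemma IsTorsionSheaf.isZero {G : Sheaf J AddCommGrpCat.{u}} (hG : IsTorsionSheaf J G) :
    IsZero ((tensorQ J).obj G) := by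
  have : IsZero (G.obj ⋙ tensorQGroup) := by
    refine Functor.isZero _ fun U ↦ ?_
    have : Subsingleton (G.obj.obj U ⊗[ℤ] ℚ) := by
      refine subsingleton_of_forall_eq 0 fun x ↦ ?_
      obtain ⟨a, n, hn, rfl⟩ := exists_eq_tmul x
      obtain ⟨m, hm, hm'⟩ := isOfFinAddOrder_iff_nsmul_eq_zero.1 (hG U a)
      have e : (1 / n : ℚ) = (m : ℕ) • (1 / (m * n) : ℚ) := by
        rw [nsmul_eq_mul]; field_simp
      rw [e, ← TensorProduct.smul_tmul, hm', TensorProduct.zero_tmul]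
    exact AddCommGrpCat.isZero_of_subsingleton (.of (G.obj.obj U ⊗[ℤ] ℚ))
  exact (presheafToSheaf J AddCommGrpCat.{u}).map_isZero this

end TensorQ

end WeilEtale

namespace WeilEtale

section TensorQExact

open scoped TensorProduct

/-- Flatness of `ℚ` on elements: if `a ⊗ 1/n` maps to zero, some positive multiple of `a` is a
cycle, hence a boundary, and dividing again gives the preimage. -/
instance : tensorQGroup.{u}.PreservesHomology := by
  refine Functor.preservesHomology_of_map_exact _ fun S hS ↦ ?_
  rw [ShortComplex.ab_exact_iff] at hS ⊢
  intro x hx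
  obtain ⟨a, n, hn, rfl⟩ := exists_eq_tmul (A := S.X₂) x
  have hx' : (S.g a ⊗ₜ[ℤ] (1 / n : ℚ) : S.X₃ ⊗[ℤ] ℚ) = 0 := hx
  obtain ⟨m, hm, hm'⟩ := exists_nsmul_eq_zero_of_tmul (by positivity) hx'
  obtain ⟨b, hb⟩ := hS (m • a) (by rw [map_nsmul]; exact hm')
  refine ⟨(b ⊗ₜ[ℤ] (1 / (m * n) : ℚ) : S.X₁ ⊗[ℤ] ℚ), ?_⟩
  change (S.f b ⊗ₜ[ℤ] (1 / (m * n) : ℚ) : S.X₂ ⊗[ℤ] ℚ) = _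
  rw [hb, TensorProduct.smul_tmul, nsmul_eq_mul]
  congr 1
  field_simp

instance : PreservesFiniteLimits tensorQGroup.{u} :=
  Functor.preservesFiniteLimits_of_preservesHomology _

variable {C : Type u} [SmallCategory C] (J : GrothendieckTopology C)

instance : PreservesFiniteLimits (tensorQ J) := by
  have : PreservesFiniteLimits ((Functor.whiskeringRight Cᵒᵖ _ _).obj tensorQGroup.{u}) :=
    ⟨fun _ _ _ ↦ inferInstance⟩
  have : PreservesFiniteLimits (presheafToSheaf J AddCommGrpCat.{u}) := inferInstance
  unfold tensorQ
  infer_instance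

instance : (tensorQ J).PreservesEpimorphisms where
  preserves {F G} ψ _ := by
    have : Presheaf.IsLocallySurjective J (Functor.whiskerRight ψ.hom tensorQGroup) := by
      refine isLocallySurjective_of_exists _ fun U y ↦ ?_
      obtain ⟨a, n, hn, rfl⟩ := exists_eq_tmul (A := Sec G.obj U) y
      obtain ⟨T, hT, hT'⟩ := exists_of_epi ψ (U := U) a
      refine ⟨T, hT, fun W f hf ↦ ?_⟩
      obtain ⟨x, hx⟩ := hT' f hf
      refine ⟨(x ⊗ₜ[ℤ] (1 / n : ℚ) : Sec F.obj W ⊗[ℤ] ℚ), ?_⟩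
      change (ev ψ.hom W x ⊗ₜ[ℤ] (1 / n : ℚ) : Sec G.obj W ⊗[ℤ] ℚ) = _
      rw [hx]
      rfl
    have h := (Presheaf.isLocallySurjective_presheafToSheaf_map_iff J
      (Functor.whiskerRight ψ.hom tensorQGroup)).2 this
    exact (Sheaf.isLocallySurjective_iff_epi' AddCommGrpCat.{u} _).1 h

/-- Needed to identify the cohomology of the complex `G ⊗ ℚ` with the cohomology sheaves of `G`
tensored with `ℚ`. -/
instance : (tensorQ J).PreservesHomology :=
  Functor.preservesHomology_of_preservesEpis_and_kernels _

end TensorQExact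

section Constant

open scoped TensorProduct

variable {C : Type u} [SmallCategory C] (J : GrothendieckTopology C)

/-- `ℤ ⊗ ℚ = ℚ`. -/
noncomputable def tensorQGroupInt :
    tensorQGroup.obj (.of (ULift.{u} ℤ)) ≅ AddCommGrpCat.of (ULift.{u} ℚ) :=
  AddEquiv.toAddCommGrpIso (((TensorProduct.congr (ULift.moduleEquiv (R := ℤ) (M := ℤ))
    (LinearEquiv.refl ℤ ℚ)).trans (TensorProduct.lid ℤ ℚ)).toAddEquiv.trans
      (AddEquiv.ulift (α := ℚ)).symm)

/-- `ℤ ⊗ ℚ = ℚ` for constant sheaves. -/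
lemma nonempty_tensorQ_constZ_iso : Nonempty ((tensorQ J).obj (constZ J) ≅ constQ J) := by
  let P : Cᵒᵖ ⥤ AddCommGrpCat.{u} := (Functor.const _).obj (.of (ULift.{u} ℤ))
  -- The sheafification map of the constant presheaf is locally bijective, so one may tensor the
  -- constant presheaf itself.
  have := isIso_presheafToSheaf_tensorQ (J := J) (toSheafify J P)
    (fun U x hx ↦ by
      obtain ⟨T, hT, h⟩ := exists_of_isLocallyInjective (J := J) (toSheafify J P) x hx
      exact ⟨T, hT, fun W f hf ↦ ⟨1, one_pos, by rw [h f hf, smul_zero]⟩⟩)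
    (fun U y ↦ by
      obtain ⟨T, hT, h⟩ := exists_of_isLocallySurjective (J := J) (toSheafify J P) y
      exact ⟨T, hT, fun W f hf ↦ ⟨1, one_pos, by rw [one_smul]; exact h f hf⟩⟩)
  exact ⟨(asIso ((presheafToSheaf J _).map (Functor.whiskerRight (toSheafify J P) tensorQGroup))
    ).symm ≪≫ (presheafToSheaf J _).mapIso
      (NatIso.ofComponents (fun _ ↦ tensorQGroupInt) (fun f ↦ by
        change tensorQGroup.map (𝟙 _) ≫ _ = _ ≫ 𝟙 _
        simp))⟩

end Constant

end WeilEtale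

namespace WeilEtale

/-! ### Frobenius, traces and gluing on the pieces of `V̄` -/

section Pieces

variable {k : Type u} [Field k] [Fintype k]
  {S : Scheme.{u}} {s : S ⟶ Spec (.of k)} {E : Type u} [SmallCategory E] {ι : E ⥤ Over S}
  {K : Type u} [Field K] [Algebra k K] [IsAlgClosure k K]
variable [hE : IsEtaleFamily s ι]

open Opposite

/-- The action of the `n`-th power of the Frobenius on the sections over `V̄`. -/
noncomputable def phi (F : WeilSheaf s ι K) (V : E) (n : ℤ) :
    Sec F.obj (barObj s ι K V) →+ Sec F.obj (barObj s ι K V) :=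
  res F.obj (twist s ι K (𝟙 V) n)

lemma twist_id_zero (V : E) : twist s ι K (𝟙 V) 0 = 𝟙 _ := (barFunctor s ι K).map_id V

@[simp] lemma phi_zero (F : WeilSheaf s ι K) (V : E) (x : Sec F.obj (barObj s ι K V)) :
    phi F V 0 x = x := by
  rw [phi, twist_id_zero, res_id]

lemma phi_add (F : WeilSheaf s ι K) (V : E) (m n : ℤ) (x : Sec F.obj (barObj s ι K V)) :
    phi F V (m + n) x = phi F V m (phi F V n x) := by
  have := twist_comp s ι K (𝟙 V) (𝟙 V) m n
  rw [Category.id_comp] at this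
  rw [phi, this, res_comp]
  rfl

lemma res_twist_phi (F : WeilSheaf s ι K) {V V' : E} (h : V ⟶ V') (n : ℤ)
    (x : Sec F.obj (barObj s ι K V')) :
    res F.obj (twist s ι K h 0) (phi F V' n x) = phi F V n (res F.obj (twist s ι K h 0) x) := by
  rw [phi, phi, ← res_comp, ← res_comp, ← twist_comp, ← twist_comp, Category.comp_id,
    Category.id_comp, zero_add, add_zero]

lemma ev_frobPush (F : WeilSheaf s ι K) (V : E) (x : Sec F.obj (barObj s ι K V)) :
    ev ((frobPush s ι K).app F).hom V x = phi F V 1 x := rfl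

lemma phi_eq_of_one {F : WeilSheaf s ι K} {V : E} {x : Sec F.obj (barObj s ι K V)}
    (h : phi F V 1 x = x) (n : ℤ) : phi F V n x = x := by
  have h' : phi F V (-1) x = x := by
    conv_lhs => rw [← h]
    rw [← phi_add, neg_add_cancel, phi_zero]
  induction n using Int.induction_on with
  | zero => simp
  | succ n ih => rw [phi_add, h, ih]
  | pred n ih => rw [sub_eq_add_neg, phi_add, h', ih]

lemma phi_mul_eq {F : WeilSheaf s ι K} {V : E} {n : ℕ} {x : Sec F.obj (barObj s ι K V)}
    (h : phi F V n x = x) (m : ℕ) : phi F V (m * n : ℕ) x = x := by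
  induction m with
  | zero => simp
  | succ m ih => rw [add_mul, one_mul, Nat.cast_add, phi_add, h, ih]

/-- The trace. -/
noncomputable def trace (F : WeilSheaf s ι K) (V : E) (n : ℕ) :
    Sec F.obj (barObj s ι K V) →+ Sec F.obj (barObj s ι K V) :=
  ∑ i ∈ Finset.range n, phi F V i

lemma trace_apply (F : WeilSheaf s ι K) (V : E) (n : ℕ) (x : Sec F.obj (barObj s ι K V)) :
    trace F V n x = ∑ i ∈ Finset.range n, phi F V i x := by
  simp [trace]

/-- A telescoping sum. -/
lemma trace_phi_sub (F : WeilSheaf s ι K) (V : E) (n : ℕ) (x : Sec F.obj (barObj s ι K V)) :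
    trace F V n (phi F V 1 x - x) = phi F V n x - x := by
  rw [trace_apply]
  have : ∀ i ∈ Finset.range n, phi F V i (phi F V 1 x - x) =
      phi F V (i + 1 : ℕ) x - phi F V i x := fun i _ ↦ by
    rw [map_sub, ← phi_add, Nat.cast_succ]
  rw [Finset.sum_congr rfl this, Finset.sum_range_sub (fun i : ℕ ↦ phi F V i x)]
  simp

lemma phi_trace (F : WeilSheaf s ι K) (V : E) (n : ℕ) {x : Sec F.obj (barObj s ι K V)}
    (h : phi F V n x = x) : phi F V 1 (trace F V n x) = trace F V n x := by
  have h1 : phi F V 1 (trace F V n x) - trace F V n x = trace F V n (phi F V 1 x - x) := by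
    rw [map_sub, trace_apply, map_sum, trace_apply]
    congr 1
    refine Finset.sum_congr rfl fun i _ ↦ ?_
    rw [← phi_add, ← phi_add, add_comm]
  rw [trace_phi_sub, h, sub_self] at h1
  exact sub_eq_zero.1 h1

lemma trace_of_phi_one (F : WeilSheaf s ι K) (V : E) (n : ℕ) {x : Sec F.obj (barObj s ι K V)}
    (h : phi F V 1 x = x) : trace F V n x = n • x := by
  rw [trace_apply, Finset.sum_congr rfl (fun (i : ℕ) _ ↦ phi_eq_of_one h (i : ℤ)), Finset.sum_const,
    Finset.card_range]

lemma trace_mul (F : WeilSheaf s ι K) (V : E) (m n : ℕ) {x : Sec F.obj (barObj s ι K V)}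
    (h : phi F V n x = x) : trace F V (m * n) x = m • trace F V n x := by
  induction m with
  | zero => simp [trace]
  | succ m ih =>
    rw [add_mul, one_mul, trace_apply, Finset.sum_range_add, ← trace_apply, ih, add_smul, one_smul]
    congr 1
    rw [trace_apply]
    refine Finset.sum_congr rfl fun i _ ↦ ?_
    rw [Nat.cast_add, add_comm, phi_add, phi_mul_eq h]

/-- The empty sieve covers the empty scheme. -/
lemma subsingleton_sec (F : WeilSheaf s ι K) (U : Geom s ι K) (h : IsEmpty U.scheme) :
    Subsingleton (Sec F.obj U) :=
  ⟨fun _ _ ↦ sec_ext F.property (T := ⊥) (mem_weilTopology fun v ↦ h.elim v)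
    (fun _ _ hf ↦ hf.elim)⟩

namespace Level

variable (D : Level s ι K)

lemma ofArrows_tr_mem :
    Sieve.ofArrows (fun _ : Fin D.N ↦ D.geom) (fun i ↦ D.tr (i : ℕ)) ∈
      weilTopology s ι K (barObj s ι K D.V) := by
  refine mem_weilTopology fun v ↦ ?_
  obtain ⟨i, hi, y, hy⟩ := D.exists_tr_apply v
  exact ⟨_, D.tr i, Sieve.ofArrows_mk _ (fun i : Fin D.N ↦ D.tr (i : ℕ)) ⟨i, hi⟩, inferInstance,
    y, hy⟩

lemma sec_ext_tr (F : WeilSheaf s ι K) {x y : Sec F.obj (barObj s ι K D.V)}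
    (h : ∀ i < D.N, res F.obj (D.tr i) x = res F.obj (D.tr i) y) : x = y :=
  sec_ext_ofArrows F.property _ D.ofArrows_tr_mem fun i ↦ h i i.2

/-- The translates are disjoint, so no compatibility is required: `F(V̄)` is a product of `N` copies
of the sections over the piece. Values of `x` from `N` on play no role. -/
lemma exists_glue_tr (F : WeilSheaf s ι K) (x : ℕ → Sec F.obj D.geom) :
    ∃ y : Sec F.obj (barObj s ι K D.V), ∀ i < D.N, res F.obj (D.tr i) y = x i := by
  obtain ⟨y, hy⟩ := exists_glue F.property _ D.ofArrows_tr_mem (fun i ↦ x i) (by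
    intro i j Z a b h
    by_cases hZ : IsEmpty Z.scheme
    · exact (subsingleton_sec F Z hZ).elim _ _
    · obtain ⟨z⟩ := not_isEmpty_iff.1 hZ
      have hd := D.dvd_of_tr_eq h z
      -- Both indices are below `N`, and `N` divides their difference.
      have hij : i = j := by
        have := Int.eq_zero_of_abs_lt_dvd hd (by
          rw [abs_lt]; constructor <;> · have := i.2; have := j.2; omega)
        ext; omega
      subst hij
      rw [D.eq_of_tr h])
  exact ⟨y, fun i hi ↦ hy ⟨i, hi⟩⟩

lemma res_tr_phi (F : WeilSheaf s ι K) (n m : ℤ) (x : Sec F.obj (barObj s ι K D.V)) :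
    res F.obj (D.tr n) (phi F D.V m x) = res F.obj (D.tr (n + m)) x := by
  rw [phi, ← res_comp, tr_twist]

lemma res_tr_add (F : WeilSheaf s ι K) (n : ℤ) (hn : (D.N : ℤ) ∣ n) (m : ℤ)
    (x : Sec F.obj (barObj s ι K D.V)) :
    res F.obj (D.tr (n + m)) x = res F.obj (D.psi n hn) (res F.obj (D.tr m) x) := by
  rw [← res_comp, psi_tr]

/-- A section of trace zero is of the form `φ z - z`. -/
lemma exists_phi_sub (F : WeilSheaf s ι K) (x : Sec F.obj (barObj s ι K D.V))
    (hx : trace F D.V D.N x = 0) : ∃ z, phi F D.V 1 z - z = x := by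
  -- Along the pieces, `φ z - z = x` reads `z_{i+1} - z_i = (φ^i x)_0`; the partial traces of `x`
  -- solve this recursion with `z_0 = 0`.
  obtain ⟨z, hz⟩ := D.exists_glue_tr F fun i ↦ res F.obj (D.tr 0) (trace F D.V i x)
  refine ⟨z, D.sec_ext_tr F fun i hi ↦ ?_⟩
  -- When `i + 1 = N`, one returns to the piece `0` through the automorphism `psi`. Both sides then
  -- vanish: the left because `z_0 = 0`, the right because `x` has trace zero.
  have key : res F.obj (D.tr ((i + 1 : ℕ) : ℤ)) z = res F.obj (D.tr 0) (trace F D.V (i + 1) x) := by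
    rcases Nat.lt_or_eq_of_le (Nat.succ_le_of_lt hi) with h | h
    · exact hz _ h
    · have h0 : res F.obj (D.tr 0) z = 0 := by
        have := hz 0 (by omega)
        rw [Nat.cast_zero] at this
        rw [this, trace]
        simp
      have := D.res_tr_add F (D.N : ℤ) dvd_rfl 0 z
      rw [add_zero, h0, map_zero] at this
      rw [Nat.succ_eq_add_one] at h
      rw [h, this, hx, map_zero]
  rw [map_sub, res_tr_phi, ← Nat.cast_succ, key, hz i hi, ← map_sub, trace_apply, trace_apply,
    Finset.sum_range_succ, add_sub_cancel_left, res_tr_phi, zero_add]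

end Level

/-- The functor `F ↦ (V ↦ F(V̄))` is exact. -/
instance : (barPush s ι K).PreservesEpimorphisms where
  preserves {F F'} α _ := by
    refine epi_of_exists _ fun V y ↦ ?_
    change Sec F'.obj (barObj s ι K V) at y
    obtain ⟨T, hT, h⟩ := exists_of_epi α y
    refine ⟨_, Level.splitSieve_mem hT 1 one_ne_zero, ?_⟩
    rintro W _ ⟨D, g, h', rfl, -, hD⟩
    -- Lifts on the translates are chosen independently, with the dummy value `0` from the index
    -- `D.N` on, and then glued.
    have (i : ℕ) : ∃ x, i < D.N → ev α.hom _ x = res F'.obj (D.tr i ≫ twist s ι K h' 0) y := by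
      by_cases hi : i < D.N
      · obtain ⟨x, hx⟩ := h _ (hD i hi)
        exact ⟨x, fun _ ↦ hx⟩
      · exact ⟨0, fun h ↦ (hi h).elim⟩
    choose x hx using this
    obtain ⟨z, hz⟩ := D.exists_glue_tr F x
    refine ⟨res F.obj (twist s ι K g 0) z, ?_⟩
    have e : ev α.hom _ z = res F'.obj (twist s ι K h' 0) y := by
      refine D.sec_ext_tr F' fun i hi ↦ ?_
      rw [← ev_res, hz i hi, hx i hi, res_comp]
    change ev α.hom _ _ = res F'.obj (twist s ι K (g ≫ h') 0) y
    rw [ev_res, e, twist_comp_zero, res_comp]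

end Pieces

end WeilEtale

namespace WeilEtale

/-! ### Universal property and local generators of `γ^* G` -/

section GammaPull

variable {k : Type u} [Field k] [Fintype k]
  {S : Scheme.{u}} {s : S ⟶ Spec (.of k)} {E : Type u} [SmallCategory E] {ι : E ⥤ Over S}
  {K : Type u} [Field K] [Algebra k K] [IsAlgClosure k K]
variable [hE : IsEtaleFamily s ι]

open Opposite

/-- The inclusion of the invariants. -/
noncomputable def gammaIncl (F : WeilSheaf s ι K) :
    (gammaPush s ι K).obj F ⟶ (barPush s ι K).obj F :=
  (equalizer.ι (frobPush s ι K) (𝟙 _)).app F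

lemma gammaIncl_naturality {F F' : WeilSheaf s ι K} (α : F ⟶ F') :
    (gammaPush s ι K).map α ≫ gammaIncl F' = gammaIncl F ≫ (barPush s ι K).map α :=
  (equalizer.ι (frobPush s ι K) (𝟙 _)).naturality α

lemma gammaIncl_frobPush (F : WeilSheaf s ι K) :
    gammaIncl F ≫ (frobPush s ι K).app F = gammaIncl F :=
  (congr_app (equalizer.condition (frobPush s ι K) (𝟙 _)) F).trans (Category.comp_id _)

instance (F : WeilSheaf s ι K) : Mono (gammaIncl F) :=
  ⟨fun _ _ h ↦ Fork.IsLimit.hom_ext (equalizerAppIsLimit (frobPush s ι K) F) h⟩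

lemma exists_comp_gammaIncl {F : WeilSheaf s ι K} {G : EtaleSheaf ι}
    (α : G ⟶ (barPush s ι K).obj F) (hα : α ≫ (frobPush s ι K).app F = α) :
    ∃ β : G ⟶ (gammaPush s ι K).obj F, β ≫ gammaIncl F = α :=
  ⟨Fork.IsLimit.lift (equalizerAppIsLimit (frobPush s ι K) F) α (hα.trans (Category.comp_id α).symm),
    Fork.IsLimit.lift_ι' _ _ _⟩

/-- The canonical morphism from `G` to the push-forward of `γ^* G`. -/
noncomputable def hat (G : EtaleSheaf ι) :
    G ⟶ (barPush s ι K).obj ((gammaPull s ι K).obj G) :=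
  (gammaAdj s ι K).unit.app G ≫ gammaIncl _

lemma hat_naturality {G G' : EtaleSheaf ι} (α : G ⟶ G') :
    α ≫ hat (s := s) (K := K) G' = hat G ≫ (barPush s ι K).map ((gammaPull s ι K).map α) := by
  have := (gammaAdj s ι K).unit.naturality α
  dsimp at this
  rw [hat, hat, reassoc_of% this, gammaIncl_naturality, Category.assoc]

/-- No formula for `γ^* G` is used: this lemma and the next express, through `hat`, that it
represents the Frobenius-invariant morphisms from `G` to a push-forward. -/
lemma gammaPull_hom_ext {G : EtaleSheaf ι} {F : WeilSheaf s ι K}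
    {β β' : (gammaPull s ι K).obj G ⟶ F}
    (h : hat G ≫ (barPush s ι K).map β = hat G ≫ (barPush s ι K).map β') : β = β' := by
  apply ((gammaAdj s ι K).homEquiv _ _).injective
  rw [Adjunction.homEquiv_unit, Adjunction.homEquiv_unit, ← cancel_mono (gammaIncl F),
    Category.assoc, Category.assoc, gammaIncl_naturality, gammaIncl_naturality]
  simpa [hat] using h

lemma exists_gammaPull_hom {G : EtaleSheaf ι} {F : WeilSheaf s ι K}
    (α : G ⟶ (barPush s ι K).obj F) (hα : α ≫ (frobPush s ι K).app F = α) :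
    ∃ β : (gammaPull s ι K).obj G ⟶ F, hat G ≫ (barPush s ι K).map β = α := by
  obtain ⟨α', rfl⟩ := exists_comp_gammaIncl α hα
  refine ⟨((gammaAdj s ι K).homEquiv _ _).symm α', ?_⟩
  rw [hat, Category.assoc, ← gammaIncl_naturality, ← Category.assoc, ← Adjunction.homEquiv_unit,
    Equiv.apply_symm_apply]

/-- The section over `V̄` given by a section over `V`. -/
noncomputable def hatSec (G : EtaleSheaf ι) {V : E} :
    Sec G.obj V →+ Sec ((gammaPull s ι K).obj G).obj (barObj s ι K V) :=
  ev (hat G).hom V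

lemma hatSec_res (G : EtaleSheaf ι) {V W : E} (f : W ⟶ V) (y : Sec G.obj V) :
    hatSec (s := s) (K := K) G (res G.obj f y) =
      res ((gammaPull s ι K).obj G).obj (twist s ι K f 0) (hatSec G y) :=
  ev_res (hat G).hom f y

lemma phi_hatSec (G : EtaleSheaf ι) {V : E} (y : Sec G.obj V) (n : ℤ) :
    phi ((gammaPull s ι K).obj G) V n (hatSec G y) = hatSec G y := by
  refine phi_eq_of_one ?_ n
  rw [← ev_frobPush]
  have : hat G ≫ (frobPush s ι K).app _ = hat (s := s) (K := K) G := by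
    rw [hat, Category.assoc, gammaIncl_frobPush]
  exact congrArg (fun c ↦ ev c.hom V y) this

lemma gammaPull_hom_ext_sec {G : EtaleSheaf ι} {F : WeilSheaf s ι K}
    {β β' : (gammaPull s ι K).obj G ⟶ F}
    (h : ∀ (V : E) (y : Sec G.obj V), ev β.hom _ (hatSec G y) = ev β'.hom _ (hatSec G y)) :
    β = β' := by
  apply gammaPull_hom_ext
  ext : 1
  exact ev_ext h

/-- The sections of `γ^* G` generated by the pull-backs of sections of `G`. -/
noncomputable def gen (G : EtaleSheaf ι) (U : Geom s ι K) :
    AddSubgroup (Sec ((gammaPull s ι K).obj G).obj U) :=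
  AddSubgroup.closure {x | ∃ (W : E) (f : U ⟶ barObj s ι K W) (y : Sec G.obj W),
    x = res _ f (hatSec G y)}

lemma res_mem_gen (G : EtaleSheaf ι) {U U' : Geom s ι K} (f : U' ⟶ U)
    {x : Sec ((gammaPull s ι K).obj G).obj U} (hx : x ∈ gen G U) :
    res _ f x ∈ gen G U' := by
  induction hx using AddSubgroup.closure_induction with
  | mem x hx =>
    obtain ⟨W, g, y, rfl⟩ := hx
    exact AddSubgroup.subset_closure ⟨W, f ≫ g, y, (res_comp _ _ _).symm⟩
  | zero => rw [map_zero]; exact zero_mem _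
  | add x y _ _ hx hy => rw [map_add]; exact add_mem hx hy
  | neg x _ hx => rw [map_neg]; exact neg_mem hx

/-- The subpresheaf of `γ^* G` generated by the pull-backs of sections of `G`. -/
noncomputable def genPresheaf (G : EtaleSheaf ι) : (Geom s ι K)ᵒᵖ ⥤ AddCommGrpCat.{u} where
  obj U := .of (gen G U.unop)
  map f := AddCommGrpCat.ofHom (((res _ f.unop).comp (gen G _).subtype).codRestrict _
    fun x ↦ res_mem_gen G f.unop x.2)
  map_id U := by
    refine AddCommGrpCat.hom_ext (AddMonoidHom.ext fun x ↦ Subtype.ext ?_)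
    exact res_id (F := ((gammaPull s ι K).obj G).obj) _
  map_comp f g := by
    refine AddCommGrpCat.hom_ext (AddMonoidHom.ext fun x ↦ Subtype.ext ?_)
    exact res_comp (F := ((gammaPull s ι K).obj G).obj) _ _ _

/-- The inclusion of this subpresheaf. -/
noncomputable def genIncl (G : EtaleSheaf ι) :
    genPresheaf (s := s) (K := K) G ⟶ ((gammaPull s ι K).obj G).obj where
  app U := AddCommGrpCat.ofHom (gen G U.unop).subtype
  naturality U V f := by
    ext x
    rfl

/-- The sections of `γ^* G` are locally generated by the pull-backs of sections of `G`. -/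
lemma exists_mem_gen (G : EtaleSheaf ι) {U : Geom s ι K}
    (x : Sec ((gammaPull s ι K).obj G).obj U) :
    ∃ T ∈ weilTopology s ι K U, ∀ ⦃W⦄ (f : W ⟶ U), T f → res _ f x ∈ gen G W := by
  -- Two morphisms on `γ^* G` which agree on the subpresheaf agree on the pull-backs of sections of
  -- `G`, hence coincide. So the inclusion becomes an epimorphism after sheafification, that is, it
  -- is locally surjective.
  have hepi : Epi ((presheafToSheaf (weilTopology s ι K) _).map (genIncl G)) := by
    refine ⟨fun {Z} α β h ↦ ?_⟩
    apply ((sheafificationAdjunction (weilTopology s ι K) AddCommGrpCat.{u}).homEquiv _ _).injective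
    have hcomp := congrArg ((sheafificationAdjunction (weilTopology s ι K)
      AddCommGrpCat.{u}).homEquiv _ _) h
    rw [Adjunction.homEquiv_naturality_left, Adjunction.homEquiv_naturality_left] at hcomp
    let α' : (gammaPull s ι K).obj G ⟶ Z := ⟨(sheafificationAdjunction (weilTopology s ι K)
      AddCommGrpCat.{u}).homEquiv _ _ α⟩
    let β' : (gammaPull s ι K).obj G ⟶ Z := ⟨(sheafificationAdjunction (weilTopology s ι K)
      AddCommGrpCat.{u}).homEquiv _ _ β⟩
    have : α' = β' := gammaPull_hom_ext_sec fun V y ↦ by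
      let z : gen G (barObj s ι K V) :=
        ⟨hatSec G y, AddSubgroup.subset_closure ⟨V, 𝟙 _, y, (res_id _).symm⟩⟩
      exact congrArg (fun c ↦ ev c (barObj s ι K V) z) hcomp
    exact congrArg (·.hom) this
  have := (Presheaf.isLocallySurjective_presheafToSheaf_map_iff (weilTopology s ι K)
    (genIncl G)).1 ((Sheaf.isLocallySurjective_iff_epi' AddCommGrpCat.{u} _).2 hepi)
  obtain ⟨T, hT, h⟩ := exists_of_isLocallySurjective (J := weilTopology s ι K) (genIncl G) x
  refine ⟨T, hT, fun W f hf ↦ ?_⟩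
  obtain ⟨z, hz⟩ := h f hf
  rw [← hz]
  exact z.2

end GammaPull

/-! ### Morphisms from pieces to members of `E` -/

section Factor

variable {k : Type u} [Field k] [Fintype k]
  {S : Scheme.{u}} {s : S ⟶ Spec (.of k)} {E : Type u} [SmallCategory E] {ι : E ⥤ Over S}
  {K : Type u} [Field K] [Algebra k K] [IsAlgClosure k K]
variable [hE : IsEtaleFamily s ι]

lemma mem_etaleTopology_of_surjective {V W : E} (f : W ⟶ V) (hf : Etale (ι.map f).left)
    (hf' : Surjective (ι.map f).left) {T : Sieve V} (hT : T f) : T ∈ etaleTopology ι V :=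
  mem_etaleTopology fun v ↦ ⟨W, f, hT, hf, hf'.surj v⟩

namespace Level

/-- After a finite extension a morphism from a piece to `W̄` splits into a Frobenius translate and a
morphism of `E`. This reduces the study of `γ^* G` on pieces to sections of `G`. -/
lemma exists_factor_geom (D : Level s ι K) {W : E} (g : D.geom ⟶ barObj s ι K W) :
    ∃ (D' : Level s ι K) (m : Map D' D) (h : D'.V ⟶ W), Etale (ι.map m.f).left ∧
      Surjective (ι.map m.f).left ∧ IsIso (map m) ∧
        map m ≫ g = D'.tr (Geom.deg g) ≫ twist s ι K h 0 := by
  obtain ⟨D', m, h, h₁, h₂, h₃, h₄⟩ := D.exists_factor (Geom.left g ≫ barProj s ι K W)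
    (left_barProj_hom g)
  refine ⟨D', m, h, h₁, h₂, h₃, barObj_hom_ext (by simp) ?_⟩
  simp only [Geom.left_comp, Category.assoc, twist_barProj]
  rw [← h₄, ← Category.assoc, left_tr]

end Level

/-- The functor to schemes over `S`. -/
noncomputable def overS (s : S ⟶ Spec (.of k)) (ι : E ⥤ Over S) (K : Type u) [Field K]
    [Algebra k K] [IsAlgClosure k K] : Geom s ι K ⥤ Over S where
  obj U := Over.mk U.toS
  map f := Over.homMk (Geom.left f) (Geom.left_toS f)

/-- The projection `V̄ ⟶ V` over `S`. -/
noncomputable def overProj (V : E) : (overS s ι K).obj (barObj s ι K V) ⟶ ι.obj V :=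
  Over.homMk (barProj s ι K V) (barProj_hom s ι K V)

lemma overS_twist_overProj {V W : E} (f : W ⟶ V) (n : ℤ) :
    (overS s ι K).map (twist s ι K f n) ≫ overProj V = overProj W ≫ ι.map f := by
  apply (Over.forget S).map_injective
  exact twist_barProj f n

/-- The projection `D ×_L K ⟶ D` over `S`. -/
noncomputable def Level.overFst (D : Level s ι K) : (overS s ι K).obj D.geom ⟶ ι.obj D.V :=
  Over.homMk D.fst D.fst_hom

lemma Level.overS_tr (D : Level s ι K) (n : ℤ) :
    (overS s ι K).map (D.tr n) ≫ overProj D.V = D.overFst := by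
  apply (Over.forget S).map_injective
  exact D.left_tr n

lemma Level.overS_map {D D' : Level s ι K} (m : Level.Map D' D) :
    (overS s ι K).map (Level.map m) ≫ D.overFst = D'.overFst ≫ ι.map m.f := by
  apply (Over.forget S).map_injective
  exact Level.left_map_fst m

instance (D : Level s ι K) : Epi D.overFst := by
  have : Epi ((Over.forget S).map D.overFst) := inferInstanceAs (Epi D.fst)
  exact (Over.forget S).epi_of_epi_map this

lemma Level.exists_factor_over (D : Level s ι K) {W : E} (p : (overS s ι K).obj D.geom ⟶ ι.obj W) :
    ∃ (D' : Level s ι K) (m : Level.Map D' D) (h : D'.V ⟶ W), Etale (ι.map m.f).left ∧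
      Surjective (ι.map m.f).left ∧ IsIso (Level.map m) ∧
        (overS s ι K).map (Level.map m) ≫ p = D'.overFst ≫ ι.map h := by
  obtain ⟨D', m, h, h₁, h₂, h₃, h₄⟩ := D.exists_factor p.left (Over.w p)
  refine ⟨D', m, h, h₁, h₂, h₃, ?_⟩
  apply (Over.forget S).map_injective
  exact h₄.symm

/-- Makes the value at a piece of a left Kan extension along `ι` a filtered colimit. Common
refinements exist because morphisms from a piece to members of `E` descend after a finite extension;
parallel morphisms are equalized because `D.overFst` is an epimorphism and `ι` is faithful. -/
instance (D : Level s ι K) : IsCofiltered (StructuredArrow ((overS s ι K).obj D.geom) ι) where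
  nonempty := ⟨StructuredArrow.mk D.overFst⟩
  cone_objs := by
    intro X Y
    obtain ⟨D₁, m₁, h₁, -, -, i₁, e₁⟩ := D.exists_factor_over X.hom
    obtain ⟨D₂, m₂, h₂, -, -, i₂, e₂⟩ := D₁.exists_factor_over
      ((overS s ι K).map (Level.map m₁) ≫ Y.hom)
    refine ⟨StructuredArrow.mk (inv ((overS s ι K).map (Level.map m₂ ≫ Level.map m₁)) ≫
      D₂.overFst), StructuredArrow.homMk (m₂.f ≫ h₁) ?_, StructuredArrow.homMk h₂ ?_, trivial⟩
    · dsimp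
      rw [Category.assoc, IsIso.inv_comp_eq, Functor.map_comp, ← Category.assoc,
        ← Level.overS_map, Category.assoc, ← e₁, Functor.map_comp, Category.assoc]
    · dsimp
      rw [Category.assoc, IsIso.inv_comp_eq, ← e₂, Functor.map_comp, Category.assoc]
  cone_maps := by
    intro X Y f g
    obtain ⟨D₁, m₁, h₁, -, -, i₁, e₁⟩ := D.exists_factor_over X.hom
    have hf := StructuredArrow.w f
    have hg := StructuredArrow.w g
    refine ⟨StructuredArrow.mk (inv ((overS s ι K).map (Level.map m₁)) ≫ D₁.overFst),
      StructuredArrow.homMk h₁ ?_, ?_⟩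
    · dsimp
      rw [Category.assoc, IsIso.inv_comp_eq, e₁]
    · ext
      have := hE.faithful
      apply ι.map_injective
      dsimp
      rw [← cancel_epi D₁.overFst, Functor.map_comp, Functor.map_comp, ← reassoc_of% e₁,
        ← reassoc_of% e₁, hf, hg]

end Factor

end WeilEtale

namespace WeilEtale

/-! ### The unit `G ⟶ γ_* γ^* G` and the periodicity of sections of `γ^* G` -/

section Unit

variable {k : Type u} [Field k] [Fintype k]
  {S : Scheme.{u}} {s : S ⟶ Spec (.of k)} {E : Type u} [SmallCategory E] {ι : E ⥤ Over S}
  {K : Type u} [Field K] [Algebra k K] [IsAlgClosure k K]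
variable [hE : IsEtaleFamily s ι]

open Opposite

/-- The presheaf on the category of `S`-schemes given by `G`. -/
noncomputable def extend (G : Eᵒᵖ ⥤ AddCommGrpCat.{u}) : (Over S)ᵒᵖ ⥤ AddCommGrpCat.{u} :=
  ι.op.leftKanExtension G

/-- The section of `extend G` given by a section of `G`. -/
noncomputable def toExtend (G : Eᵒᵖ ⥤ AddCommGrpCat.{u}) {V : E} {T : Over S} (p : T ⟶ ι.obj V) :
    Sec G V →+ (extend (ι := ι) G).obj (op T) :=
  ((ι.op.leftKanExtensionUnit G).app (op V) ≫ (ι.op.leftKanExtension G).map p.op).hom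

lemma toExtend_res (G : Eᵒᵖ ⥤ AddCommGrpCat.{u}) {V W : E} (f : W ⟶ V) {T : Over S}
    (p : T ⟶ ι.obj W) (y : Sec G V) :
    toExtend G p (res G f y) = toExtend G (p ≫ ι.map f) y := by
  have := (ι.op.leftKanExtensionUnit G).naturality f.op
  have h : G.map f.op ≫ (ι.op.leftKanExtensionUnit G).app (op W) ≫
      (ι.op.leftKanExtension G).map p.op =
        (ι.op.leftKanExtensionUnit G).app (op V) ≫
          (ι.op.leftKanExtension G).map (p ≫ ι.map f).op := by
    rw [← Category.assoc, this, op_comp, Functor.map_comp, Category.assoc]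
    rfl
  exact ConcreteCategory.congr_hom h y

lemma map_toExtend (G : Eᵒᵖ ⥤ AddCommGrpCat.{u}) {V : E} {T T' : Over S} (g : T' ⟶ T)
    (p : T ⟶ ι.obj V) (y : Sec G V) :
    ((extend G).map g.op).hom (toExtend G p y) = toExtend G (g ≫ p) y := by
  have h : ((ι.op.leftKanExtensionUnit G).app (op V) ≫ (ι.op.leftKanExtension G).map p.op) ≫
      (ι.op.leftKanExtension G).map g.op =
        (ι.op.leftKanExtensionUnit G).app (op V) ≫
          (ι.op.leftKanExtension G).map (g ≫ p).op := by
    rw [op_comp, Functor.map_comp, Category.assoc]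
  exact ConcreteCategory.congr_hom h y

/-- In a filtered colimit a vanishing section vanishes at a finite stage. -/
lemma exists_of_toExtend_eq_zero (G : Eᵒᵖ ⥤ AddCommGrpCat.{u}) (D : Level s ι K) {V : E}
    (p : (overS s ι K).obj D.geom ⟶ ι.obj V) (y : Sec G V) (h : toExtend G p y = 0) :
    ∃ (W : E) (q : (overS s ι K).obj D.geom ⟶ ι.obj W) (f : W ⟶ V), q ≫ ι.map f = p ∧
      res G f y = 0 := by
  have : IsFiltered (CostructuredArrow ι.op (op ((overS s ι K).obj D.geom))) :=
    IsFiltered.of_equivalence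
      (structuredArrowOpEquivalence ι ((overS s ι K).obj D.geom))
  let j : CostructuredArrow ι.op (op ((overS s ι K).obj D.geom)) :=
    CostructuredArrow.mk (Y := op V) p.op
  obtain ⟨l, a, b, hab⟩ := Concrete.isColimit_exists_of_rep_eq _
    (ι.op.isPointwiseLeftKanExtensionLeftKanExtensionUnit G (op ((overS s ι K).obj D.geom)))
    (i := j) (j := j) y (0 : Sec G V) (h.trans (map_zero (toExtend G p)).symm)
  refine ⟨l.left.unop, l.hom.unop, a.left.unop, ?_, ?_⟩
  · exact congrArg Quiver.Hom.unop (CostructuredArrow.w a)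
  · exact Eq.trans (b := res G b.left.unop 0) hab (map_zero _)

/-- Injectivity is tested on a concrete target: the Kan extension of `G` to schemes over `S`, pulled
back to the geometric category and sheafified, receives a morphism from `γ^* G`. A section which
dies there dies locally in the Kan extension, hence at a finite stage, hence on an étale covering of
`V`. -/
lemma eq_zero_of_hatSec (G : EtaleSheaf ι) {V : E} (y : Sec G.obj V)
    (hy : hatSec (s := s) (K := K) G y = 0) : y = 0 := by
  let H : (Geom s ι K)ᵒᵖ ⥤ AddCommGrpCat.{u} := (overS s ι K).op ⋙ extend (ι := ι) G.obj
  have hres {U U' : Geom s ι K} (f : U' ⟶ U) {W : E} (p : (overS s ι K).obj U ⟶ ι.obj W)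
      (z : Sec G.obj W) : res H f (toExtend G.obj p z) =
        toExtend G.obj ((overS s ι K).map f ≫ p) z := map_toExtend _ _ _ _
  let J := weilTopology s ι K
  let F : WeilSheaf s ι K := (presheafToSheaf J _).obj H
  let e (V : E) : Sec G.obj V →+ Sec F.obj (barObj s ι K V) :=
    (ev (toSheafify J H) (barObj s ι K V)).comp (toExtend G.obj (overProj V))
  -- `overS` forgets degrees, so all powers of the Frobenius fix these sections, and the morphism
  -- `α` below is Frobenius-invariant.
  have he {V W : E} (f : W ⟶ V) (n : ℤ) (x : Sec G.obj V) :
      e W (res G.obj f x) = res F.obj (twist s ι K f n) (e V x) := by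
    change ev (toSheafify J H) _ (toExtend G.obj (overProj W) (res G.obj f x)) = _
    rw [toExtend_res, ← overS_twist_overProj f n, ← hres]
    exact ev_res _ _ _
  let α : G ⟶ (barPush s ι K).obj F := ⟨homOfSec e (fun f x ↦ he f 0 x)⟩
  have hα : α ≫ (frobPush s ι K).app F = α := by
    ext : 1
    refine ev_ext fun W z ↦ ?_
    have := he (𝟙 W) 1 z
    rw [res_id] at this
    exact this.symm
  obtain ⟨β, hβ⟩ := exists_gammaPull_hom α hα
  have h0 : ev (toSheafify J H) (barObj s ι K V) (toExtend G.obj (overProj V) y) = 0 := by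
    have h1 : ev α.hom V y = ev β.hom _ (hatSec G y) :=
      congrArg (fun c ↦ ev c.hom V y) hβ.symm
    rw [hy, map_zero] at h1
    exact h1
  obtain ⟨T, hT, hT'⟩ := exists_of_isLocallyInjective (J := J) (toSheafify J H)
    (toExtend G.obj (overProj V) y) h0
  refine sec_ext G.property (Level.splitSieve_mem hT 1 one_ne_zero) ?_
  rintro W _ ⟨D, g, h, rfl, -, hD⟩
  have hN : 0 < D.N := Module.finrank_pos
  have h1 : toExtend G.obj D.overFst (res G.obj h y) = 0 := by
    rw [toExtend_res, ← Level.overS_tr D (0 : ℕ), Category.assoc, ← overS_twist_overProj h 0,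
      ← Category.assoc, ← Functor.map_comp, ← hres]
    exact hT' _ (hD 0 hN)
  -- The section vanishes on a member of `E` through which the piece maps to `D.V`. Descending that
  -- map to a finite extension gives the vanishing on the étale covering `m.f`.
  obtain ⟨W', q, f, hq, hf⟩ := exists_of_toExtend_eq_zero G.obj D D.overFst _ h1
  obtain ⟨D', m, l, i₁, i₂, -, e⟩ := D.exists_factor_over q
  have hm : l ≫ f = m.f := by
    have := hE.faithful
    apply ι.map_injective
    rw [← cancel_epi D'.overFst, Functor.map_comp, ← reassoc_of% e, hq, Level.overS_map]
  have h2 : res G.obj h y = 0 := by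
    refine sec_ext G.property (T := Sieve.generate (Presieve.singleton m.f))
      (mem_etaleTopology_of_surjective m.f i₁ i₂
        ⟨_, 𝟙 _, m.f, Presieve.singleton_self _, Category.id_comp _⟩) ?_
    rintro Z _ ⟨_, c, _, ⟨⟩, rfl⟩
    rw [res_comp, ← hm, res_comp, hf, map_zero, map_zero, map_zero]
  rw [res_comp, h2, map_zero, map_zero]

/-- The pull-backs of sections of `γ^* G` to levels come, étale locally, from sections of `G`. -/
lemma exists_res_eq_hatSec (G : EtaleSheaf ι) {U : Geom s ι K}
    (x : Sec ((gammaPull s ι K).obj G).obj U) (D : Level s ι K) (f : D.geom ⟶ U)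
    (z : D.geom.scheme) :
    ∃ (D' : Level s ι K) (m : Level.Map D' D), Etale (ι.map m.f).left ∧
      (∃ z', Geom.left (Level.map m) z' = z) ∧ ∃ y : Sec G.obj D'.V,
        res _ (Level.map m ≫ f) x = res _ (D'.tr 0) (hatSec G y) := by
  obtain ⟨T, hT, h⟩ := exists_mem_gen G x
  obtain ⟨D₁, m₁, i₁, ⟨z₁, rfl⟩, hT₁⟩ := D.exists_map_mem hT f z
  -- All levels over `D₁` are admitted, so that in a sum the second summand can be treated on the
  -- refinement found for the first.
  have key : ∀ x' ∈ gen G D₁.geom, ∀ (D₂ : Level s ι K) (m₂ : Level.Map D₂ D₁)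
      (z : D₂.geom.scheme), ∃ (D' : Level s ι K) (m : Level.Map D' D₂), Etale (ι.map m.f).left ∧
        (∃ z', Geom.left (Level.map m) z' = z) ∧ ∃ y : Sec G.obj D'.V,
          res _ (Level.map m ≫ Level.map m₂) x' = res _ (D'.tr 0) (hatSec G y) := by
    intro x' hx'
    induction hx' using AddSubgroup.closure_induction with
    | mem x' hx' =>
      obtain ⟨W, g, y, rfl⟩ := hx'
      intro D₂ m₂ z
      obtain ⟨D', m, h, j₁, j₂, j₃, e⟩ := D₂.exists_factor_geom (Level.map m₂ ≫ g)
      refine ⟨D', m, j₁, (inferInstance : Surjective (Geom.left (Level.map m))).surj z,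
        res _ h y, ?_⟩
      rw [← res_comp, Category.assoc, e, res_comp, ← hatSec_res]
      conv_lhs => rw [← zero_add (Geom.deg (Level.map m₂ ≫ g)), ← Level.tr_twist, res_comp]
      congr 1
      exact phi_hatSec G _ _
    | zero =>
      intro D₂ m₂ z
      refine ⟨D₂, .id D₂, ?_, ⟨z, by rw [Level.map_id]; rfl⟩, 0, by simp⟩
      dsimp only [Level.Map.id]
      rw [CategoryTheory.Functor.map_id]
      exact inferInstanceAs (Etale (𝟙 _))
    | add a b _ _ ha hb =>
      intro D₂ m₂ z
      obtain ⟨D', m, j, ⟨z', rfl⟩, y, e⟩ := ha D₂ m₂ z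
      obtain ⟨D'', m', j', ⟨z'', rfl⟩, y', e'⟩ := hb D' (m.comp m₂) z'
      refine ⟨D'', m'.comp m, ?_, ⟨z'', by rw [Level.map_comp]; rfl⟩, res _ m'.f y + y', ?_⟩
      · dsimp only [Level.Map.comp]
        rw [Functor.map_comp, Over.comp_left]
        infer_instance
      · rw [Level.map_comp] at e'
        rw [Level.map_comp, map_add, map_add, map_add, Category.assoc, e', res_comp, e, hatSec_res,
          ← res_comp, ← res_comp, Level.map_tr]
    | neg a _ ha =>
      intro D₂ m₂ z
      obtain ⟨D', m, j, hz, y, e⟩ := ha D₂ m₂ z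
      exact ⟨D', m, j, hz, -y, by rw [map_neg, map_neg, map_neg, e]⟩
  obtain ⟨D', m, j, ⟨z', rfl⟩, y, e⟩ := key _ (h _ hT₁) D₁ (.id D₁) z₁
  refine ⟨D', m.comp m₁, ?_, ⟨z', by rw [Level.map_comp]; rfl⟩, y, ?_⟩
  · dsimp only [Level.Map.comp]
    rw [Functor.map_comp, Over.comp_left]
    infer_instance
  · rw [Level.map_id, Category.comp_id, ← res_comp] at e
    rw [Level.map_comp, Category.assoc, e]

/-- The other pieces are Frobenius translates of the piece `0`, so for an invariant section they
carry no further information. -/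
lemma Level.eq_of_res_tr_zero (D : Level s ι K) (F : WeilSheaf s ι K)
    {x y : Sec F.obj (barObj s ι K D.V)} (hx : phi F _ 1 x = x) (hy : phi F _ 1 y = y)
    (h : res F.obj (D.tr 0) x = res F.obj (D.tr 0) y) : x = y := by
  refine D.sec_ext_tr F fun i _ ↦ ?_
  rw [← zero_add (i : ℤ), ← D.res_tr_phi, ← D.res_tr_phi, phi_eq_of_one hx, phi_eq_of_one hy, h]

/-- The sections of `γ^* G` over `V̄` which are invariant under the Frobenius come, locally, from
sections of `G`. -/
lemma exists_hatSec_eq (G : EtaleSheaf ι) {V : E}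
    (x : Sec ((gammaPull s ι K).obj G).obj (barObj s ι K V)) (hx : phi _ V 1 x = x) :
    ∃ T ∈ etaleTopology ι V, ∀ ⦃W⦄ (f : W ⟶ V), T f →
      ∃ y, hatSec G y = res _ (twist s ι K f 0) x := by
  let T : Sieve V :=
    { arrows := fun W f ↦ ∃ y, hatSec G y = res _ (twist s ι K f 0) x
      downward_closed := by
        rintro W W' f ⟨y, hy⟩ g
        exact ⟨res _ g y, by rw [hatSec_res, hy, twist_comp_zero, res_comp]⟩ }
  refine ⟨T, mem_etaleTopology fun v ↦ ?_, fun W f hf ↦ hf⟩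
  obtain ⟨z, hz⟩ := (Level.bot s ι K V).fst.surjective v
  obtain ⟨D, m, i, ⟨z', hz'⟩, y, e⟩ := exists_res_eq_hatSec G x (Level.bot s ι K V)
    ((Level.bot s ι K V).tr 0) z
  refine ⟨D.V, m.f, ⟨y, ?_⟩, i, D.fst z', ?_⟩
  · refine D.eq_of_res_tr_zero _ (phi_hatSec G y 1) ?_ ?_
    · rw [← res_twist_phi, hx]
    · rw [← e, Level.map_tr, res_comp]
  · rw [← hz, ← hz', ← Scheme.Hom.comp_apply, ← Scheme.Hom.comp_apply, Level.left_map_fst]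

/-- The unit `G ⟶ γ_* γ^* G` is an isomorphism. -/
instance (G : EtaleSheaf ι) : IsIso ((gammaAdj s ι K).unit.app G) := by
  refine isIso_of_locally _ (fun V y hy ↦ ?_) (fun V x ↦ ?_)
  · refine eq_zero_of_hatSec (s := s) (K := K) G y ?_
    change ev (gammaIncl _).hom V (ev ((gammaAdj s ι K).unit.app G).hom V y) = 0
    rw [hy, map_zero]
  · have hx : phi _ V 1 (ev (gammaIncl ((gammaPull s ι K).obj G)).hom V x) =
        ev (gammaIncl ((gammaPull s ι K).obj G)).hom V x :=
      congrArg (fun c : (gammaPush s ι K).obj ((gammaPull s ι K).obj G) ⟶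
        (barPush s ι K).obj ((gammaPull s ι K).obj G) ↦ ev c.hom V x) (gammaIncl_frobPush _)
    obtain ⟨T, hT, h⟩ := exists_hatSec_eq G _ hx
    refine ⟨T, hT, fun W f hf ↦ ?_⟩
    obtain ⟨y, hy⟩ := h f hf
    refine ⟨y, ev_injective_of_mono (gammaIncl ((gammaPull s ι K).obj G)) W ?_⟩
    exact hy.trans (ev_res (gammaIncl ((gammaPull s ι K).obj G)).hom f x).symm

/-- The sections of `γ^* G` over `V̄` are, locally, invariant under a power of the Frobenius. -/
lemma exists_phi_eq (G : EtaleSheaf ι) {V : E}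
    (x : Sec ((gammaPull s ι K).obj G).obj (barObj s ι K V)) :
    ∃ T ∈ etaleTopology ι V, ∀ ⦃W⦄ (f : W ⟶ V), T f → ∃ n : ℕ, 0 < n ∧
      phi _ W n (res _ (twist s ι K f 0) x) = res _ (twist s ι K f 0) x := by
  obtain ⟨T, hT, h⟩ := exists_mem_gen G x
  refine ⟨_, Level.splitSieve_mem hT 1 one_ne_zero, ?_⟩
  rintro W _ ⟨D, g, h', rfl, -, hD⟩
  -- Over a larger level `D'` a generator is a pull-back of a section of `G` along a translate, so
  -- it is fixed by the powers of the Frobenius divisible by `D'.N`. In a sum, the product of the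
  -- two periods works.
  have key : ∀ x' ∈ gen G D.geom, ∃ n : ℕ, 0 < n ∧ D.N ∣ n ∧
      ∀ (n' : ℕ) (h : (D.N : ℤ) ∣ n'), n ∣ n' → res _ (D.psi n' h) x' = x' := by
    intro x' hx'
    induction hx' using AddSubgroup.closure_induction with
    | mem x' hx' =>
      obtain ⟨W, g, y, rfl⟩ := hx'
      obtain ⟨D', m, h, -, -, j₃, e⟩ := D.exists_factor_geom g
      refine ⟨D'.N, Module.finrank_pos, m.dvd, fun n' hn' hd ↦ ?_⟩
      have hd' : (D'.N : ℤ) ∣ n' := by exact_mod_cast hd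
      have h1 : D.psi n' hn' ≫ g = g ≫ twist s ι K (𝟙 W) n' := by
        rw [← cancel_epi (Level.map m), ← reassoc_of% (Level.map_psi m n' hd'), e,
          ← Category.assoc, Level.psi_tr, reassoc_of% e, ← twist_comp, Category.comp_id, zero_add,
          add_comm, ← Level.tr_twist, Category.assoc, ← twist_comp, Category.id_comp, add_zero]
      rw [← res_comp, h1, res_comp]
      congr 1
      exact phi_hatSec G y _
    | zero => exact ⟨D.N, Module.finrank_pos, dvd_rfl, fun _ _ _ ↦ map_zero _⟩
    | add a b _ _ ha hb =>
      obtain ⟨n, hn, hn', H⟩ := ha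
      obtain ⟨l, hl, hl', H'⟩ := hb
      exact ⟨n * l, Nat.mul_pos hn hl, hn'.mul_right _, fun n' h h' ↦ by
        rw [map_add, H n' h ((Nat.dvd_mul_right _ _).trans h'),
          H' n' h ((Nat.dvd_mul_left _ _).trans h')]⟩
    | neg a _ ha =>
      obtain ⟨n, hn, hn', H⟩ := ha
      exact ⟨n, hn, hn', fun n' h h' ↦ by rw [map_neg, H n' h h']⟩
  have key' (i : ℕ) : ∃ n : ℕ, 0 < n ∧ D.N ∣ n ∧ (i < D.N →
      ∀ (n' : ℕ) (h : (D.N : ℤ) ∣ n'), n ∣ n' → res _ (D.psi n' h)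
        (res _ (D.tr i ≫ twist s ι K h' 0) x) = res _ (D.tr i ≫ twist s ι K h' 0) x) := by
    by_cases hi : i < D.N
    · obtain ⟨n, hn, hn', H⟩ := key _ (h _ (hD i hi))
      exact ⟨n, hn, hn', fun _ ↦ H⟩
    · exact ⟨D.N, Module.finrank_pos, dvd_rfl, fun h ↦ (hi h).elim⟩
  choose n hn hn' H using key'
  -- A common period for all the pieces; the factor `D.N` ensures that `φ^M` preserves each of them
  -- and acts through `psi`.
  let M := D.N * ∏ i ∈ Finset.range D.N, n i
  have hM : (D.N : ℤ) ∣ M := by exact_mod_cast Nat.dvd_mul_right _ _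
  refine ⟨M, Nat.mul_pos Module.finrank_pos (Finset.prod_pos fun i _ ↦ hn i), ?_⟩
  rw [twist_comp_zero, res_comp, ← res_twist_phi]
  congr 1
  refine D.sec_ext_tr _ fun i hi ↦ ?_
  rw [D.res_tr_phi, add_comm, D.res_tr_add _ _ hM, ← res_comp _ (twist s ι K h' 0)]
  exact H i hi M hM ((Finset.dvd_prod_of_mem n (Finset.mem_range.2 hi)).mul_left _)

end Unit

end WeilEtale

/-! ### The coinvariants of the Frobenius on `γ^* G` are `G ⊗ ℚ` -/

namespace WeilEtale

lemma exists_of_bind {C : Type u} [SmallCategory C] {J : GrothendieckTopology C} {U : C}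
    {p : ∀ ⦃W : C⦄, (W ⟶ U) → Prop} {T : Sieve U} (hT : T ∈ J U)
    (h : ∀ ⦃W⦄ (f : W ⟶ U), T f → ∃ T' ∈ J W, ∀ ⦃W'⦄ (g : W' ⟶ W), T' g → p (g ≫ f)) :
    ∃ T' ∈ J U, ∀ ⦃W⦄ (f : W ⟶ U), T' f → p f := by
  choose R hR hp using h
  refine ⟨_, J.bind_covering hT (R := R) hR, ?_⟩
  rintro W _ ⟨Y, g, f, hf, hg, rfl⟩
  exact hp f hf g hg

section Coinvariants

variable {k : Type u} [Field k] [Fintype k]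
  {S : Scheme.{u}} {s : S ⟶ Spec (.of k)} {E : Type u} [SmallCategory E] {ι : E ⥤ Over S}
  {K : Type u} [Field K] [Algebra k K] [IsAlgClosure k K]
variable [hE : IsEtaleFamily s ι]

open Opposite

/-- The morphism `φ - 1`. -/
noncomputable def frobSubOne (F : WeilSheaf s ι K) :
    (barPush s ι K).obj F ⟶ (barPush s ι K).obj F :=
  (frobPush s ι K).app F - 𝟙 _

lemma frobSubOne_naturality {F F' : WeilSheaf s ι K} (α : F ⟶ F') :
    frobSubOne F ≫ (barPush s ι K).map α = (barPush s ι K).map α ≫ frobSubOne F' := by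
  rw [frobSubOne, frobSubOne, Preadditive.sub_comp, Preadditive.comp_sub, NatTrans.naturality,
    Category.id_comp, Category.comp_id]

lemma ev_frobSubOne (F : WeilSheaf s ι K) {V : E} (x : Sec F.obj (barObj s ι K V)) :
    ev (frobSubOne F).hom V x = phi F V 1 x - x := rfl

lemma gammaIncl_frobSubOne (F : WeilSheaf s ι K) : gammaIncl F ≫ frobSubOne F = 0 := by
  rw [frobSubOne, Preadditive.comp_sub, gammaIncl_frobPush, Category.comp_id, sub_self]

lemma gammaIncl_exact (F : WeilSheaf s ι K) :
    (ShortComplex.mk _ _ (gammaIncl_frobSubOne F)).Exact :=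
  ShortComplex.exact_of_f_is_kernel _ (KernelFork.IsLimit.ofι _ _
    (fun α hα ↦ Fork.IsLimit.lift (equalizerAppIsLimit (frobPush s ι K) F) α
      (sub_eq_zero.1 ((Preadditive.comp_sub α _ _).symm.trans hα)))
    (fun _ _ ↦ Fork.IsLimit.lift_ι' _ _ _)
    (fun α _ _ hm ↦ (cancel_mono (gammaIncl F)).1 (hm.trans
      (Fork.IsLimit.lift_ι' (equalizerAppIsLimit (frobPush s ι K) F) α _).symm)))

/-- The coinvariants. -/
noncomputable def coinv (F : WeilSheaf s ι K) : EtaleSheaf ι := cokernel (frobSubOne F)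

/-- The projection to the coinvariants. -/
noncomputable def coinvProj (F : WeilSheaf s ι K) : (barPush s ι K).obj F ⟶ coinv F :=
  cokernel.π (frobSubOne F)

instance (F : WeilSheaf s ι K) : Epi (coinvProj F) := inferInstanceAs (Epi (cokernel.π _))

lemma frobSubOne_coinvProj (F : WeilSheaf s ι K) : frobSubOne F ≫ coinvProj F = 0 :=
  cokernel.condition _

/-- The map on coinvariants. -/
noncomputable def coinvMap {F F' : WeilSheaf s ι K} (α : F ⟶ F') : coinv F ⟶ coinv F' :=
  cokernel.map _ _ _ _ (frobSubOne_naturality α)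

lemma coinvProj_naturality {F F' : WeilSheaf s ι K} (α : F ⟶ F') :
    coinvProj F ≫ coinvMap α = (barPush s ι K).map α ≫ coinvProj F' :=
  cokernel.π_desc _ _ _

/-- The class of a section in the coinvariants. -/
noncomputable def cl (F : WeilSheaf s ι K) (V : E) :
    Sec F.obj (barObj s ι K V) →+ Sec (coinv F).obj V :=
  ev (coinvProj F).hom V

lemma exists_cl_eq (F : WeilSheaf s ι K) {V : E} (c : Sec (coinv F).obj V) :
    ∃ T ∈ etaleTopology ι V, ∀ ⦃W⦄ (f : W ⟶ V), T f → ∃ x, cl F W x = res _ f c :=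
  exists_of_epi (coinvProj F) c

lemma exists_of_cl_eq_zero (F : WeilSheaf s ι K) {V : E} (x : Sec F.obj (barObj s ι K V))
    (hx : cl F V x = 0) : ∃ T ∈ etaleTopology ι V, ∀ ⦃W⦄ (f : W ⟶ V), T f →
      ∃ z, phi F W 1 z - z = res F.obj (twist s ι K f 0) x :=
  exists_of_exact (S := ShortComplex.mk _ _ (frobSubOne_coinvProj F))
    (ShortComplex.exact_cokernel _) x hx

lemma cl_phi_sub (F : WeilSheaf s ι K) {V : E} (z : Sec F.obj (barObj s ι K V)) :
    cl F V (phi F V 1 z - z) = 0 :=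
  congrArg (fun c : (barPush s ι K).obj F ⟶ coinv F ↦ ev c.hom V z) (frobSubOne_coinvProj F)

lemma cl_phi (F : WeilSheaf s ι K) {V : E} (n : ℕ) (z : Sec F.obj (barObj s ι K V)) :
    cl F V (phi F V n z) = cl F V z := by
  induction n with
  | zero => simp
  | succ n ih =>
    have := cl_phi_sub F (phi F V n z)
    rw [map_sub, sub_eq_zero, ih, ← phi_add, add_comm] at this
    exact_mod_cast this

lemma cl_trace (F : WeilSheaf s ι K) {V : E} (n : ℕ) (z : Sec F.obj (barObj s ι K V)) :
    cl F V (trace F V n z) = n • cl F V z := by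
  rw [trace_apply, map_sum, Finset.sum_congr rfl (fun (i : ℕ) _ ↦ cl_phi F i z),
    Finset.sum_const, Finset.card_range]

lemma cl_res (F : WeilSheaf s ι K) {V W : E} (f : W ⟶ V) (z : Sec F.obj (barObj s ι K V)) :
    cl F W (res F.obj (twist s ι K f 0) z) = res (coinv F).obj f (cl F V z) :=
  ev_res (coinvProj F).hom f z

variable (G : EtaleSheaf ι)

/-- If locally `y = φ z - z` and `φ^n z = z`, taking traces gives `n y = φ^n z - z = 0`. -/
lemma exists_nsmul_eq_zero_of_coinv {V : E} (y : Sec G.obj V)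
    (hy : cl _ V (hatSec (s := s) (K := K) G y) = 0) :
    ∃ T ∈ etaleTopology ι V, ∀ ⦃W⦄ (f : W ⟶ V), T f → ∃ n : ℕ, 0 < n ∧ n • res G.obj f y = 0 := by
  obtain ⟨T, hT, h⟩ := exists_of_cl_eq_zero _ _ hy
  refine exists_of_bind hT fun W f hf ↦ ?_
  obtain ⟨z, hz⟩ := h f hf
  obtain ⟨T', hT', h'⟩ := exists_phi_eq G z
  refine ⟨T', hT', fun W' g hg ↦ ?_⟩
  obtain ⟨n, hn, hn'⟩ := h' g hg
  refine ⟨n, hn, eq_zero_of_hatSec (s := s) (K := K) G _ ?_⟩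
  rw [map_nsmul, ← trace_of_phi_one _ _ _ (phi_hatSec G _ 1), res_comp, hatSec_res, hatSec_res,
    ← hz, map_sub, res_twist_phi, trace_phi_sub, hn', sub_self]

/-- If `φ^n x = x`, then `n` times the class of `x` is the class of its trace, which is invariant
and therefore comes locally from `G`. -/
lemma exists_nsmul_eq_of_coinv {V : E} (c : Sec (coinv ((gammaPull s ι K).obj G)).obj V) :
    ∃ T ∈ etaleTopology ι V, ∀ ⦃W⦄ (f : W ⟶ V), T f → ∃ n : ℕ, 0 < n ∧ ∃ y,
      cl _ W (hatSec (s := s) (K := K) G y) = n • res _ f c := by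
  obtain ⟨T, hT, h⟩ := exists_cl_eq _ c
  refine exists_of_bind hT fun W f hf ↦ ?_
  obtain ⟨x, hx⟩ := h f hf
  obtain ⟨T', hT', h'⟩ := exists_phi_eq G x
  refine exists_of_bind hT' fun W' g hg ↦ ?_
  obtain ⟨n, hn, hn'⟩ := h' g hg
  obtain ⟨T'', hT'', h''⟩ := exists_hatSec_eq G _ (phi_trace _ _ n hn')
  refine ⟨T'', hT'', fun W'' l hl ↦ ?_⟩
  obtain ⟨y, hy⟩ := h'' l hl
  refine ⟨n, hn, y, ?_⟩
  rw [hy, cl_res, cl_trace, cl_res, map_nsmul, hx, res_comp, res_comp]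

/-- Let `n x = φ z - z`, with `x` and `z` fixed by `φ^a` and `φ^b`. Cut `V̄` into `N = m n a b`
pieces. The trace of `x` of length `N` is `m` times the trace of length `a b` of `n x`, that is `m
(φ^{ab} z - z) = 0`, and a section of trace zero has trivial class. -/
lemma eq_zero_of_nsmul_coinv {V : E} (c : Sec (coinv ((gammaPull s ι K).obj G)).obj V)
    {n : ℕ} (hn : 0 < n) (hc : n • c = 0) : c = 0 := by
  obtain ⟨T, hT, h⟩ := exists_cl_eq _ c
  refine sec_ext (coinv _).property hT fun W f hf ↦ ?_
  obtain ⟨x, hx⟩ := h f hf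
  rw [map_zero, ← hx]
  obtain ⟨T, hT, h⟩ := exists_of_cl_eq_zero _ (n • x) (by
    rw [map_nsmul, hx, ← map_nsmul, hc, map_zero])
  refine sec_ext (coinv _).property hT fun W' f' hf' ↦ ?_
  obtain ⟨z, hz⟩ := h f' hf'
  rw [map_zero, ← cl_res]
  generalize hx' : res _ (twist s ι K f' 0) x = x'
  rw [map_nsmul, hx'] at hz
  obtain ⟨T, hT, h⟩ := exists_phi_eq G x'
  refine sec_ext (coinv _).property hT fun W₂ f₂ hf₂ ↦ ?_
  obtain ⟨a, ha, ha'⟩ := h f₂ hf₂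
  rw [map_zero, ← cl_res]
  replace hz := congrArg (res _ (twist s ι K f₂ 0)) hz
  rw [map_nsmul, map_sub, res_twist_phi] at hz
  generalize res _ (twist s ι K f₂ 0) x' = x'' at *
  generalize res _ (twist s ι K f₂ 0) z = z' at *
  obtain ⟨T, hT, h⟩ := exists_phi_eq G z'
  refine sec_ext (coinv _).property hT fun W₃ f₃ hf₃ ↦ ?_
  obtain ⟨b, hb, hb'⟩ := h f₃ hf₃
  rw [map_zero, ← cl_res]
  replace hz := congrArg (res _ (twist s ι K f₃ 0)) hz
  replace ha' := congrArg (res _ (twist s ι K f₃ 0)) ha'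
  rw [map_nsmul, map_sub, res_twist_phi] at hz
  rw [res_twist_phi] at ha'
  generalize res _ (twist s ι K f₃ 0) x'' = x₃ at *
  generalize res _ (twist s ι K f₃ 0) z' = z₃ at *
  -- Only the divisibility of the number of pieces matters here, hence the maximal sieve.
  refine sec_ext (coinv _).property (Level.splitSieve_mem (s := s) (K := K) (T := ⊤) (GrothendieckTopology.top_mem _ _)
    (n * (a * b)) (by positivity)) ?_
  rintro W₄ _ ⟨D, g, h', rfl, ⟨m, hm⟩, -⟩
  rw [map_zero, ← cl_res, twist_comp_zero, res_comp, cl_res]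
  replace hz := congrArg (res _ (twist s ι K h' 0)) hz
  replace ha' := congrArg (res _ (twist s ι K h' 0)) ha'
  replace hb' := congrArg (res _ (twist s ι K h' 0)) hb'
  rw [map_nsmul, map_sub, res_twist_phi] at hz
  rw [res_twist_phi] at ha' hb'
  generalize res _ (twist s ι K h' 0) x₃ = x₄ at *
  generalize res _ (twist s ι K h' 0) z₃ = z₄ at *
  obtain ⟨w, rfl⟩ := D.exists_phi_sub _ x₄ (by
    have e : D.N = (m * n) * (a * b) := by rw [hm]; ring
    have ha'' := phi_mul_eq ha' b
    rw [mul_comm] at ha''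
    rw [e, trace_mul _ _ _ _ ha'', mul_smul, ← map_nsmul, ← hz, trace_phi_sub,
      phi_mul_eq hb' a, sub_self, smul_zero])
  rw [cl_phi_sub, map_zero]

/-- Let `x` be fixed by `φ^a`, let `t` be its trace of length `a`, and cut `V̄` into `N = n m a`
pieces. The section `w` equal to `m t` on one piece and to zero on the others has trace `m t`; so `n
w` and `x` have the same trace of length `N`, and hence the same class. -/
lemma exists_eq_nsmul_coinv {V : E} (c : Sec (coinv ((gammaPull s ι K).obj G)).obj V)
    {n : ℕ} (hn : 0 < n) : ∃ T ∈ etaleTopology ι V, ∀ ⦃W⦄ (f : W ⟶ V), T f →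
      ∃ c', n • c' = res _ f c := by
  obtain ⟨T, hT, h⟩ := exists_cl_eq _ c
  refine exists_of_bind hT fun W f hf ↦ ?_
  obtain ⟨x, hx⟩ := h f hf
  obtain ⟨T', hT', h'⟩ := exists_phi_eq G x
  refine exists_of_bind hT' fun W' f' hf' ↦ ?_
  obtain ⟨a, ha, ha'⟩ := h' f' hf'
  refine ⟨_, Level.splitSieve_mem (s := s) (K := K) (T := ⊤) (GrothendieckTopology.top_mem _ _)
    (n * a) (by positivity), ?_⟩
  rintro W₂ _ ⟨D, g, h', rfl, ⟨m, hm⟩, -⟩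
  have hx' : cl _ _ (res _ (twist s ι K h' 0)
      (res _ (twist s ι K f' 0) x)) = res _ (h' ≫ f' ≫ f) c := by
    rw [cl_res, cl_res, res_comp, res_comp, hx]
  replace ha' := congrArg (res _ (twist s ι K h' 0)) ha'
  rw [res_twist_phi] at ha'
  generalize res _ (twist s ι K h' 0) (res _ (twist s ι K f' 0) x) = y at *
  have ht := phi_trace _ _ _ ha'
  generalize ht' : trace _ _ a y = t at *
  obtain ⟨w, hw⟩ := D.exists_glue_tr _ fun i ↦ if i = 0 then res _ (D.tr 0) (m • t) else 0
  have hw0 : res _ (D.tr 0) w = res _ (D.tr 0) (m • t) := by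
    have := hw 0 Module.finrank_pos
    rwa [if_pos rfl, Nat.cast_zero] at this
  have hmt : phi _ _ 1 (m • t) = m • t := by rw [map_nsmul, ht]
  have hwN : phi _ _ D.N w = w := by
    refine D.sec_ext_tr _ fun i hi ↦ ?_
    rw [D.res_tr_phi, add_comm, D.res_tr_add _ _ dvd_rfl]
    by_cases h0 : i = 0
    · subst h0
      rw [Nat.cast_zero, hw0, ← D.res_tr_add, add_comm, ← D.res_tr_phi, phi_eq_of_one hmt]
    · rw [hw i hi, if_neg h0, map_zero]
  have hwt : trace _ _ D.N w = m • t := by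
    refine D.eq_of_res_tr_zero _ (phi_trace _ _ _ hwN) hmt ?_
    rw [trace_apply, map_sum, Finset.sum_eq_single_of_mem 0
      (Finset.mem_range.2 Module.finrank_pos), Nat.cast_zero, phi_zero, hw0]
    intro i hi h0
    rw [D.res_tr_phi, zero_add, hw i (Finset.mem_range.1 hi), if_neg h0]
  obtain ⟨z, hz⟩ := D.exists_phi_sub _ (n • w - y) (by
    have e : D.N = (n * m) * a := by rw [hm]; ring
    rw [map_sub, map_nsmul, hwt, e, trace_mul _ _ _ _ ha', ht', mul_smul, sub_self])
  refine ⟨res _ g (cl _ _ w), ?_⟩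
  have h1 := cl_phi_sub _ z
  rw [hz, map_sub, map_nsmul, sub_eq_zero, hx'] at h1
  rw [← map_nsmul, h1, ← res_comp]
  simp only [Category.assoc]

/-- Multiplication by `n` is bijective only locally by the two lemmas above; it is thus an
isomorphism of sheaves, and so bijective on all sections. -/
lemma uniquelyDivisible_coinv : UniquelyDivisible (coinv ((gammaPull s ι K).obj G)) := by
  intro V n hn
  let α : coinv ((gammaPull s ι K).obj G) ⟶ coinv ((gammaPull s ι K).obj G) :=
    ⟨homOfSec (fun V ↦ nsmulAddMonoidHom n) (fun f x ↦ (map_nsmul _ _ _).symm)⟩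
  have : IsIso α := isIso_of_locally α (fun U x hx ↦ eq_zero_of_nsmul_coinv G x hn hx)
    (fun U y ↦ exists_eq_nsmul_coinv G y hn)
  exact bijective_of_isIso α V

/-- The functor `G ↦ coinv (γ^* G)`. -/
noncomputable def gammaCoinv : EtaleSheaf ι ⥤ EtaleSheaf ι where
  obj G := coinv ((gammaPull s ι K).obj G)
  map f := coinvMap ((gammaPull s ι K).map f)
  map_id _ := by
    rw [← cancel_epi (coinvProj _), coinvProj_naturality]
    simp
  map_comp f g := by
    rw [← cancel_epi (coinvProj _), coinvProj_naturality, reassoc_of% coinvProj_naturality,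
      coinvProj_naturality]
    simp

variable (s ι K) in
/-- The projection to the coinvariants. -/
noncomputable def toGammaCoinv :
    gammaPull s ι K ⋙ barPush s ι K ⟶ gammaCoinv (s := s) (ι := ι) (K := K) where
  app _ := coinvProj _
  naturality _ _ f := (coinvProj_naturality ((gammaPull s ι K).map f)).symm

variable (s ι K) in
/-- The canonical morphism from `G` to the push-forward of `γ^* G`. -/
noncomputable def hatNat : 𝟭 (EtaleSheaf ι) ⟶ gammaPull s ι K ⋙ barPush s ι K where
  app G := hat G
  naturality _ _ f := hat_naturality f

instance : IsIso ((tensorQ (etaleTopology ι)).map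
    (hat G ≫ coinvProj ((gammaPull s ι K).obj G))) :=
  isIso_tensorQ_map _ (fun _ y hy ↦ exists_nsmul_eq_zero_of_coinv (s := s) (K := K) G y hy)
    (fun _ c ↦ exists_nsmul_eq_of_coinv (s := s) (K := K) G c)

variable (s ι K) in
/-- The isomorphism between the coinvariants of `γ^* G` and `G ⊗ ℚ`. -/
noncomputable def gammaCoinvIso :
    gammaCoinv (s := s) (ι := ι) (K := K) ≅ tensorQ (etaleTopology ι) :=
  have (G : EtaleSheaf ι) : IsIso ((Functor.whiskerLeft (gammaCoinv (s := s) (ι := ι) (K := K))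
      (toTensorQ (etaleTopology ι))).app G) :=
    (uniquelyDivisible_coinv (s := s) (K := K) G).isIso
  have (G : EtaleSheaf ι) : IsIso ((Functor.whiskerRight (hatNat s ι K ≫ toGammaCoinv s ι K)
      (tensorQ (etaleTopology ι))).app G) :=
    inferInstanceAs (IsIso ((tensorQ (etaleTopology ι)).map
      (hat G ≫ coinvProj ((gammaPull s ι K).obj G))))
  have := NatIso.isIso_of_isIso_app (Functor.whiskerLeft (gammaCoinv (s := s) (ι := ι) (K := K))
      (toTensorQ (etaleTopology ι)))
  have := NatIso.isIso_of_isIso_app (Functor.whiskerRight (hatNat s ι K ≫ toGammaCoinv s ι K)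
      (tensorQ (etaleTopology ι)))
  -- `coinv ≅ coinv ⊗ ℚ` by unique divisibility, and `G ⊗ ℚ ≅ coinv ⊗ ℚ` because `G ⟶ coinv` has
  -- torsion kernel and cokernel.
  asIso (Functor.whiskerLeft (gammaCoinv (s := s) (ι := ι) (K := K))
      (toTensorQ (etaleTopology ι))) ≪≫
    (asIso (Functor.whiskerRight (hatNat s ι K ≫ toGammaCoinv s ι K)
      (tensorQ (etaleTopology ι)))).symm

variable (s ι K) in
/-- The projection from the push-forward of `γ^* G` to `G ⊗ ℚ`. -/
noncomputable def barToTensorQ :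
    gammaPull s ι K ⋙ barPush s ι K ⟶ tensorQ (etaleTopology ι) :=
  toGammaCoinv s ι K ≫ (gammaCoinvIso s ι K).hom

/-- Fixes the normalization of the isomorphism with `G ⊗ ℚ`; the effect of the cup product will be
read off from it. -/
lemma hatNat_barToTensorQ :
    hatNat s ι K ≫ barToTensorQ s ι K = toTensorQ (etaleTopology ι) := by
  rw [barToTensorQ, ← Category.assoc, gammaCoinvIso, Iso.trans_hom, Iso.symm_hom, asIso_hom,
    ← Category.assoc, Iso.comp_inv_eq, asIso_hom]
  ext1
  ext1 G
  exact (toTensorQ (etaleTopology ι)).naturality _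

instance : Epi ((barToTensorQ s ι K).app G) := by
  have : Epi ((toGammaCoinv s ι K).app G) := inferInstanceAs (Epi (coinvProj _))
  rw [barToTensorQ, NatTrans.comp_app]
  infer_instance

lemma frobSubOne_barToTensorQ :
    frobSubOne ((gammaPull s ι K).obj G) ≫ (barToTensorQ s ι K).app G = 0 := by
  have : frobSubOne ((gammaPull s ι K).obj G) ≫ (toGammaCoinv s ι K).app G = 0 :=
    frobSubOne_coinvProj _
  rw [barToTensorQ, NatTrans.comp_app, reassoc_of% this, zero_comp]

lemma frobSubOne_barToTensorQ_exact :
    (ShortComplex.mk _ _ (frobSubOne_barToTensorQ (s := s) (K := K) G)).Exact := by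
  let e : ShortComplex.mk _ _ (frobSubOne_coinvProj ((gammaPull s ι K).obj G)) ≅
      ShortComplex.mk _ _ (frobSubOne_barToTensorQ (s := s) (K := K) G) :=
    ShortComplex.isoMk (Iso.refl _) (Iso.refl _) ((gammaCoinvIso s ι K).app G)
      ((Category.id_comp _).trans (Category.comp_id _).symm) (Category.id_comp _)
  exact ShortComplex.exact_of_iso e (ShortComplex.exact_cokernel _)

end Coinvariants

end WeilEtale

namespace WeilEtale

/-! ### Constant sheaves and their pull-back -/

section ConstantSheaf

variable {C : Type u} [SmallCategory C] (J : GrothendieckTopology C) (A : AddCommGrpCat.{u})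

/-- The constant sections of a constant sheaf. -/
noncomputable def constSec (U : C) : A →+ Sec ((constantSheaf J AddCommGrpCat.{u}).obj A).obj U :=
  ev (toSheafify J ((Functor.const _).obj A)) U

variable {J A}

lemma res_constSec {U V : C} (f : U ⟶ V) (a : A) :
    res _ f (constSec J A V a) = constSec J A U a :=
  (ev_res (toSheafify J ((Functor.const _).obj A)) f a).symm

lemma exists_constantSheaf_hom {F : Sheaf J AddCommGrpCat.{u}} (c : ∀ U : C, A →+ Sec F.obj U)
    (hc : ∀ {U V : C} (f : U ⟶ V) (a : A), c U a = res F.obj f (c V a)) :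
    ∃ β : (constantSheaf J AddCommGrpCat.{u}).obj A ⟶ F,
      ∀ (U : C) (a : A), ev β.hom U (constSec J A U a) = c U a := by
  let c' : (Functor.const Cᵒᵖ).obj A ⟶ F.obj := homOfSec c hc
  refine ⟨⟨sheafifyLift J c' F.property⟩, fun U a ↦ ?_⟩
  exact congrArg (fun t : (Functor.const Cᵒᵖ).obj A ⟶ F.obj ↦ ev t U a)
    (toSheafify_sheafifyLift J c' F.property)

lemma constantSheaf_hom_ext {F : Sheaf J AddCommGrpCat.{u}}
    {β β' : (constantSheaf J AddCommGrpCat.{u}).obj A ⟶ F}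
    (h : ∀ (U : C) (a : A), ev β.hom U (constSec J A U a) = ev β'.hom U (constSec J A U a)) :
    β = β' := by
  ext : 1
  exact sheafify_hom_ext J _ _ F.property (ev_ext h)

end ConstantSheaf

section LevelCover

variable {k : Type u} [Field k] [Fintype k]
  {S : Scheme.{u}} {s : S ⟶ Spec (.of k)} {E : Type u} [SmallCategory E] {ι : E ⥤ Over S}
  {K : Type u} [Field K] [Algebra k K] [IsAlgClosure k K]

/-- The inclusion into `V̄`. -/
noncomputable def Geom.incl (U : Geom s ι K) : U ⟶ barObj s ι K U.V where
  deg := 0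
  left := U.toBar ≫ (barIso s ι K U.V).inv
  comp_toK := by
    rw [frobSpec_zero, Category.comp_id, barObj_toK, Category.assoc, Iso.inv_hom_id_assoc]; rfl
  comp_toS := by rw [barObj_toS, Category.assoc, Iso.inv_hom_id_assoc]; rfl

instance (U : Geom s ι K) : IsOpenImmersion (Geom.left U.incl) :=
  inferInstanceAs (IsOpenImmersion (U.Z.ι ≫ (barIso s ι K U.V).inv))

lemma Geom.barIso_incl (U : Geom s ι K) (v : U.scheme) :
    (barIso s ι K U.V).hom (Geom.left U.incl v) = U.Z.ι v := by
  have : Geom.left U.incl ≫ (barIso s ι K U.V).hom = U.Z.ι := by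
    change (U.toBar ≫ _) ≫ _ = _
    rw [Category.assoc, Iso.inv_hom_id, Category.comp_id]
    rfl
  rw [← this]
  rfl

/-- The complement. -/
abbrev Geom.compl (U : Geom s ι K) : Geom s ι K where
  V := U.V
  Z := ⟨(U.Z : Set (bar s ι K U.V))ᶜ, U.isClosed.isOpen_compl⟩
  isClosed := U.Z.isOpen.isClosed_compl

variable [hE : IsEtaleFamily s ι]

/-- `U` and its complement cover `V̄`. This covering is refined by pieces, and near a point of `U`
such a piece has to factor through `U`. -/
lemma exists_level_mem_geom (U : Geom s ι K) :
    ∃ T ∈ weilTopology s ι K U, ∀ ⦃W⦄ (f : W ⟶ U), T f →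
      ∃ (D : Level s ι K) (g : W ⟶ D.geom) (h : D.geom ⟶ U), g ≫ h = f := by
  let T : Sieve U :=
    { arrows := fun W f ↦ ∃ (D : Level s ι K) (g : W ⟶ D.geom) (h : D.geom ⟶ U), g ≫ h = f
      downward_closed := by
        rintro W W' _ ⟨D, g, h, rfl⟩ l
        exact ⟨D, l ≫ g, h, Category.assoc _ _ _⟩ }
  refine ⟨T, mem_weilTopology fun v ↦ ?_, fun W f hf ↦ hf⟩
  have hmem (W : Geom s ι K) (w : W.scheme) :
      (barIso s ι K W.V).hom (Geom.left W.incl w) ∈ W.Z := by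
    rw [Geom.barIso_incl]
    exact w.2
  let T₀ : Sieve (barObj s ι K U.V) :=
    Sieve.generate (Presieve.singleton U.incl) ⊔ Sieve.generate (Presieve.singleton U.compl.incl)
  have hT₀ : T₀ ∈ weilTopology s ι K (barObj s ι K U.V) := by
    refine mem_weilTopology fun x ↦ ?_
    by_cases hx : (barIso s ι K U.V).hom x ∈ U.Z
    · refine ⟨U, U.incl, Or.inl ⟨_, 𝟙 _, _, Presieve.singleton_self _, Category.id_comp _⟩,
        inferInstance, ⟨_, hx⟩, ?_⟩
      apply (barIso s ι K U.V).hom.isOpenEmbedding.injective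
      exact Geom.barIso_incl U _
    · refine ⟨U.compl, U.compl.incl,
        Or.inr ⟨_, 𝟙 _, _, Presieve.singleton_self _, Category.id_comp _⟩, inferInstance,
        ⟨_, hx⟩, ?_⟩
      apply (barIso s ι K U.V).hom.isOpenEmbedding.injective
      exact Geom.barIso_incl U.compl _
  have := Level.botTr_surjective (s := s) (ι := ι) (K := K) U.V 0
  obtain ⟨z, hz⟩ := (Geom.left ((Level.botTr s ι K U.V 0))).surjective (Geom.left U.incl v)
  obtain ⟨D, m, i, ⟨z', hz'⟩, hT⟩ := (Level.bot s ι K U.V).exists_map_mem hT₀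
    ((Level.botTr s ι K U.V 0)) z
  have hv : Geom.left (Level.map m ≫ (Level.botTr s ι K U.V 0)) z' = Geom.left U.incl v := by
    rw [← hz, ← hz']
    rfl
  have het : Etale (Geom.left (Level.map m ≫ (Level.botTr s ι K U.V 0))) := by
    have e : Level.map m ≫ Level.botTr s ι K U.V 0 = D.tr 0 ≫ twist s ι K m.f 0 := Level.map_tr m 0
    have : Etale (Geom.left (twist s ι K m.f 0)) :=
      MorphismProperty.of_isPullback (barObj_isPullback s ι K m.f).flip i
    rw [e, Geom.left_comp]
    infer_instance
  obtain ⟨_, g, _, ⟨⟩, hg⟩ | ⟨_, g, _, ⟨⟩, hg⟩ := hT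
  · rw [← hg] at hv het
    refine ⟨D.geom, g, ⟨D, 𝟙 _, g, Category.id_comp _⟩, ?_, z', ?_⟩
    · have : Etale (Geom.left g ≫ Geom.left U.incl) := het
      exact Etale.of_comp _ (Geom.left U.incl)
    · exact (Geom.left U.incl).isOpenEmbedding.injective hv
  · rw [← hg] at hv
    have h₁ := hmem U.compl (Geom.left g z')
    have h₂ : Geom.left U.compl.incl (Geom.left g z') = Geom.left U.incl v := hv
    rw [h₂] at h₁
    exact (h₁ (hmem U v)).elim

/-- The pull-back of a constant sheaf is constant. -/
lemma nonempty_gammaPull_constantSheaf_iso (A : AddCommGrpCat.{u}) :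
    Nonempty ((gammaPull s ι K).obj ((constantSheaf (etaleTopology ι) AddCommGrpCat.{u}).obj A) ≅
      (constantSheaf (weilTopology s ι K) AddCommGrpCat.{u}).obj A) := by
  let G := (constantSheaf (etaleTopology ι) AddCommGrpCat.{u}).obj A
  let F := (constantSheaf (weilTopology s ι K) AddCommGrpCat.{u}).obj A
  let c (V : E) : A →+ Sec ((gammaPull s ι K).obj G).obj (barObj s ι K V) :=
    (hatSec G).comp (constSec (etaleTopology ι) A V)
  have hc {V W : E} (f : W ⟶ V) (a : A) : res _ (twist s ι K f 0) (c V a) = c W a := by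
    change res _ _ (hatSec G (constSec _ _ _ _)) = hatSec G (constSec _ _ _ _)
    rw [← hatSec_res, res_constSec]
  have hc' {V : E} (n : ℤ) (a : A) : phi _ V n (c V a) = c V a := phi_hatSec G _ _
  -- After a finite extension `g` is a translate followed by a morphism of `E`, and both preserve
  -- the constant sections.
  have key (D : Level s ι K) {V : E} (g : D.geom ⟶ barObj s ι K V) (a : A) :
      res _ g (c V a) = res _ (D.tr 0) (c D.V a) := by
    obtain ⟨D', m, h, -, -, _, e⟩ := D.exists_factor_geom g
    rw [← res_id (F := ((gammaPull s ι K).obj G).obj) (res _ g (c V a)),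
      ← res_id (F := ((gammaPull s ι K).obj G).obj) (res _ (D.tr 0) (c D.V a)),
      ← IsIso.inv_hom_id (Level.map m), res_comp, res_comp]
    congr 1
    rw [← res_comp, ← res_comp, e, Level.map_tr, res_comp, hc, res_comp, hc,
      ← zero_add (Geom.deg g), ← D'.res_tr_phi, hc']
  have key' {U : Geom s ι K} {V V' : E} (p : U ⟶ barObj s ι K V) (p' : U ⟶ barObj s ι K V')
      (a : A) : res _ p (c V a) = res _ p' (c V' a) := by
    obtain ⟨T, hT, h⟩ := exists_level_mem_geom U
    refine sec_ext ((gammaPull s ι K).obj G).property hT fun W f hf ↦ ?_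
    obtain ⟨D, g, l, rfl⟩ := h f hf
    rw [res_comp, res_comp]
    congr 1
    rw [← res_comp, ← res_comp, key D (l ≫ p), key D (l ≫ p')]
  -- The use of `U.incl` is no real choice: by `key'` all morphisms from `U` to base changes give
  -- the same section.
  obtain ⟨β', hβ'⟩ := exists_constantSheaf_hom (J := weilTopology s ι K) (A := A)
    (F := (gammaPull s ι K).obj G) (fun U ↦ (res _ U.incl).comp (c U.V)) (fun {U V} f a ↦ by
      change res _ _ _ = res _ f (res _ _ _)
      rw [← res_comp]
      exact key' _ _ _)
  obtain ⟨α, hα⟩ := exists_constantSheaf_hom (J := etaleTopology ι) (A := A)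
    (F := (barPush s ι K).obj F) (fun V ↦ constSec (weilTopology s ι K) A (barObj s ι K V))
    (fun {U V} f a ↦ (res_constSec (twist s ι K f 0) a).symm)
  have hα' : α ≫ (frobPush s ι K).app F = α := constantSheaf_hom_ext fun V a ↦ by
    change phi F V 1 (ev α.hom V (constSec _ A V a)) = _
    rw [hα]
    exact res_constSec _ a
  obtain ⟨β, hβ⟩ := exists_gammaPull_hom α hα'
  have hβ'' (V : E) (a : A) : ev β.hom _ (c V a) = constSec _ A _ a :=
    Eq.trans (congrArg (fun t : G ⟶ (barPush s ι K).obj F ↦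
      ev t.hom V (constSec (etaleTopology ι) A V a)) hβ) (hα V a)
  have e₁ : β' ≫ β = 𝟙 F := constantSheaf_hom_ext fun U a ↦ by
    change ev β.hom U (ev β'.hom U _) = _
    rw [hβ']
    change ev β.hom U (res _ U.incl (c U.V a)) = _
    rw [ev_res, hβ'']
    exact res_constSec _ a
  have e₂ : β ≫ β' = 𝟙 _ := by
    apply gammaPull_hom_ext
    refine constantSheaf_hom_ext fun V a ↦ ?_
    change ev β'.hom _ (ev β.hom _ (c V a)) = c V a
    rw [hβ'', hβ']
    change res _ _ _ = _
    rw [key' _ (𝟙 (barObj s ι K V)), res_id]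
  exact ⟨⟨β, β', e₂, e₁⟩⟩

end LevelCover

end WeilEtale

namespace WeilEtale

/-! ### Total right derived functors from functorial adapted resolutions -/

section DerivedExistence

open DerivedCategory

universe v₁ v₂ u₁ u₂
variable {A : Type u₁} [Category.{v₁} A] [Abelian A] {B : Type u₂} [Category.{v₂} B] [Abelian B]
  {F : A ⥤ B} [F.Additive]

variable (F) in
/-- A class of complexes, stable under shifts, in which every complex has a functorial resolution
and between members of which `F` preserves quasi-isomorphisms. -/
structure AdaptedResolution where
  prop : ObjectProperty (CochainComplex A ℤ)
  isStableUnderShift : prop.IsStableUnderShift ℤ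
  functor : CochainComplex A ℤ ⥤ CochainComplex A ℤ
  hom : 𝟭 _ ⟶ functor
  prop_obj (M) : prop (functor.obj M)
  quasiIso_hom_app (M) : QuasiIso (hom.app M)
  quasiIso_map {M N : CochainComplex A ℤ} (f : M ⟶ N) : prop M → prop N → QuasiIso f →
    QuasiIso ((F.mapHomologicalComplex (ComplexShape.up ℤ)).map f)

/-- Compatibility with shifts is transported from the resolutions along naturality squares; for this
it is enough that `G₂` inverts the resolution morphisms. -/
lemma commShift_of_resolutions {C₀ C D : Type*} [Category* C₀] [Category* C] [Category* D]
    {M : Type*} [AddMonoid M] [HasShift C₀ M] [HasShift C M] [HasShift D M] {G₁ G₂ : C ⥤ D}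
    [G₁.CommShift M] [G₂.CommShift M] (α : G₁ ⟶ G₂) (ι : C₀ ⥤ C) [ι.CommShift M]
    [hα : NatTrans.CommShift (Functor.whiskerLeft ι α) M]
    (hι : ∀ X : C, ∃ (Y : C₀) (f : X ⟶ ι.obj Y), IsIso (G₂.map f)) :
    NatTrans.CommShift α M := by
  refine ⟨fun a ↦ NatTrans.ext (funext fun X ↦ ?_)⟩
  obtain ⟨Y, f, hf⟩ := hι X
  have h := NatTrans.congr_app (hα.shift_comm a) Y
  simp only [NatTrans.comp_app, Functor.whiskerRight_app, Functor.whiskerLeft_app,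
    Functor.commShiftIso_comp_hom_app, Category.assoc, Functor.comp_obj] at h
  have h₁ := G₁.commShiftIso_hom_naturality f a
  have h₂ := G₂.commShiftIso_hom_naturality f a
  have h₃ := α.naturality (f⟦a⟧')
  have h₄ := congrArg (fun g ↦ g⟦a⟧') (α.naturality f)
  simp only [Functor.map_comp] at h₄
  have h' : (G₁.commShiftIso a).hom.app (ι.obj Y) ≫ (α.app (ι.obj Y))⟦a⟧' =
      α.app ((ι.obj Y)⟦a⟧) ≫ (G₂.commShiftIso a).hom.app (ι.obj Y) := by
    rw [← cancel_epi (G₁.map ((ι.commShiftIso a).hom.app Y)), h]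
    exact (α.naturality_assoc ((ι.commShiftIso a).hom.app Y) _).symm
  simp only [NatTrans.comp_app, Functor.whiskerRight_app, Functor.whiskerLeft_app]
  rw [← cancel_mono ((G₂.map f)⟦a⟧'), Category.assoc, ← h₄, ← reassoc_of% h₁, h', reassoc_of% h₃,
    Category.assoc]
  exact congrArg (α.app _ ≫ ·) h₂

namespace AdaptedResolution

variable (r : AdaptedResolution F)

/-- The quasi-isomorphisms between complexes of the class. -/
abbrev quasiIsoProp : MorphismProperty r.prop.FullSubcategory :=
  (HomologicalComplex.quasiIso A (ComplexShape.up ℤ)).inverseImage r.prop.ι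

/-- The inclusion of the class of complexes, as a morphism of localizers. -/
abbrev localizer :
    LocalizerMorphism r.quasiIsoProp (HomologicalComplex.quasiIso A (ComplexShape.up ℤ)) where
  functor := r.prop.ι
  map := le_rfl

/-- The resolution functor, with values in the class of complexes. -/
abbrev lift : CochainComplex A ℤ ⥤ r.prop.FullSubcategory := r.prop.lift r.functor r.prop_obj

/-- The resolution, with values in the class of complexes. -/
abbrev liftHom : 𝟭 _ ⟶ r.lift ⋙ r.localizer.functor where
  app M := r.hom.app M
  naturality _ _ f := r.hom.naturality f

lemma isRightDerivabilityStructure : r.localizer.IsRightDerivabilityStructure :=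
  r.localizer.isRightDerivabilityStructure_of_functorial_resolutions r.liftHom
    r.quasiIso_hom_app rfl

lemma isLocalizedEquivalence : r.localizer.IsLocalizedEquivalence :=
  r.localizer.isLocalizedEquivalence_of_functorial_right_resolutions r.liftHom
    r.quasiIso_hom_app rfl

variable [HasDerivedCategory.{w₁} A] [HasDerivedCategory.{w₂} B]

lemma derives : r.localizer.Derives (F.mapHomologicalComplex _ ⋙ Q (C := B)) := by
  intro M N f hf
  have := r.quasiIso_map f.hom M.property N.property hf
  exact inferInstanceAs (IsIso (Q.map ((F.mapHomologicalComplex _).map f.hom)))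

/-- Holds for every total right derived functor, since the universal property alone forces agreement
with `F` on adapted complexes. -/
lemma isIso_unit_app (R : TotalRightDerivedFunctor F) {M : CochainComplex A ℤ} (hM : r.prop M) :
    IsIso (R.unit.app M) := by
  have := r.isRightDerivabilityStructure
  have := R.isRightDerived
  exact r.derives.isIso_of_isRightDerivedFunctor R.unit ⟨M, hM⟩

/-- The derived category is already a localization of the adapted complexes, and `F` descends to it
from there. The unit is `F` applied to the resolution, followed by the comparison on adapted
complexes. -/
lemma nonempty_totalRightDerivedFunctor (r : AdaptedResolution F) :
    Nonempty (TotalRightDerivedFunctor F) := by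
  have := r.isRightDerivabilityStructure
  have := r.isLocalizedEquivalence
  have := r.isStableUnderShift
  let W := r.quasiIsoProp
  let L : r.prop.FullSubcategory ⥤ DerivedCategory A := r.localizer.functor ⋙ Q
  have hL : L.IsLocalization W := LocalizerMorphism.IsLocalizedEquivalence.isLocalization _ _
  let F' : r.prop.FullSubcategory ⥤ DerivedCategory B :=
    r.prop.ι ⋙ F.mapHomologicalComplex _ ⋙ Q
  let R : DerivedCategory A ⥤ DerivedCategory B := Localization.lift F' r.derives L
  let e : L ⋙ R ≅ F' := Localization.Lifting.iso L W F' R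
  let : L.CommShift ℤ := inferInstanceAs ((r.prop.ι ⋙ Q (C := A)).CommShift ℤ)
  let : R.CommShift ℤ := Functor.commShiftOfLocalization L W ℤ F' R
  have he : NatTrans.CommShift e.hom ℤ := NatTrans.commShift_iso_hom_of_localization L W ℤ F' R
  have hi' (M) : IsIso (R.map (Q.map (r.hom.app M))) := by
    have := r.quasiIso_hom_app M
    infer_instance
  have he_nat {M N : r.prop.FullSubcategory} (f : M ⟶ N) :
      e.inv.app M ≫ R.map (Q.map f.hom) =
        Q.map ((F.mapHomologicalComplex _).map f.hom) ≫ e.inv.app N :=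
    (e.inv.naturality f).symm
  let α : F.mapHomologicalComplex (ComplexShape.up ℤ) ⋙ Q ⟶ Q ⋙ R :=
    { app M := Q.map ((F.mapHomologicalComplex _).map (r.hom.app M)) ≫ e.inv.app (r.lift.obj M) ≫
        inv (R.map (Q.map (r.hom.app M)))
      naturality M N f := by
        have h := he_nat (r.lift.map f)
        have h' := r.hom.naturality f
        dsimp at h h' ⊢
        rw [Category.assoc, Category.assoc, ← cancel_mono (R.map (Q.map (r.hom.app N)))]
        simp only [Category.assoc, IsIso.inv_hom_id, Category.comp_id]
        rw [← R.map_comp, ← Q.map_comp, h', Q.map_comp, R.map_comp, IsIso.inv_hom_id_assoc, h,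
          ← Q.map_comp_assoc, ← Functor.map_comp, h', Functor.map_comp, Q.map_comp_assoc] }
  -- On an adapted complex the unit is the comparison isomorphism itself; universality and
  -- compatibility with shifts both reduce to this.
  have hα (M : r.prop.FullSubcategory) : α.app M.obj = e.inv.app M := by
    have h := he_nat (M := M) (N := r.lift.obj M.obj) ⟨r.hom.app M.obj⟩
    dsimp only at h
    rw [← cancel_mono (R.map (Q.map (r.hom.app M.obj)))]
    dsimp only [α]
    rw [Category.assoc, Category.assoc, IsIso.inv_hom_id, Category.comp_id]
    exact h.symm
  refine ⟨{ functor := R, unit := α, isRightDerived := ?_, unit_commShift := ?_ }⟩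
  · refine r.derives.isRightDerivedFunctor_of_isIso α fun M ↦ ?_
    have : α.app (r.localizer.functor.obj M) = e.inv.app M := hα M
    rw [this]
    infer_instance
  · have : NatTrans.CommShift e.inv ℤ := inferInstance
    have h : Functor.whiskerLeft r.prop.ι α = e.inv ≫ (Functor.associator r.prop.ι Q R).hom :=
      NatTrans.ext (funext fun M ↦ (hα M).trans (Category.comp_id _).symm)
    have : NatTrans.CommShift (Functor.whiskerLeft r.prop.ι α) ℤ := by
      rw [h]
      infer_instance
    exact commShift_of_resolutions α r.prop.ι fun M ↦ ⟨r.lift.obj M, r.hom.app M, hi' M⟩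

end AdaptedResolution

end DerivedExistence

end WeilEtale

/-! ### Coinduced sheaves `Hom(ℤ[G], F)` -/

namespace WeilEtale

/-- Invertibility of each `g m` lets the recursion run in both directions from a starting value. It
solves the difference equations below. -/
lemma exists_int_rec {M : Type*} [hM : Nonempty M] (g : ℤ → M ≃ M) :
    ∃ x : ℤ → M, ∀ m, x (m + 1) = g m (x m) := by
  obtain ⟨x₀⟩ := hM
  let a : ℕ → M := fun n ↦ Nat.rec x₀ (fun n x ↦ g n x) n
  let b : ℕ → M := fun n ↦ Nat.rec x₀ (fun n x ↦ (g (-(n + 1 : ℕ))).symm x) n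
  refine ⟨fun m ↦ Int.casesOn m a fun n ↦ b (n + 1), fun m ↦ ?_⟩
  obtain n | n := m
  · rfl
  · obtain _ | n := n
    · exact ((g (-1)).apply_symm_apply x₀).symm
    · exact ((g (-(n + 1 + 1 : ℕ))).apply_symm_apply (b (n + 1))).symm

section SheafSections

variable {C : Type u} [SmallCategory C] {J : GrothendieckTopology C}

lemma epi_of_ev_surjective {F G : Sheaf J AddCommGrpCat.{u}} (a : F ⟶ G)
    (h : ∀ U, Function.Surjective (ev a.hom U)) : Epi a :=
  epi_of_exists a fun U y ↦ ⟨⊤, J.top_mem U, fun _ f _ ↦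
    ⟨res _ f (h U y).choose, by rw [ev_res, (h U y).choose_spec]⟩⟩

lemma exact_of_sec {S : ShortComplex (Sheaf J AddCommGrpCat.{u})}
    (hf : ∀ U, Function.Injective (ev S.f.hom U))
    (h : ∀ U x, ev S.g.hom U x = 0 → ∃ y, ev S.f.hom U y = x) : S.Exact := by
  have hm : Mono S.f := mono_of_ev_injective _ fun U x hx ↦ hf U (hx.trans (map_zero _).symm)
  have key : ∀ {Z : Sheaf J AddCommGrpCat.{u}} (z : Z ⟶ S.X₂) (_ : z ≫ S.g = 0),
      ∃ l, l ≫ S.f = z := by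
    intro Z z hz
    choose y hy using fun U x ↦ h U (ev z.hom U x) (congrArg (fun c ↦ ev c.hom U x) hz)
    refine ⟨⟨homOfSec (fun U ↦ AddMonoidHom.mk' (y U) fun a b ↦ hf U ?_) fun {U V} f x ↦ hf U ?_⟩,
      ?_⟩
    · rw [map_add, hy, hy, hy, map_add]
    · change ev S.f.hom U (y U _) = ev S.f.hom U (res _ f (y V x))
      rw [hy, ev_res, ev_res, hy]
    · ext : 1
      exact ev_ext fun U x ↦ hy U x
  choose l hl using fun (Z : Sheaf J AddCommGrpCat.{u}) z hz ↦ key (Z := Z) z hz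
  exact S.exact_of_f_is_kernel (KernelFork.IsLimit.ofι _ _ (fun {Z} a ha ↦ l Z a ha)
    (fun {Z} a ha ↦ hl Z a ha)
    (fun {Z} a ha m hm' ↦ hm.right_cancellation _ _ (hm'.trans (hl Z a ha).symm)))

end SheafSections

section Coinduced

variable {k : Type u} [Field k] [Fintype k]
  {S : Scheme.{u}} {s : S ⟶ Spec (.of k)} {E : Type u} [SmallCategory E] {ι : E ⥤ Over S}
  {K : Type u} [Field K] [Algebra k K] [IsAlgClosure k K]

/-- The presheaf of families of sections indexed by `ℤ`, on which the `n`-th power of the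
Frobenius acts by `(x_m) ↦ (x_{m - n})`. -/
noncomputable def coindPresheaf (F : (Geom s ι K)ᵒᵖ ⥤ AddCommGrpCat.{u}) :
    (Geom s ι K)ᵒᵖ ⥤ AddCommGrpCat.{u} where
  obj U := .of (ℤ → F.obj U)
  map f := AddCommGrpCat.ofHom (AddMonoidHom.mk'
    (fun x m ↦ F.map f (x (m - Geom.deg f.unop)))
    (fun x y ↦ by ext; simp))
  map_id U := by
    refine AddCommGrpCat.hom_ext (AddMonoidHom.ext fun x ↦ funext fun m ↦ ?_)
    change F.map (𝟙 U) (x (m - 0)) = x m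
    simp
  map_comp {U V W} f g := by
    refine AddCommGrpCat.hom_ext (AddMonoidHom.ext fun x ↦ funext fun m ↦ ?_)
    change F.map (f ≫ g) (x (m - (Geom.deg g.unop + Geom.deg f.unop))) =
      F.map g (F.map f (x (m - Geom.deg g.unop - Geom.deg f.unop)))
    rw [sub_sub]
    simp

/-- Shifting the index by the degree removes the twist in the restriction maps, so that each
component is glued separately in `F`. -/
lemma coindPresheaf_isSheaf (F : WeilSheaf s ι K) :
    Presheaf.IsSheaf (weilTopology s ι K) (coindPresheaf F.obj) := by
  have hF := F.property
  rw [Presheaf.isSheaf_iff_isSheaf_forget (s := CategoryTheory.forget AddCommGrpCat.{u}),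
    isSheaf_iff_isSheaf_of_type] at hF ⊢
  intro X T hT x hx
  rw [Presieve.compatible_iff_sieveCompatible] at hx
  let x' : ∀ ⦃Y⦄ (f : Y ⟶ X), T f → ℤ → F.obj.obj (.op Y) := fun Y f hf ↦ x f hf
  have hx' : ∀ ⦃Y Z⦄ (f : Y ⟶ X) (g : Z ⟶ Y) (hf : T f) (m : ℤ),
    x' (g ≫ f) (T.downward_closed hf g) m = F.obj.map g.op (x' f hf (m - Geom.deg g)) :=
    fun Y Z f g hf m ↦ congrFun (hx f g hf) m
  have key : ∀ m : ℤ, ∃! t : F.obj.obj (.op X), ∀ ⦃Y⦄ (f : Y ⟶ X) (hf : T f),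
      F.obj.map f.op t = x' f hf (m + Geom.deg f) := by
    intro m
    exact hF T hT (fun Y f hf ↦ x' f hf (m + Geom.deg f))
      ((Presieve.compatible_iff_sieveCompatible _).2 fun Y Z f g hf ↦
        (hx' f g hf _).trans (congrArg (fun n ↦ F.obj.map g.op (x' f hf n)) (by
          rw [Geom.deg_comp]; ring)))
  choose t ht ht' using key
  refine ⟨t, fun Y f hf ↦ ?_, fun t' h ↦ ?_⟩
  · change (fun m ↦ F.obj.map f.op (t (m - Geom.deg f))) = x' f hf
    funext m
    rw [ht, sub_add_cancel]
  · funext m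
    refine ht' m (t' m) fun Y f hf ↦ ?_
    have : F.obj.map f.op (t' (m + Geom.deg f - Geom.deg f)) = x' f hf (m + Geom.deg f) :=
      congrFun (h f hf) _
    rwa [add_sub_cancel_right] at this

variable (s ι K)

/-- The functor `F ↦ Hom(ℤ[G], F)`. -/
noncomputable def coind : WeilSheaf s ι K ⥤ WeilSheaf s ι K where
  obj F := ⟨coindPresheaf F.obj, coindPresheaf_isSheaf F⟩
  map {F F'} a := ⟨{
    app U := AddCommGrpCat.ofHom (AddMonoidHom.mk' (fun (x : ℤ → F.obj.obj U) m ↦ a.hom.app U (x m))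
      (fun x y ↦ by ext; simp))
    naturality U V f := by
      refine AddCommGrpCat.hom_ext (AddMonoidHom.ext fun x ↦ ?_)
      funext m
      exact NatTrans.naturality_apply a.hom f (x (m - Geom.deg f.unop)) }⟩
  map_id F := by ext U x; rfl
  map_comp a b := by ext U x; rfl

instance : (coind s ι K).Additive where
  map_add := by intros; ext U x; rfl

/-- The inclusion of the constant families. -/
noncomputable def toCoind : 𝟭 _ ⟶ coind s ι K where
  app F := ⟨{
    app U := AddCommGrpCat.ofHom (AddMonoidHom.mk' (fun (x : F.obj.obj U) (_ : ℤ) ↦ x)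
      (fun _ _ ↦ rfl))
    naturality _ _ _ := rfl }⟩
  naturality _ _ _ := rfl

/-- The difference operator `(x_m) ↦ (x_{m + 1} - x_m)`. -/
noncomputable def coindDiff : coind s ι K ⟶ coind s ι K where
  app F := ⟨{
    app U := AddCommGrpCat.ofHom (AddMonoidHom.mk'
      (fun (x : ℤ → F.obj.obj U) m ↦ x (m + 1) - x m)
      (fun x y ↦ by ext m; simp; abel))
    naturality U V f := by
      refine AddCommGrpCat.hom_ext (AddMonoidHom.ext fun x ↦ ?_)
      funext m
      change F.obj.map f (x (m + 1 - Geom.deg f.unop)) - F.obj.map f (x (m - Geom.deg f.unop)) =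
        F.obj.map f (x (m - Geom.deg f.unop + 1) - x (m - Geom.deg f.unop))
      rw [map_sub]
      congr 4
      ring }⟩
  naturality F F' f := by
    ext U x
    funext m
    exact (map_sub (f.hom.app U).hom _ _).symm

/-- The map `F ⊗ N ⟶ Hom(ℤ[G], F)`. -/
noncomputable def tensorNToCoind : tensorN s ι K ⟶ coind s ι K where
  app F := ⟨{
    app U := AddCommGrpCat.ofHom (AddMonoidHom.mk'
      (fun (x : F.obj.obj U × F.obj.obj U) (m : ℤ) ↦ x.1 - m • x.2)
      (fun x y ↦ by ext m; simp; abel))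
    naturality U V f := by
      refine AddCommGrpCat.hom_ext (AddMonoidHom.ext fun (x : F.obj.obj U × F.obj.obj U) ↦ ?_)
      funext m
      change F.obj.map f x.1 + Geom.deg f.unop • F.obj.map f x.2 - m • F.obj.map f x.2 =
        F.obj.map f (x.1 - (m - Geom.deg f.unop) • x.2)
      rw [map_sub, map_zsmul, sub_smul]
      abel }⟩
  naturality F F' f := by
    ext U x
    funext m
    exact ((map_sub (f.hom.app U).hom _ _).trans
      (congrArg (_ - ·) (map_zsmul (f.hom.app U).hom _ _))).symm

variable {s ι K} (F : WeilSheaf s ι K)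

lemma toTensorN_tensorNToCoind :
    (toTensorN s ι K).app F ≫ (tensorNToCoind s ι K).app F = (toCoind s ι K).app F := by
  ext U x
  funext m
  change (show F.obj.obj U from x) - m • (0 : F.obj.obj U) = x
  rw [smul_zero, sub_zero]

/-- The sign comes from `(r - (m + 1) s) - (r - m s) = -s`; it persists in `cupE_eq`. -/
lemma tensorNToCoind_coindDiff :
    (tensorNToCoind s ι K).app F ≫ (coindDiff s ι K).app F =
      (ofTensorN s ι K).app F ≫ (-(toCoind s ι K).app F) := by
  ext U x
  funext m
  let x' : F.obj.obj U × F.obj.obj U := x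
  change (x'.1 - (m + 1) • x'.2) - (x'.1 - m • x'.2) = -x'.2
  rw [add_smul, one_smul]
  abel

/-- The sequence `0 ⟶ F ⟶ Hom(ℤ[G], F) ⟶ Hom(ℤ[G], F) ⟶ 0`. -/
noncomputable abbrev coindSequence : ShortComplex (WeilSheaf s ι K) :=
  ShortComplex.mk ((toCoind s ι K).app F) ((coindDiff s ι K).app F) (by
    ext U x
    funext m
    exact sub_self _)

/-- A family with zero differences is constant, and any family of differences can be summed in both
directions. -/
lemma coindSequence_shortExact : (coindSequence F).ShortExact := by
  have h₁ : Mono (coindSequence F).f :=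
    mono_of_ev_injective _ fun U x h ↦ congrFun h 0
  have h₂ : Epi (coindSequence F).g := by
    refine epi_of_ev_surjective _ fun U y ↦ ?_
    let y' : ℤ → Sec F.obj U := y
    obtain ⟨x, hx⟩ := exists_int_rec fun m ↦ Equiv.addRight (y' m)
    refine ⟨x, funext fun m ↦ ?_⟩
    change x (m + 1) - x m = y' m
    rw [hx]
    exact add_sub_cancel_left _ _
  refine ⟨exact_of_sec (fun U x y h ↦ congrFun h 0) fun U x hx ↦ ?_⟩
  let x' : ℤ → Sec F.obj U := x
  have h : ∀ m, x' (m + 1) = x' m := fun m ↦ sub_eq_zero.1 (congrFun hx m)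
  refine ⟨x' 0, funext fun m ↦ ?_⟩
  change x' 0 = x' m
  induction m with
  | zero => rfl
  | succ n ih => rw [h, ih]
  | pred n ih => rw [ih, ← h (-n - 1), sub_add_cancel]

end Coinduced

end WeilEtale

namespace WeilEtale

/-! ### Invariants of coinduced sheaves -/

section CoinducedFrobenius

variable {k : Type u} [Field k] [Fintype k]
  {S : Scheme.{u}} {s : S ⟶ Spec (.of k)} {E : Type u} [SmallCategory E] {ι : E ⥤ Over S}
  {K : Type u} [Field K] [Algebra k K] [IsAlgClosure k K]
variable [hE : IsEtaleFamily s ι]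
variable (F : WeilSheaf s ι K)

/-- The sections of `Hom(ℤ[G], F)` given by a family of sections. -/
def coindSec {V : E} : (ℤ → Sec F.obj (barObj s ι K V)) ≃
    Sec ((coind s ι K).obj F).obj (barObj s ι K V) := Equiv.refl _

lemma phi_coindSec {V : E} (x : ℤ → Sec F.obj (barObj s ι K V)) (n : ℤ) :
    phi ((coind s ι K).obj F) V n (coindSec F x) =
      coindSec F fun m ↦ phi F V n (x (m - n)) := rfl

/-- The equation `φ x_{m-1} - x_m = y_m` determines all components of `x` recursively from one of
them. -/
instance : Epi (frobSubOne ((coind s ι K).obj F)) := by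
  refine epi_of_ev_surjective _ fun V y ↦ ?_
  obtain ⟨y, rfl⟩ := (coindSec F (V := V)).surjective y
  let e : Sec F.obj (barObj s ι K V) ≃ Sec F.obj (barObj s ι K V) :=
    ⟨phi F V 1, phi F V (-1), fun x ↦ by simp [← phi_add], fun x ↦ by simp [← phi_add]⟩
  obtain ⟨x, hx⟩ := exists_int_rec fun m ↦ e.trans (Equiv.subRight (y (m + 1)))
  refine ⟨coindSec F x, ?_⟩
  refine (ev_frobSubOne _ _).trans ?_
  rw [phi_coindSec]
  refine funext fun m ↦ ?_
  change phi F V 1 (x (m - 1)) - x m = y m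
  have := hx (m - 1)
  rw [sub_add_cancel] at this
  rw [this]
  exact sub_sub_cancel _ _

/-- The inclusion of the invariant sections. -/
noncomputable def inclSec {V : E} :
    Sec ((gammaPush s ι K).obj F).obj V →+ Sec F.obj (barObj s ι K V) :=
  ev (gammaIncl F).hom V

lemma phi_inclSec {V : E} (z : Sec ((gammaPush s ι K).obj F).obj V) :
    phi F V 1 (inclSec F z) = inclSec F z :=
  congrArg (fun c : (gammaPush s ι K).obj F ⟶ (barPush s ι K).obj F ↦ ev c.hom V z)
    (gammaIncl_frobPush F)

lemma exists_coindSec_eq {V : E} (z : Sec ((gammaPush s ι K).obj ((coind s ι K).obj F)).obj V) :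
    ∃ x : ℤ → Sec F.obj (barObj s ι K V), inclSec _ z = coindSec F x ∧
      ∀ m, x m = phi F V m (x 0) := by
  have hz := phi_inclSec _ z
  obtain ⟨x, hx⟩ := (coindSec F).surjective (inclSec _ z)
  rw [← hx] at hz
  refine ⟨x, hx.symm, fun m ↦ ?_⟩
  have := congrFun (phi_eq_of_one hz m) m
  rw [phi_coindSec] at this
  refine Eq.trans this.symm ?_
  change phi F V m (x (m - m)) = phi F V m (x 0)
  rw [sub_self]

/-- The component at `0` of a family of sections. -/
noncomputable def coindEval : (barPush s ι K).obj ((coind s ι K).obj F) ⟶ (barPush s ι K).obj F :=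
  ⟨homOfSec (fun V ↦ AddMonoidHom.mk' (fun x ↦ (coindSec F (V := V)).symm x 0) fun _ _ ↦ rfl)
    fun _ _ ↦ rfl⟩

/-- The map `x ↦ (φ^m x)_m`. -/
noncomputable def coindOrbit : (barPush s ι K).obj F ⟶ (barPush s ι K).obj ((coind s ι K).obj F) :=
  ⟨homOfSec (fun V ↦ AddMonoidHom.mk' (fun x ↦ coindSec F (V := V) fun m ↦ phi F V m x)
      fun _ _ ↦ funext fun m ↦ map_add (phi F _ m) _ _)
    fun {_ W} f x ↦ funext fun m ↦
      (res_twist_phi F f m x).symm.trans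
        (congrArg (fun n ↦ res F.obj (twist s ι K f 0) (phi F W n x)) (sub_zero m).symm)⟩

lemma coindOrbit_frobPush :
    coindOrbit F ≫ (frobPush s ι K).app ((coind s ι K).obj F) = coindOrbit F := by
  ext : 1
  refine ev_ext fun V x ↦ ?_
  have h (x : Sec F.obj (barObj s ι K V)) :
      phi _ V 1 (coindSec F fun m ↦ phi F V m x) = coindSec F fun m ↦ phi F V m x := by
    rw [phi_coindSec]
    refine congrArg (coindSec F) (funext fun m ↦ ?_)
    rw [← phi_add, add_sub_cancel]
  exact h x

lemma coindOrbit_coindEval : coindOrbit F ≫ coindEval F = 𝟙 _ := by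
  ext : 1
  exact ev_ext fun V x ↦ phi_zero F V x

lemma gammaIncl_coindEval_coindOrbit :
    gammaIncl ((coind s ι K).obj F) ≫ coindEval F ≫ coindOrbit F = gammaIncl _ := by
  ext : 1
  refine ev_ext fun V z ↦ ?_
  obtain ⟨x, hx, hx'⟩ := exists_coindSec_eq F z
  exact (congrArg (fun y ↦ coindSec F fun m ↦ phi F V m ((coindSec F).symm y 0)) hx).trans
    ((congrArg (coindSec F) (funext fun m ↦ (hx' m).symm)).trans hx.symm)

/-- The isomorphism between the invariants of `Hom(ℤ[G], F)` and `F`. -/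
noncomputable def gammaCoind :
    (gammaPush s ι K).obj ((coind s ι K).obj F) ⟶ (barPush s ι K).obj F :=
  gammaIncl _ ≫ coindEval F

/-- The inverse is the orbit map `x ↦ (φ^m x)_m`. -/
instance : IsIso (gammaCoind F) := by
  obtain ⟨β, hβ⟩ := exists_comp_gammaIncl _ (coindOrbit_frobPush F)
  refine ⟨β, ?_, ?_⟩
  · rw [← cancel_mono (gammaIncl _), Category.assoc, hβ, gammaCoind, Category.assoc,
      gammaIncl_coindEval_coindOrbit, Category.id_comp]
  · rw [gammaCoind, reassoc_of% hβ, coindOrbit_coindEval]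

lemma gammaCoind_naturality {F F' : WeilSheaf s ι K} (α : F ⟶ F') :
    (gammaPush s ι K).map ((coind s ι K).map α) ≫ gammaCoind F' =
      gammaCoind F ≫ (barPush s ι K).map α := by
  rw [gammaCoind, gammaCoind, reassoc_of% gammaIncl_naturality ((coind s ι K).map α),
    Category.assoc]
  rfl

lemma gammaPush_toCoind_gammaCoind :
    (gammaPush s ι K).map ((toCoind s ι K).app F) ≫ gammaCoind F = gammaIncl F := by
  rw [gammaCoind, reassoc_of% gammaIncl_naturality ((toCoind s ι K).app F)]
  rfl

/-- On an invariant family, `x_1 - x_0 = φ x_0 - x_0`. -/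
lemma gammaPush_coindDiff_gammaCoind :
    (gammaPush s ι K).map ((coindDiff s ι K).app F) ≫ gammaCoind F =
      gammaCoind F ≫ frobSubOne F := by
  rw [gammaCoind, reassoc_of% gammaIncl_naturality ((coindDiff s ι K).app F), Category.assoc]
  ext : 1
  refine ev_ext fun V z ↦ ?_
  obtain ⟨x, hx, hx'⟩ := exists_coindSec_eq F z
  have h : (coindSec F).symm (inclSec _ z) = x := (congrArg (coindSec F).symm hx)
  refine (congrArg (fun y : ℤ → Sec F.obj (barObj s ι K V) ↦ y (0 + 1) - y 0) h).trans ?_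
  refine Eq.trans ?_ (congrArg (fun y : ℤ → Sec F.obj (barObj s ι K V) ↦ phi F V 1 (y 0) - y 0)
    h).symm
  exact congrArg (· - x 0) (hx' 1)

end CoinducedFrobenius

end WeilEtale

namespace WeilEtale

/-! ### Mapping cones and four-term exact sequences of complexes -/

section Triangulated

open Pretriangulated

variable {D : Type*} [Category* D] [HasShift D ℤ] [HasZeroObject D] [Preadditive D]
  [∀ n : ℤ, (shiftFunctor D n).Additive] [Pretriangulated D]

lemma distinguished_of_isos {X Y Z X' Y' Z' : D} {f : X ⟶ Y} {g : Y ⟶ Z} {h : Z ⟶ X⟦(1 : ℤ)⟧}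
    (hT : Triangle.mk f g h ∈ distTriang D) {f' : X' ⟶ Y'} {g' : Y' ⟶ Z'} {h' : Z' ⟶ X'⟦(1 : ℤ)⟧}
    (a : X' ≅ X) (b : Y' ≅ Y) (c : Z' ≅ Z) (hf : f' ≫ b.hom = a.hom ≫ f)
    (hg : g' ≫ c.hom = b.hom ≫ g) (hh : h' ≫ a.hom⟦(1 : ℤ)⟧' = c.hom ≫ h) :
    Triangle.mk f' g' h' ∈ distTriang D :=
  isomorphic_distinguished _ hT _ (Triangle.isoMk _ _ a b c hf hg hh)

lemma distinguished_of_iso₃ {X Y Z Z' : D} {f : X ⟶ Y} {g : Y ⟶ Z} {h : Z ⟶ X⟦(1 : ℤ)⟧}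
    (hT : Triangle.mk f g h ∈ distTriang D) (e : Z ≅ Z') :
    Triangle.mk f (g ≫ e.hom) (e.inv ≫ h) ∈ distTriang D :=
  distinguished_of_isos hT (Iso.refl _) (Iso.refl _) e.symm (by simp) (by simp) (by simp)

end Triangulated

section Cone

open DerivedCategory CochainComplex Pretriangulated HomComplex

universe v u₁
variable {A : Type u₁} [Category.{v} A] [Abelian A] {G B B' H : CochainComplex A ℤ}

/-- The identification of the components of a shifted complex. -/
def shiftX (G : CochainComplex A ℤ) (n : ℤ) : (G⟦(1 : ℤ)⟧).X n ≅ G.X (n + 1) :=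
  G.shiftFunctorObjXIso 1 n (n + 1) rfl

lemma d_shiftX_hom (G : CochainComplex A ℤ) (n : ℤ) :
    (G⟦(1 : ℤ)⟧).d n (n + 1) ≫ (shiftX G (n + 1)).hom =
      -((shiftX G n).hom ≫ G.d (n + 1) (n + 1 + 1)) := by
  have h : (G⟦(1 : ℤ)⟧).d n (n + 1) = (1 : ℤ).negOnePow • G.d (n + 1) (n + 1 + 1) := rfl
  exact (Category.comp_id _).trans (h.trans (by
    rw [Int.negOnePow_one, Units.neg_smul, one_smul]
    exact congrArg Neg.neg (Category.id_comp _).symm))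

lemma map_f_shiftX_hom (f : G ⟶ B) (n : ℤ) :
    (f⟦(1 : ℤ)⟧').f n ≫ (shiftX B n).hom = (shiftX G n).hom ≫ f.f (n + 1) :=
  (Category.comp_id _).trans (Category.id_comp _).symm

/-- The morphism `G[1] ⟶ cone(d)` induced by `a : G ⟶ B` with `a ≫ d = 0`. -/
noncomputable def toCone (a : G ⟶ B) (d : B ⟶ B') (w : a ≫ d = 0) :
    G⟦(1 : ℤ)⟧ ⟶ mappingCone d where
  f n := (shiftX G n).hom ≫ a.f (n + 1) ≫ (mappingCone.inl d).v (n + 1) n (by lia)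
  comm' n m hnm := by
    obtain rfl : n + 1 = m := hnm
    have h : a.f (n + 1) ≫ d.f (n + 1) = 0 := by rw [← HomologicalComplex.comp_f, w]; rfl
    rw [Category.assoc, Category.assoc, mappingCone.inl_v_d d (n + 1) n (n + 1 + 1) (by lia) (by lia),
      ← Category.assoc, ← Category.assoc, d_shiftX_hom]
    simp [-shiftFunctor_obj_X', reassoc_of% h]

lemma toCone_f (a : G ⟶ B) (d : B ⟶ B') (w : a ≫ d = 0) (n : ℤ) :
    (toCone a d w).f n =
      (shiftX G n).hom ≫ a.f (n + 1) ≫ (mappingCone.inl d).v (n + 1) n (by lia) := rfl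

lemma toCone_map {B₁ B₁' : CochainComplex A ℤ} (a : G ⟶ B) (d : B ⟶ B') (w : a ≫ d = 0)
    (d₁ : B₁ ⟶ B₁') (b : B ⟶ B₁) (b' : B' ⟶ B₁') (h : d ≫ b' = b ≫ d₁)
    (w' : (a ≫ b) ≫ d₁ = 0) :
    toCone a d w ≫ mappingCone.map d d₁ b b' h = toCone (a ≫ b) d₁ w' := by
  ext n
  simp [toCone_f, mappingCone.map]

lemma toCone_comp {G' : CochainComplex A ℤ} (f : G' ⟶ G) (a : G ⟶ B) (d : B ⟶ B') (w : a ≫ d = 0) :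
    f⟦(1 : ℤ)⟧' ≫ toCone a d w = toCone (f ≫ a) d (by rw [Category.assoc, w, comp_zero]) := by
  ext n
  rw [HomologicalComplex.comp_f, toCone_f, toCone_f, ← Category.assoc, map_f_shiftX_hom]
  simp

/-- The first component of the map of cones is `d`, shifted, and the second is the identity; so the
kernel is `G[1]`, and surjectivity is that of `d`. -/
lemma toCone_shortExact {a : G ⟶ B} {d : B ⟶ B'} {w : a ≫ d = 0}
    (hS : (ShortComplex.mk a d w).ShortExact) {C : CochainComplex A ℤ} (j : B' ⟶ C)
    (w' : toCone a (d ≫ j) (by rw [reassoc_of% w, zero_comp]) ≫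
      mappingCone.map (d ≫ j) j d (𝟙 C) (Category.comp_id _) = 0) :
    (ShortComplex.mk _ _ w').ShortExact := by
  refine HomologicalComplex.shortExact_of_degreewise_shortExact _ fun n ↦ ?_
  have hS' := hS.map_of_exact (HomologicalComplex.eval A (ComplexShape.up ℤ) (n + 1))
  have hm : Mono (a.f (n + 1)) := hS'.mono_f
  have he : Epi (d.f (n + 1)) := hS'.epi_g
  have hmono : Mono ((toCone a (d ≫ j) (by rw [reassoc_of% w, zero_comp])).f n) := by
    refine ⟨fun x y h ↦ ?_⟩
    have := h =≫ (mappingCone.fst (d ≫ j)).1.v n (n + 1) rfl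
    simp only [toCone_f, Category.assoc, mappingCone.inl_v_fst_v, Category.comp_id] at this
    exact (cancel_mono _).1 this
  have hepi : Epi ((mappingCone.map (d ≫ j) j d (𝟙 C) (Category.comp_id _)).f n) := by
    refine ⟨fun x y h ↦ ?_⟩
    rw [mappingCone.ext_from_iff _ (n + 1) n rfl]
    have h₁ := (mappingCone.inl (d ≫ j)).v (n + 1) n (by lia) ≫= h
    have h₂ := (mappingCone.inr (d ≫ j)).f n ≫= h
    simp only [mappingCone.map, mappingCone.inl_v_desc_f_assoc, mappingCone.inr_f_desc_f_assoc,
      Cochain.zero_cochain_comp_v, Cochain.ofHom_v, Category.assoc, Category.id_comp] at h₁ h₂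
    exact ⟨(cancel_epi _).1 h₁, h₂⟩
  refine ShortComplex.ShortExact.mk' (ShortComplex.exact_of_f_is_kernel _ ?_) hmono hepi
  have key {Z : A} (x : Z ⟶ (mappingCone (d ≫ j)).X n)
      (hx : x ≫ (mappingCone.map (d ≫ j) j d (𝟙 C) (Category.comp_id _)).f n = 0) :
      ∃ l, l ≫ (toCone a (d ≫ j) (by rw [reassoc_of% w, zero_comp])).f n = x := by
    have h₁ := hx =≫ (mappingCone.fst j).1.v n (n + 1) rfl
    have h₂ := hx =≫ (mappingCone.snd j).v n n (add_zero n)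
    rw [mappingCone.map, mappingCone.desc_f (hpq := rfl)] at h₁ h₂
    simp at h₁ h₂
    have := hS'.mono_f
    obtain ⟨l, hl⟩ : ∃ l : Z ⟶ G.X (n + 1),
        l ≫ a.f (n + 1) = x ≫ (mappingCone.fst (d ≫ j)).1.v n (n + 1) rfl :=
      ⟨_, hS'.exact.lift_f (x ≫ (mappingCone.fst (d ≫ j)).1.v n (n + 1) rfl)
        ((Category.assoc _ _ _).trans h₁)⟩
    refine ⟨l ≫ (shiftX G n).inv, ?_⟩
    rw [mappingCone.ext_to_iff _ n (n + 1) rfl]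
    simp [-shiftFunctor_obj_X', toCone_f, hl, h₂]
  choose l hl using fun Z x hx ↦ key (Z := Z) x hx
  exact KernelFork.IsLimit.ofι _ _ (fun {Z} x hx ↦ l Z x hx) (fun {Z} x hx ↦ hl Z x hx)
    fun {Z} x hx m hm ↦ hmono.right_cancellation _ _ (hm.trans (hl Z x hx).symm)

variable [HasDerivedCategory.{w₁} A]

lemma quasiIso_desc {j : B ⟶ B'} {q : B' ⟶ H} {w : j ≫ q = 0}
    (h : (ShortComplex.mk j q w).ShortExact) :
    QuasiIso (mappingCone.desc j 0 q (by simp [w])) := by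
  have := mappingCone.quasiIso_descShortComplex h
  rwa [mappingCone.descShortComplex] at this

/-- The map from the cone of `e ≫ j` to the cone of `j` has kernel `G[1]`, and the latter cone is
quasi-isomorphic to `H`. -/
lemma exists_cone_triangle_of_shortExact {I : CochainComplex A ℤ} {a : G ⟶ B} {e : B ⟶ I}
    {j : I ⟶ B'} {q : B' ⟶ H} {w₁ : a ≫ e = 0} {w₂ : j ≫ q = 0}
    (h₁ : (ShortComplex.mk a e w₁).ShortExact) (h₂ : (ShortComplex.mk j q w₂).ShortExact) :
    ∃ δ, Triangle.mk (Q.map (toCone a (e ≫ j) (by rw [reassoc_of% w₁, zero_comp])))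
      (Q.map (mappingCone.desc (e ≫ j) 0 q (by simp [w₂]))) δ ∈ distTriang (DerivedCategory A) := by
  have w₃ : toCone a (e ≫ j) (by rw [reassoc_of% w₁, zero_comp]) ≫
      mappingCone.map (e ≫ j) j e (𝟙 _) (Category.comp_id _) = 0 := by
    rw [toCone_map a (e ≫ j) _ j e (𝟙 _) (Category.comp_id _) (by rw [w₁, zero_comp])]
    ext n
    have : (a ≫ e).f (n + 1) = 0 := by rw [w₁]; rfl
    rw [toCone_f, this]
    simp [-shiftFunctor_obj_X']
  have h₃ := toCone_shortExact h₁ j w₃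
  let q' : mappingCone j ⟶ H := mappingCone.desc j 0 q (by simp [w₂])
  have hq : QuasiIso q' := quasiIso_desc h₂
  have hq' : mappingCone.desc (e ≫ j) 0 q (by simp [w₂]) =
      mappingCone.map (e ≫ j) j e (𝟙 _) (Category.comp_id _) ≫ q' := by
    ext n
    rw [mappingCone.ext_from_iff _ (n + 1) n rfl]
    simp [mappingCone.map, q']
  have hT : Triangle.mk (Q.map (toCone a (e ≫ j) (by rw [reassoc_of% w₁, zero_comp])))
      (Q.map (mappingCone.map (e ≫ j) j e (𝟙 _) (Category.comp_id _))) (triangleOfSESδ h₃) ∈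
        distTriang (DerivedCategory A) := triangleOfSES_distinguished h₃
  have key := distinguished_of_iso₃ hT (asIso (Q.map q'))
  rw [asIso_hom, ← Q.map_comp, ← hq'] at key
  exact ⟨_, key⟩

/-- In an exact sequence `0 ⟶ G ⟶ B ⟶ B' ⟶ H ⟶ 0` the cone of the middle map is built from `G[1]`
and `H`; one factors `d` through its image. -/
lemma exists_cone_triangle (a : G ⟶ B) (d : B ⟶ B') (q : B' ⟶ H) (w : a ≫ d = 0) (w' : d ≫ q = 0)
    [Mono a] [Epi q] (h : (ShortComplex.mk a d w).Exact) (h' : (ShortComplex.mk d q w').Exact) :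
    ∃ δ, Triangle.mk (Q.map (toCone a d w)) (Q.map (mappingCone.desc d 0 q (by simp [w']))) δ ∈
      distTriang (DerivedCategory A) := by
  obtain ⟨I, e, j, hd, he, hj⟩ : ∃ (I : CochainComplex A ℤ) (e : B ⟶ I) (j : I ⟶ B'),
      e ≫ j = d ∧ Epi e ∧ Mono j :=
    ⟨_, Abelian.factorThruImage d, Abelian.image.ι d, Abelian.image.fac d, inferInstance,
      inferInstance⟩
  have w₁ : a ≫ e = 0 := by rw [← cancel_mono j, Category.assoc, hd, w, zero_comp]
  have w₂ : j ≫ q = 0 := by rw [← cancel_epi e, ← Category.assoc, hd, w', comp_zero]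
  have h₁ : (ShortComplex.mk a e w₁).ShortExact :=
    { exact := (ShortComplex.exact_iff_of_epi_of_isIso_of_mono
        (ShortComplex.Hom.mk (S₁ := .mk a e w₁) (S₂ := .mk a d w) (𝟙 _) (𝟙 _) j
          (by simp) (by simp [hd]))).2 h }
  have h₂ : (ShortComplex.mk j q w₂).ShortExact :=
    { exact := (ShortComplex.exact_iff_of_epi_of_isIso_of_mono
        (ShortComplex.Hom.mk (S₁ := .mk d q w') (S₂ := .mk j q w₂) e (𝟙 _) (𝟙 _)
          (by simp [hd]) (by simp))).1 h' }
  subst hd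
  exact exists_cone_triangle_of_shortExact h₁ h₂

/-- The preceding triangle with `H = 0`. -/
lemma quasiIso_toCone {a : G ⟶ B} {d : B ⟶ B'} {w : a ≫ d = 0}
    (hS : (ShortComplex.mk a d w).ShortExact) : QuasiIso (toCone a d w) := by
  have := hS.mono_f
  have := hS.epi_g
  have : Epi d := hS.epi_g
  obtain ⟨Z, hZ⟩ : ∃ Z : CochainComplex A ℤ, IsZero Z := ⟨_, isZero_zero _⟩
  have : Epi (0 : B' ⟶ Z) := ⟨fun _ _ _ ↦ hZ.eq_of_src _ _⟩
  obtain ⟨δ, hδ⟩ := exists_cone_triangle a d (0 : B' ⟶ Z) w comp_zero hS.exact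
    ((ShortComplex.exact_iff_epi _ rfl).2 ‹Epi d›)
  rw [← isIso_Q_map_iff_quasiIso]
  exact (Triangle.isZero₃_iff_isIso₁ _ hδ).1 (Q.map_isZero hZ)

end Cone

end WeilEtale

namespace WeilEtale

/-! ### Splitting a triangle by an endomorphism of degree one and square zero -/

section Splitting

open Pretriangulated

variable {D : Type*} [Category* D] [HasShift D ℤ] [HasZeroObject D] [Preadditive D]
  [∀ n : ℤ, (shiftFunctor D n).Additive] [Pretriangulated D]

lemma negOnePow_neg_one_smul {C : Type*} [Category* C] [Preadditive C] {X Y : C} (f : X ⟶ Y) :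
    (-1 : ℤ).negOnePow • f = -f := by
  rw [Int.negOnePow_neg, Int.negOnePow_one, Units.neg_smul, one_smul]

lemma exists_desuspension {X M H : D} {u : X ⟶ M} {p : M⟦(1 : ℤ)⟧ ⟶ H}
    {δ : H ⟶ X⟦(1 : ℤ)⟧⟦(1 : ℤ)⟧} (hT : Triangle.mk (u⟦(1 : ℤ)⟧') p δ ∈ distTriang D) :
    ∃ δ', Triangle.mk u ((shiftShiftNeg M (1 : ℤ)).inv ≫ p⟦(-1 : ℤ)⟧') δ' ∈ distTriang D := by
  let T := (Triangle.shiftFunctor D (-1)).obj (Triangle.mk (u⟦(1 : ℤ)⟧') p δ)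
  have h₁ : T.mor₁ = -(u⟦(1 : ℤ)⟧'⟦(-1 : ℤ)⟧') := negOnePow_neg_one_smul _
  have h₂ : T.mor₂ = -(p⟦(-1 : ℤ)⟧') := negOnePow_neg_one_smul _
  let d : H⟦(-1 : ℤ)⟧ ⟶ X⟦(1 : ℤ)⟧⟦(-1 : ℤ)⟧⟦(1 : ℤ)⟧ := T.mor₃
  have hT' : Triangle.mk (-(u⟦(1 : ℤ)⟧'⟦(-1 : ℤ)⟧')) (-(p⟦(-1 : ℤ)⟧')) d ∈ distTriang D := by
    change Triangle.mk _ _ T.mor₃ ∈ _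
    rw [← h₁, ← h₂]
    exact Triangle.shift_distinguished _ hT (-1)
  let a := (shiftShiftNeg X (1 : ℤ)).symm
  -- The shift by `-1` reverses the signs of the maps of the triangle; the sign of `b` absorbs those
  -- of the first two.
  let b : M ≅ M⟦(1 : ℤ)⟧⟦(-1 : ℤ)⟧ :=
    ⟨-(shiftShiftNeg M (1 : ℤ)).inv, -(shiftShiftNeg M (1 : ℤ)).hom,
      (Preadditive.neg_comp_neg _ _).trans (Iso.inv_hom_id _),
      (Preadditive.neg_comp_neg _ _).trans (Iso.hom_inv_id _)⟩
  refine ⟨d ≫ a.inv⟦(1 : ℤ)⟧', distinguished_of_isos hT' a b (Iso.refl _) ?_ ?_ ?_⟩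
  · have h := (shiftFunctorCompIsoId D (1 : ℤ) (-1) (by lia)).inv.naturality u
    exact (Preadditive.comp_neg _ _).trans ((congrArg Neg.neg h).trans
      (Preadditive.comp_neg _ _).symm)
  · exact (Category.comp_id _).trans (Preadditive.neg_comp_neg _ _).symm
  · rw [Category.assoc, ← Functor.map_comp, a.inv_hom_id]
    refine (congrArg (d ≫ ·) ((shiftFunctor D (1 : ℤ)).map_id _)).trans ?_
    exact (Category.comp_id _).trans (Category.id_comp _).symm

/-- The desuspension `v` of `u ≫ e` splits the triangle, because its composite with the second map
is a shift of the isomorphism `u ≫ e ≫ p`; so `u` and `v` give the decomposition. On the first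
summand `e` is the shift of `v`, and on the second it vanishes since `e` has square zero. -/
lemma exists_iso_biprod {X M H : D} {u : X ⟶ M} {p : M⟦(1 : ℤ)⟧ ⟶ H}
    {δ : H ⟶ X⟦(1 : ℤ)⟧⟦(1 : ℤ)⟧} (hT : Triangle.mk (u⟦(1 : ℤ)⟧') p δ ∈ distTriang D)
    (e : M ⟶ M⟦(1 : ℤ)⟧) (he : e ≫ e⟦(1 : ℤ)⟧' = 0) (h : IsIso (u ≫ e ≫ p)) :
    ∃ Φ : M ≅ X ⊞ X⟦(-1 : ℤ)⟧, u ≫ Φ.hom = biprod.inl ∧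
      e ≫ Φ.hom⟦(1 : ℤ)⟧' = Φ.hom ≫ biprod.fst ≫ (shiftNegShift X (1 : ℤ)).inv ≫
        (biprod.inr : _ ⟶ X ⊞ X⟦(-1 : ℤ)⟧)⟦(1 : ℤ)⟧' := by
  obtain ⟨δ', hδ'⟩ := exists_desuspension hT
  let v : X⟦(-1 : ℤ)⟧ ⟶ M := (u ≫ e)⟦(-1 : ℤ)⟧' ≫ (shiftShiftNeg M (1 : ℤ)).hom
  have hv : v⟦(1 : ℤ)⟧' = (shiftNegShift X (1 : ℤ)).hom ≫ u ≫ e := by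
    have h₁ := shift_shiftFunctorCompIsoId_hom_app (C := D) (1 : ℤ) (-1) (by lia) M
    have h₂ := (shiftFunctorCompIsoId D (-1 : ℤ) 1 (by lia)).hom.naturality (u ≫ e)
    dsimp only [v]
    rw [Functor.map_comp]
    exact (congrArg (_ ≫ ·) h₁).trans h₂
  have hvp : v ≫ (shiftShiftNeg M (1 : ℤ)).inv ≫ p⟦(-1 : ℤ)⟧' = (u ≫ e ≫ p)⟦(-1 : ℤ)⟧' := by
    dsimp only [v]
    rw [Category.assoc, Iso.hom_inv_id_assoc, ← Functor.map_comp, Category.assoc]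
  let w : X⟦(-1 : ℤ)⟧ ⟶ H⟦(-1 : ℤ)⟧ := (u ≫ e ≫ p)⟦(-1 : ℤ)⟧'
  have hup : u ≫ (shiftShiftNeg M (1 : ℤ)).inv ≫ p⟦(-1 : ℤ)⟧' = 0 :=
    comp_distTriang_mor_zero₁₂ _ hδ'
  have hwδ : w ≫ δ' = 0 := by
    have h₀ : ((shiftShiftNeg M (1 : ℤ)).inv ≫ p⟦(-1 : ℤ)⟧') ≫ δ' = 0 :=
      comp_distTriang_mor_zero₂₃ _ hδ'
    have h₁ : w = v ≫ (shiftShiftNeg M (1 : ℤ)).inv ≫ p⟦(-1 : ℤ)⟧' := hvp.symm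
    rw [h₁, Category.assoc, h₀, comp_zero]
  have hw : IsIso w := inferInstanceAs (IsIso ((shiftFunctor D (-1 : ℤ)).map (u ≫ e ≫ p)))
  have hiso : IsIso (biprod.desc u v) :=
    isIso₂_of_isIso₁₃ (Triangle.homMk (binaryBiproductTriangle X (X⟦(-1 : ℤ)⟧)) (Triangle.mk u
      ((shiftShiftNeg M (1 : ℤ)).inv ≫ p⟦(-1 : ℤ)⟧') δ') (𝟙 X) (biprod.desc u v) w
      ((biprod.inl_desc _ _).trans (Category.id_comp _).symm)
      (by
        refine biprod.hom_ext' _ _ ?_ ?_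
        · exact (biprod.inl_snd_assoc _).trans (zero_comp.trans
            ((biprod.inl_desc_assoc _ _ _).trans hup).symm)
        · exact (biprod.inr_snd_assoc _).trans ((biprod.inr_desc_assoc _ _ _).trans hvp).symm)
      (zero_comp.trans hwδ.symm))
      (binaryBiproductTriangle_distinguished _ _) hδ' (IsIso.id X) hw
  have hve : v ≫ e = 0 := by
    refine (shiftFunctor D (1 : ℤ)).map_injective ?_
    rw [Functor.map_comp, hv, Category.assoc, Category.assoc, he, comp_zero, comp_zero,
      Functor.map_zero]
  have hinl : u ≫ inv (biprod.desc u v) = biprod.inl := by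
    rw [IsIso.comp_inv_eq, biprod.inl_desc]
  have hinr : v ≫ inv (biprod.desc u v) = biprod.inr := by
    rw [IsIso.comp_inv_eq, biprod.inr_desc]
  refine ⟨(asIso (biprod.desc u v)).symm, hinl, ?_⟩
  rw [← cancel_epi (biprod.desc u v)]
  refine biprod.hom_ext' _ _ ?_ ?_
  · have h₁ := congrArg (fun x ↦ x⟦(1 : ℤ)⟧') hinr
    simp only [Functor.map_comp, hv, Category.assoc] at h₁
    simp [← h₁]
  · simp [reassoc_of% hve]

end Splitting

end WeilEtale

/-! ### Complexes on which `φ - 1` is onto, and the resolution adapted to `γ_*` -/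

namespace WeilEtale

section

universe v u₁
variable {A : Type u₁} [Category.{v} A] [Abelian A]

lemma quasiIso_τ₁ {S₁ S₂ : ShortComplex (CochainComplex A ℤ)} (φ : S₁ ⟶ S₂) (h₁ : S₁.ShortExact)
    (h₂ : S₂.ShortExact) (hφ₂ : QuasiIso φ.τ₂) (hφ₃ : QuasiIso φ.τ₃) : QuasiIso φ.τ₁ := by
  let := HasDerivedCategory.standard A
  rw [← DerivedCategory.isIso_Q_map_iff_quasiIso] at hφ₂ hφ₃ ⊢
  exact Pretriangulated.isIso₁_of_isIso₂₃ (DerivedCategory.triangleOfSES.map h₁ h₂ φ)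
    (DerivedCategory.triangleOfSES_distinguished h₁)
    (DerivedCategory.triangleOfSES_distinguished h₂) hφ₂ hφ₃

end

section Resolution

variable {k : Type u} [Field k] [Fintype k] {S : Scheme.{u}} {s : S ⟶ Spec (.of k)} {E : Type u}
  [SmallCategory E] {ι : E ⥤ Over S} {K : Type u} [Field K] [Algebra k K] [IsAlgClosure k K]
variable [hE : IsEtaleFamily s ι]

variable (s ι K) in
/-- The functor induced by `coind` on complexes. -/
noncomputable abbrev coindComplex :
    CochainComplex (WeilSheaf s ι K) ℤ ⥤ CochainComplex (WeilSheaf s ι K) ℤ :=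
  (coind s ι K).mapHomologicalComplex (ComplexShape.up ℤ)

/-- The morphism `toCoind` for complexes. -/
noncomputable def toCoindComplex (F : CochainComplex (WeilSheaf s ι K) ℤ) :
    F ⟶ (coindComplex s ι K).obj F where
  f i := (toCoind s ι K).app (F.X i)
  comm' i j _ := ((toCoind s ι K).naturality (F.d i j)).symm

variable (s ι K) in
/-- The morphism `coindDiff` for complexes. -/
noncomputable def coindDiffComplex : coindComplex s ι K ⟶ coindComplex s ι K :=
  NatTrans.mapHomologicalComplex (coindDiff s ι K) _

lemma toCoindComplex_naturality {F F' : CochainComplex (WeilSheaf s ι K) ℤ} (α : F ⟶ F') :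
    α ≫ toCoindComplex F' = toCoindComplex F ≫ (coindComplex s ι K).map α :=
  HomologicalComplex.hom_ext _ _ fun i ↦ (toCoind s ι K).naturality (α.f i)

lemma toCoindComplex_coindDiffComplex (F : CochainComplex (WeilSheaf s ι K) ℤ) :
    toCoindComplex F ≫ (coindDiffComplex s ι K).app F = 0 :=
  HomologicalComplex.hom_ext _ _ fun i ↦ (coindSequence (F.X i)).zero

lemma toCoindComplex_shortExact (F : CochainComplex (WeilSheaf s ι K) ℤ) :
    (ShortComplex.mk _ _ (toCoindComplex_coindDiffComplex F)).ShortExact :=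
  HomologicalComplex.shortExact_of_degreewise_shortExact _
    fun i ↦ coindSequence_shortExact (F.X i)

open CochainComplex in
variable (s ι K) in
/-- The mapping cone of `coindDiff`, a resolution of `F[1]`. -/
noncomputable def coindCone :
    CochainComplex (WeilSheaf s ι K) ℤ ⥤ CochainComplex (WeilSheaf s ι K) ℤ where
  obj F := mappingCone ((coindDiffComplex s ι K).app F)
  map α := mappingCone.map _ _ ((coindComplex s ι K).map α) ((coindComplex s ι K).map α)
    ((coindDiffComplex s ι K).naturality α).symm
  map_id F := by
    refine Eq.trans ?_ (mappingCone.map_id _)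
    congr 1
  map_comp α β := by
    refine Eq.trans ?_ (mappingCone.map_comp _ _ _ _ _ ((coindDiffComplex s ι K).naturality α).symm
      _ _ ((coindDiffComplex s ι K).naturality β).symm)
    congr 1

/-- The resolution of `F[1]` by the mapping cone of `coindDiff`. -/
noncomputable def toCoindCone (F : CochainComplex (WeilSheaf s ι K) ℤ) :
    F⟦(1 : ℤ)⟧ ⟶ (coindCone s ι K).obj F :=
  toCone (toCoindComplex F) ((coindDiffComplex s ι K).app F) (toCoindComplex_coindDiffComplex F)

lemma toCoindCone_naturality {F F' : CochainComplex (WeilSheaf s ι K) ℤ} (α : F ⟶ F') :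
    α⟦(1 : ℤ)⟧' ≫ toCoindCone F' = toCoindCone F ≫ (coindCone s ι K).map α := by
  have h := toCoindComplex_naturality α
  have h₁ := toCone_comp α (toCoindComplex F') _ (toCoindComplex_coindDiffComplex F')
  have h₂ := toCone_map (toCoindComplex F) _ (toCoindComplex_coindDiffComplex F)
    ((coindDiffComplex s ι K).app F') ((coindComplex s ι K).map α) ((coindComplex s ι K).map α)
    ((coindDiffComplex s ι K).naturality α).symm
    (by rw [← h, Category.assoc, toCoindComplex_coindDiffComplex, comp_zero])
  refine h₁.trans (Eq.trans ?_ h₂.symm)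
  congr 1

instance (F : CochainComplex (WeilSheaf s ι K) ℤ) : QuasiIso (toCoindCone F) :=
  let := HasDerivedCategory.standard (WeilSheaf s ι K)
  quasiIso_toCone (toCoindComplex_shortExact F)

variable (s ι K) in
/-- The complexes of sheaves on which `φ - 1` is an epimorphism in each degree. -/
def frobEpi : ObjectProperty (CochainComplex (WeilSheaf s ι K) ℤ) :=
  fun F ↦ ∀ i, Epi (frobSubOne (F.X i))

lemma frobEpi_isStableUnderShift : (frobEpi s ι K).IsStableUnderShift ℤ where
  isStableUnderShiftBy n := ⟨fun _ hF i ↦ hF (i + n)⟩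

instance : (barPush s ι K).Additive := ⟨rfl⟩

/-- Meant for the components of a mapping cone, which are sums of two coinduced sheaves. -/
lemma epi_frobSubOne_of_retract {X Y Z : WeilSheaf s ι K} [Epi (frobSubOne Y)] [Epi (frobSubOne Z)]
    (p : X ⟶ Y) (i : Y ⟶ X) (q : X ⟶ Z) (j : Z ⟶ X) (h : p ≫ i + q ≫ j = 𝟙 X) :
    Epi (frobSubOne X) := by
  refine Preadditive.epi_of_cancel_zero _ fun {W} g hg ↦ ?_
  have key {Y : WeilSheaf s ι K} [Epi (frobSubOne Y)] (a : Y ⟶ X) :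
      (barPush s ι K).map a ≫ g = 0 := by
    rw [← cancel_epi (frobSubOne Y), ← Category.assoc, frobSubOne_naturality, Category.assoc, hg,
      comp_zero, comp_zero]
  rw [← Category.id_comp g, ← (barPush s ι K).map_id, ← h, Functor.map_add, Functor.map_comp,
    Functor.map_comp, Preadditive.add_comp, Category.assoc, Category.assoc, key i, key j, comp_zero,
    comp_zero, add_zero]

lemma frobEpi_coindCone (F : CochainComplex (WeilSheaf s ι K) ℤ) :
    frobEpi s ι K ((coindCone s ι K).obj F) := fun i ↦
  epi_frobSubOne_of_retract (Y := (coind s ι K).obj (F.X (i + 1)))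
    (Z := (coind s ι K).obj (F.X i)) _ _ _ _
    (CochainComplex.mappingCone.id_X ((coindDiffComplex s ι K).app F) i (i + 1) rfl)

instance : (barPush s ι K).IsRightAdjoint := (barAdj s ι K).isRightAdjoint

instance : (barPush s ι K).PreservesHomology :=
  have : PreservesFiniteLimits (barPush s ι K) := inferInstance
  Functor.preservesHomology_of_preservesEpis_and_kernels _

variable (s ι K) in
/-- The functor `γ_*` on complexes. -/
noncomputable abbrev gammaPushComplex :
    CochainComplex (WeilSheaf s ι K) ℤ ⥤ CochainComplex (EtaleSheaf ι) ℤ :=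
  (gammaPush s ι K).mapHomologicalComplex (ComplexShape.up ℤ)

variable (s ι K) in
/-- The functor `F ↦ (V ↦ F(V̄))` on complexes. -/
noncomputable abbrev barPushComplex :
    CochainComplex (WeilSheaf s ι K) ℤ ⥤ CochainComplex (EtaleSheaf ι) ℤ :=
  (barPush s ι K).mapHomologicalComplex (ComplexShape.up ℤ)

variable (s ι K) in
/-- The inclusion of the invariants, as a natural transformation. -/
noncomputable def gammaInclNat : gammaPush s ι K ⟶ barPush s ι K where
  app F := gammaIncl F
  naturality _ _ α := gammaIncl_naturality α

variable (s ι K) in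
/-- The inclusion of the invariants, for complexes. -/
noncomputable def gammaInclComplex : gammaPushComplex s ι K ⟶ barPushComplex s ι K :=
  NatTrans.mapHomologicalComplex (gammaInclNat s ι K) _

variable (s ι K) in
/-- The endomorphism `φ - 1`, for complexes. -/
noncomputable def frobSubOneComplex : barPushComplex s ι K ⟶ barPushComplex s ι K :=
  NatTrans.mapHomologicalComplex
    { app := frobSubOne, naturality := fun _ _ α ↦ (frobSubOne_naturality α).symm } _

/-- The sequence `γ_* F ⟶ F ⟶ F` for a complex `F`. -/
noncomputable abbrev gammaSequence (F : CochainComplex (WeilSheaf s ι K) ℤ) :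
    ShortComplex (CochainComplex (EtaleSheaf ι) ℤ) :=
  ShortComplex.mk ((gammaInclComplex s ι K).app F) ((frobSubOneComplex s ι K).app F)
    (HomologicalComplex.hom_ext _ _ fun i ↦ gammaIncl_frobSubOne (F.X i))

lemma gammaSequence_shortExact {F : CochainComplex (WeilSheaf s ι K) ℤ} (hF : frobEpi s ι K F) :
    (gammaSequence F).ShortExact :=
  HomologicalComplex.shortExact_of_degreewise_shortExact _ fun i ↦
    { exact := gammaIncl_exact (F.X i)
      mono_f := inferInstanceAs (Mono (gammaIncl (F.X i)))
      epi_g := hF i }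

/-- When `φ - 1` is onto, `γ_* F` is the kernel in a short exact sequence whose other two terms come
from the exact functor `barPush`. The five lemma applies, without any boundedness. -/
lemma quasiIso_gammaPushComplex_map {F F' : CochainComplex (WeilSheaf s ι K) ℤ} (f : F ⟶ F')
    (hF : frobEpi s ι K F) (hF' : frobEpi s ι K F') (hf : QuasiIso f) :
    QuasiIso ((gammaPushComplex s ι K).map f) := by
  have hP : QuasiIso ((barPushComplex s ι K).map f) := inferInstance
  exact quasiIso_τ₁ (S₁ := gammaSequence F) (S₂ := gammaSequence F')
    ⟨(gammaPushComplex s ι K).map f, (barPushComplex s ι K).map f, (barPushComplex s ι K).map f,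
      (gammaInclComplex s ι K).naturality f, (frobSubOneComplex s ι K).naturality f⟩
    (gammaSequence_shortExact hF) (gammaSequence_shortExact hF') hP hP

variable (s ι K) in
/-- Shifted mapping cones of `coindDiff` are functorial resolutions adapted to `γ_*`. -/
noncomputable def coindResolution : AdaptedResolution (gammaPush s ι K) where
  prop := frobEpi s ι K
  isStableUnderShift := frobEpi_isStableUnderShift
  -- The cone resolves `F[1]`, hence the shift back.
  functor := coindCone s ι K ⋙ shiftFunctor _ (-1 : ℤ)
  hom :=
    { app F := (shiftShiftNeg F (1 : ℤ)).inv ≫ (toCoindCone F)⟦(-1 : ℤ)⟧'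
      naturality F F' α := by
        have h := (shiftFunctorCompIsoId (CochainComplex (WeilSheaf s ι K) ℤ) (1 : ℤ) (-1)
          (by lia)).inv.naturality α
        have h' := congrArg (fun x ↦ x⟦(-1 : ℤ)⟧') (toCoindCone_naturality α)
        simp only [Functor.map_comp] at h'
        refine (Category.assoc _ _ _).symm.trans ((congrArg (· ≫ _) h).trans ?_)
        refine (Category.assoc _ _ _).trans ((congrArg (_ ≫ ·) h').trans ?_)
        exact (Category.assoc _ _ _).symm }
  prop_obj F i := frobEpi_coindCone F (i + -1)
  quasiIso_hom_app F :=
    have : QuasiIso ((toCoindCone F)⟦(-1 : ℤ)⟧') := inferInstance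
    quasiIso_comp (shiftShiftNeg F (1 : ℤ)).inv ((toCoindCone F)⟦(-1 : ℤ)⟧')
  quasiIso_map := quasiIso_gammaPushComplex_map

end Resolution

end WeilEtale

namespace WeilEtale

/-! ### Derived functors computed by a resolution of the shift -/

section ShiftedResolution

open DerivedCategory CochainComplex

universe v₁ v₂ u₁ u₂
variable {A : Type u₁} [Category.{v₁} A] [Abelian A] {B : Type u₂} [Category.{v₂} B] [Abelian B]
  {F : A ⥤ B} [F.Additive]

lemma map_comp_add_of_retract {X Y Z : A} {i : X ⟶ Z} {p : Z ⟶ X} {q : Z ⟶ Y} (h : i ≫ p = 𝟙 _)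
    (h' : i ≫ q = 0) {W : B} (x : F.obj X ⟶ W) (y : F.obj Y ⟶ W) :
    F.map i ≫ (F.map p ≫ x + F.map q ≫ y) = x := by
  rw [Preadditive.comp_add, ← Functor.map_comp_assoc, ← Functor.map_comp_assoc, h, h', F.map_id,
    F.map_zero, Category.id_comp, zero_comp, add_zero]

lemma map_toCone {G X Y : CochainComplex A ℤ} (a : G ⟶ X) (d : X ⟶ Y) (w : a ≫ d = 0)
    (w' : (F.mapHomologicalComplex (ComplexShape.up ℤ)).map a ≫
      (F.mapHomologicalComplex (ComplexShape.up ℤ)).map d = 0) :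
    ((F.mapHomologicalComplex (ComplexShape.up ℤ)).commShiftIso (1 : ℤ)).inv.app G ≫
      (F.mapHomologicalComplex (ComplexShape.up ℤ)).map (toCone a d w) ≫
        (mappingCone.mapHomologicalComplexIso d F).hom =
      toCone ((F.mapHomologicalComplex (ComplexShape.up ℤ)).map a)
        ((F.mapHomologicalComplex (ComplexShape.up ℤ)).map d) w' := by
  ext n
  refine (Category.id_comp _).trans ?_
  change F.map ((shiftX G n).hom ≫ a.f (n + 1) ≫ (mappingCone.inl d).v (n + 1) n (by lia)) ≫
    (mappingCone.mapHomologicalComplexXIso' d F n (n + 1) rfl).hom =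
      (shiftX ((F.mapHomologicalComplex (ComplexShape.up ℤ)).obj G) n).hom ≫ F.map (a.f (n + 1)) ≫
        (mappingCone.inl ((F.mapHomologicalComplex (ComplexShape.up ℤ)).map d)).v (n + 1) n (by lia)
  have h : F.map (shiftX G n).hom =
      (shiftX ((F.mapHomologicalComplex (ComplexShape.up ℤ)).obj G) n).hom := F.map_id _
  have h' : F.map ((mappingCone.inl d).v (n + 1) n (by lia)) ≫
      (mappingCone.mapHomologicalComplexXIso' d F n (n + 1) rfl).hom =
        (mappingCone.inl ((F.mapHomologicalComplex (ComplexShape.up ℤ)).map d)).v (n + 1) n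
          (by lia) :=
    map_comp_add_of_retract (mappingCone.inl_v_fst_v d _ _ _)
      (mappingCone.inl_v_snd_v d _ _ _) _ _
  rw [← h', ← h, Functor.map_comp, Functor.map_comp]
  exact (Category.assoc _ _ _).trans (congrArg (_ ≫ ·) (Category.assoc _ _ _))

variable [HasDerivedCategory.{w₁} A] [HasDerivedCategory.{w₂} B]

namespace TotalRightDerivedFunctor

variable (R : TotalRightDerivedFunctor F) {X Y : CochainComplex A ℤ} (i : X⟦(1 : ℤ)⟧ ⟶ Y)
  [QuasiIso i] [IsIso (R.unit.app Y)]

/-- The computation of the shift of the derived functor by an acyclic resolution of the shift. -/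
noncomputable def shiftIso :
    (R.functor.obj (Q.obj X))⟦(1 : ℤ)⟧ ≅
      Q.obj ((F.mapHomologicalComplex (ComplexShape.up ℤ)).obj Y) :=
  ((R.functor.commShiftIso (1 : ℤ)).app (Q.obj X)).symm ≪≫
    R.functor.mapIso (((Q.commShiftIso (1 : ℤ)).app X).symm ≪≫ asIso (Q.map i)) ≪≫
      (asIso (R.unit.app Y)).symm

/-- Compatibility of the unit with shifts and its naturality; this turns the shifted unit into a
morphism of complexes. -/
lemma unit_shiftIso_hom :
    (R.unit.app X)⟦(1 : ℤ)⟧' ≫ (R.shiftIso i).hom =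
      (Q.commShiftIso (1 : ℤ)).inv.app ((F.mapHomologicalComplex (ComplexShape.up ℤ)).obj X) ≫
        Q.map (((F.mapHomologicalComplex (ComplexShape.up ℤ)).commShiftIso (1 : ℤ)).inv.app X ≫
          (F.mapHomologicalComplex (ComplexShape.up ℤ)).map i) := by
  have := R.unit_commShift
  have h₁ := NatTrans.shift_app_comm R.unit (1 : ℤ) X
  have h₂ := R.unit.naturality i
  let T := F.mapHomologicalComplex (ComplexShape.up ℤ)
  have e₁ : ((T ⋙ Q).commShiftIso (1 : ℤ)).hom.app X =
      Q.map ((T.commShiftIso (1 : ℤ)).hom.app X) ≫ (Q.commShiftIso (1 : ℤ)).hom.app (T.obj X) :=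
    Functor.commShiftIso_comp_hom_app _ _ _ _
  have e₂ : ((Q ⋙ R.functor).commShiftIso (1 : ℤ)).hom.app X =
      R.functor.map ((Q.commShiftIso (1 : ℤ)).hom.app X) ≫
        (R.functor.commShiftIso (1 : ℤ)).hom.app (Q.obj X) :=
    Functor.commShiftIso_comp_hom_app _ _ _ _
  rw [e₁, e₂] at h₁
  have h₃ : Q.map ((T.commShiftIso (1 : ℤ)).hom.app X) ≫
      (Q.commShiftIso (1 : ℤ)).hom.app (T.obj X) ≫ (R.unit.app X)⟦(1 : ℤ)⟧' ≫
        (R.shiftIso i).hom = Q.map (T.map i) := by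
    rw [← Category.assoc, ← Category.assoc, ← cancel_mono (R.unit.app Y)]
    refine Eq.trans ?_ h₂.symm
    rw [Category.assoc]
    refine (congrArg (· ≫ _) h₁).trans ?_
    simp [shiftIso]
  rw [Functor.map_comp, ← h₃, ← Functor.map_comp_assoc, Iso.inv_hom_id_app]
  refine ((Q.commShiftIso (1 : ℤ)).inv_hom_id_app_assoc (T.obj X) _).symm.trans
    (congrArg ((Q.commShiftIso (1 : ℤ)).inv.app (T.obj X) ≫ ·) ?_)
  exact ((congrArg (· ≫ _) (Q.map_id _)).trans (Category.id_comp _)).symm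

end TotalRightDerivedFunctor

end ShiftedResolution

end WeilEtale

namespace WeilEtale

/-! ### The triangle `G ⟶ Rγ_* γ^* G ⟶ (G ⊗ ℚ)[-1]` -/

section FundamentalTriangle

open DerivedCategory CochainComplex Pretriangulated

variable {k : Type u} [Field k] [Fintype k] {S : Scheme.{u}} {s : S ⟶ Spec (.of k)} {E : Type u}
  [SmallCategory E] {ι : E ⥤ Over S} {K : Type u} [Field K] [Algebra k K] [IsAlgClosure k K]
variable [hE : IsEtaleFamily s ι]

lemma exact_of_isos {A : Type*} [Category* A] [Abelian A] {X Y Z X' Y' Z' : A} {f : X ⟶ Y}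
    {g : Y ⟶ Z} {w : f ≫ g = 0} (h : (ShortComplex.mk f g w).Exact) {f' : X' ⟶ Y'} {g' : Y' ⟶ Z'}
    {w' : f' ≫ g' = 0} (a : X' ≅ X) (b : Y' ≅ Y) (c : Z' ≅ Z)
    (hf : f' ≫ b.hom = a.hom ≫ f) (hg : g' ≫ c.hom = b.hom ≫ g) : (ShortComplex.mk f' g' w').Exact :=
  ShortComplex.exact_of_iso (ShortComplex.isoMk (S₁ := ShortComplex.mk f' g' w')
    (S₂ := ShortComplex.mk f g w) a b c hf.symm hg.symm).symm h

variable (ι) in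
/-- The functor `G ↦ G ⊗ ℚ` on complexes. -/
noncomputable abbrev tensorQComplex :
    CochainComplex (EtaleSheaf ι) ℤ ⥤ CochainComplex (EtaleSheaf ι) ℤ :=
  (tensorQ (etaleTopology ι)).mapHomologicalComplex (ComplexShape.up ℤ)

section

variable (s ι K) (G : CochainComplex (EtaleSheaf ι) ℤ)

/-- The complex `γ_* (coind (γ^* G))`. -/
noncomputable abbrev coindTerm : CochainComplex (EtaleSheaf ι) ℤ :=
  (gammaPushComplex s ι K).obj ((coindComplex s ι K).obj (gammaPullComplex s ι K G))

/-- The morphism `G ⟶ γ_* (coind (γ^* G))`. -/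
noncomputable def toCoindTerm : G ⟶ coindTerm s ι K G :=
  unitComplex s ι K G ≫ (gammaPushComplex s ι K).map (toCoindComplex (gammaPullComplex s ι K G))

/-- The endomorphism of `γ_* (coind (γ^* G))` induced by `coindDiff`. -/
noncomputable def coindTermDiff : coindTerm s ι K G ⟶ coindTerm s ι K G :=
  (gammaPushComplex s ι K).map ((coindDiffComplex s ι K).app (gammaPullComplex s ι K G))

/-- The projection `γ_* (coind (γ^* G)) ⟶ G ⊗ ℚ`. -/
noncomputable def ofCoindTerm : coindTerm s ι K G ⟶ (tensorQComplex ι).obj G where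
  f i := gammaCoind ((gammaPull s ι K).obj (G.X i)) ≫ (barToTensorQ s ι K).app (G.X i)
  comm' i j _ := by
    have h := gammaCoind_naturality ((gammaPull s ι K).map (G.d i j))
    have h' := (barToTensorQ s ι K).naturality (G.d i j)
    refine (Category.assoc _ _ _).trans ((congrArg (_ ≫ ·) h'.symm).trans ?_)
    refine (Category.assoc _ _ _).symm.trans ((congrArg (· ≫ _) h.symm).trans ?_)
    exact Category.assoc _ _ _

lemma map_toCoindComplex_comp :
    (gammaPushComplex s ι K).map (toCoindComplex (gammaPullComplex s ι K G)) ≫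
      (gammaPushComplex s ι K).map ((coindDiffComplex s ι K).app (gammaPullComplex s ι K G)) =
        0 := by
  rw [← Functor.map_comp, toCoindComplex_coindDiffComplex, Functor.map_zero]

lemma toCoindTerm_coindTermDiff : toCoindTerm s ι K G ≫ coindTermDiff s ι K G = 0 := by
  rw [toCoindTerm, coindTermDiff, Category.assoc, map_toCoindComplex_comp, comp_zero]

lemma hat_frobSubOne (G : EtaleSheaf ι) :
    hat (s := s) (K := K) G ≫ frobSubOne ((gammaPull s ι K).obj G) = 0 := by
  rw [hat, Category.assoc, gammaIncl_frobSubOne, comp_zero]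

/-- The invariants of the push-forward of `γ^* G` are `G`, because the unit is an isomorphism. -/
lemma hat_exact (G : EtaleSheaf ι) :
    (ShortComplex.mk _ _ (hat_frobSubOne s ι K G)).Exact :=
  exact_of_isos (gammaIncl_exact _) (asIso ((gammaAdj s ι K).unit.app G)) (Iso.refl _) (Iso.refl _)
    (Category.comp_id _) ((Category.comp_id _).trans (Category.id_comp _).symm)

/-- The isomorphism `gammaCoind` for a sheaf of the form `γ^* G`. -/
noncomputable def gammaCoindIso (G : EtaleSheaf ι) :
    (gammaPush s ι K).obj ((coind s ι K).obj ((gammaPull s ι K).obj G)) ≅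
      (barPush s ι K).obj ((gammaPull s ι K).obj G) :=
  asIso (gammaCoind _)

lemma toCoindTerm_f_gammaCoind (i : ℤ) :
    (toCoindTerm s ι K G).f i ≫ gammaCoind ((gammaPull s ι K).obj (G.X i)) = hat (G.X i) :=
  (Category.assoc _ _ _).trans (congrArg (_ ≫ ·) (gammaPush_toCoind_gammaCoind _))

lemma coindTermDiff_f_gammaCoind (i : ℤ) :
    (coindTermDiff s ι K G).f i ≫ gammaCoind ((gammaPull s ι K).obj (G.X i)) =
      gammaCoind _ ≫ frobSubOne _ :=
  gammaPush_coindDiff_gammaCoind _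

lemma coindTermDiff_ofCoindTerm : coindTermDiff s ι K G ≫ ofCoindTerm s ι K G = 0 := by
  ext i : 1
  refine (Category.assoc _ _ _).symm.trans
    ((congrArg (· ≫ _) (coindTermDiff_f_gammaCoind s ι K G i)).trans ?_)
  exact (Category.assoc _ _ _).trans
    ((congrArg (_ ≫ ·) (frobSubOne_barToTensorQ (G.X i))).trans comp_zero)

lemma toCoindTerm_ofCoindTerm (i : ℤ) :
    (toCoindTerm s ι K G ≫ ofCoindTerm s ι K G).f i =
      (toTensorQ (etaleTopology ι)).app (G.X i) := by
  have h : (toCoindTerm s ι K G ≫ ofCoindTerm s ι K G).f i =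
      ((toCoindTerm s ι K G).f i ≫ gammaCoind ((gammaPull s ι K).obj (G.X i))) ≫
        (barToTensorQ s ι K).app (G.X i) := (Category.assoc _ _ _).symm
  rw [h, toCoindTerm_f_gammaCoind]
  exact NatTrans.congr_app hatNat_barToTensorQ (G.X i)

/-- In each degree `gammaCoind` transforms the sequence into `hat` followed by `φ - 1`. The next
lemma uses the cokernel of `φ - 1` in the same way. -/
lemma toCoindTerm_exact :
    (ShortComplex.mk _ _ (toCoindTerm_coindTermDiff s ι K G)).Exact :=
  HomologicalComplex.exact_of_degreewise_exact _ fun i ↦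
    exact_of_isos (hat_exact s ι K (G.X i)) (Iso.refl (G.X i))
      (gammaCoindIso s ι K (G.X i))
      (gammaCoindIso s ι K (G.X i))
      ((toCoindTerm_f_gammaCoind s ι K G i).trans (Category.id_comp _).symm)
      (coindTermDiff_f_gammaCoind s ι K G i)

lemma coindTermDiff_exact :
    (ShortComplex.mk _ _ (coindTermDiff_ofCoindTerm s ι K G)).Exact :=
  HomologicalComplex.exact_of_degreewise_exact _ fun i ↦
    exact_of_isos (frobSubOne_barToTensorQ_exact (G.X i))
      (gammaCoindIso s ι K (G.X i))
      (gammaCoindIso s ι K (G.X i))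
      (Iso.refl ((tensorQ (etaleTopology ι)).obj (G.X i)))
      (coindTermDiff_f_gammaCoind s ι K G i) (Category.comp_id _)

instance : Mono (toCoindTerm s ι K G) := by
  refine HomologicalComplex.mono_of_mono_f _ fun i ↦ ?_
  have h : Mono (hat (s := s) (K := K) (G.X i)) :=
    have : Mono (gammaIncl ((gammaPull s ι K).obj (G.X i))) := inferInstance
    mono_comp _ _
  rw [← toCoindTerm_f_gammaCoind] at h
  exact @mono_of_mono _ _ _ _ _ _ _ h

instance : Epi (ofCoindTerm s ι K G) :=
  HomologicalComplex.epi_of_epi_f _ fun i ↦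
    inferInstanceAs (Epi (gammaCoind ((gammaPull s ι K).obj (G.X i)) ≫
      (barToTensorQ s ι K).app (G.X i)))

end

variable [HasDerivedCategory.{w₁} (WeilSheaf s ι K)] [HasDerivedCategory.{w₂} (EtaleSheaf ι)]
  (R : TotalRightDerivedFunctor (gammaPush s ι K))

instance (F : CochainComplex (WeilSheaf s ι K) ℤ) : IsIso (R.unit.app ((coindCone s ι K).obj F)) :=
  (coindResolution s ι K).isIso_unit_app R (frobEpi_coindCone F)

/-- The comparison of `γ_*` of the mapping cone of `coindDiff` with a mapping cone. -/
noncomputable def gammaCoindConeIso (F : CochainComplex (WeilSheaf s ι K) ℤ) :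
    (gammaPushComplex s ι K).obj ((coindCone s ι K).obj F) ≅
      mappingCone ((gammaPushComplex s ι K).map ((coindDiffComplex s ι K).app F)) :=
  mappingCone.mapHomologicalComplexIso ((coindDiffComplex s ι K).app F) (gammaPush s ι K)

/-- The computation of `Rγ_* F [1]` by the mapping cone of `coindDiff`. -/
noncomputable def derivedIso (F : CochainComplex (WeilSheaf s ι K) ℤ) :
    (R.functor.obj (Q.obj F))⟦(1 : ℤ)⟧ ≅
      Q.obj (mappingCone ((gammaPushComplex s ι K).map ((coindDiffComplex s ι K).app F))) :=
  R.shiftIso (toCoindCone F) ≪≫ Q.mapIso (gammaCoindConeIso F)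

/-- Replaces the adjunction map by the explicit inclusion of `G[1]` in a cone, to which
`exists_cone_triangle` applies. -/
lemma derivedUnit_derivedIso_hom (G : CochainComplex (EtaleSheaf ι) ℤ) :
    (derivedUnit R G)⟦(1 : ℤ)⟧' ≫ (derivedIso R (gammaPullComplex s ι K G)).hom =
      (Q.commShiftIso (1 : ℤ)).inv.app G ≫
        Q.map (toCone (toCoindTerm s ι K G) (coindTermDiff s ι K G)
          (toCoindTerm_coindTermDiff s ι K G)) := by
  let F := gammaPullComplex s ι K G
  have h₁ := R.unit_shiftIso_hom (toCoindCone F)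
  have h₂ : ((gammaPushComplex s ι K).commShiftIso (1 : ℤ)).inv.app F ≫
      (gammaPushComplex s ι K).map (toCoindCone F) ≫ (gammaCoindConeIso F).hom = _ :=
    map_toCone (toCoindComplex F) ((coindDiffComplex s ι K).app F)
      (toCoindComplex_coindDiffComplex F) (map_toCoindComplex_comp s ι K G)
  have h₃ := toCone_comp (unitComplex s ι K G) _ _ (map_toCoindComplex_comp s ι K G)
  have h₄ := (Q (C := EtaleSheaf ι)).commShiftIso_inv_naturality (unitComplex s ι K G) (1 : ℤ)
  rw [derivedUnit, derivedIso, Functor.map_comp, Iso.trans_hom, Category.assoc, reassoc_of% h₁,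
    Functor.mapIso_hom, reassoc_of% h₄, ← Functor.map_comp, ← Functor.map_comp, Category.assoc,
    h₂, h₃]
  rfl

/-- The projection of the mapping cone of `coindTermDiff` to `G ⊗ ℚ`. -/
noncomputable def ofCoindCone (G : CochainComplex (EtaleSheaf ι) ℤ) :
    mappingCone ((gammaPushComplex s ι K).map
      ((coindDiffComplex s ι K).app (gammaPullComplex s ι K G))) ⟶ (tensorQComplex ι).obj G :=
  mappingCone.desc (coindTermDiff s ι K G) 0 (ofCoindTerm s ι K G)
    (by simp [coindTermDiff_ofCoindTerm s ι K G])

lemma inr_ofCoindCone (G : CochainComplex (EtaleSheaf ι) ℤ) :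
    mappingCone.inr _ ≫ ofCoindCone G = ofCoindTerm s ι K G :=
  mappingCone.inr_desc _ _ _ _

lemma exists_derivedUnit_shift_triangle (G : CochainComplex (EtaleSheaf ι) ℤ) :
    ∃ δ, Triangle.mk ((derivedUnit R G)⟦(1 : ℤ)⟧')
      ((derivedIso R (gammaPullComplex s ι K G)).hom ≫
        Q.map (ofCoindCone G)) δ ∈
        distTriang (DerivedCategory (EtaleSheaf ι)) := by
  obtain ⟨δ, hδ⟩ := exists_cone_triangle _ _ _ (toCoindTerm_coindTermDiff s ι K G)
    (coindTermDiff_ofCoindTerm s ι K G) (toCoindTerm_exact s ι K G) (coindTermDiff_exact s ι K G)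
  let a : (Q.obj G)⟦(1 : ℤ)⟧ ≅ Q.obj (G⟦(1 : ℤ)⟧) := ((Q.commShiftIso (1 : ℤ)).app G).symm
  refine ⟨δ ≫ a.inv⟦(1 : ℤ)⟧', distinguished_of_isos hδ a
    (derivedIso R (gammaPullComplex s ι K G)) (Iso.refl _) (derivedUnit_derivedIso_hom R G)
    (Category.comp_id _) ?_⟩
  rw [Category.assoc, ← Functor.map_comp, a.inv_hom_id]
  refine (congrArg (δ ≫ ·) ((CategoryTheory.shiftFunctor _ (1 : ℤ)).map_id _)).trans ?_
  exact (Category.comp_id _).trans (Category.id_comp _).symm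

end FundamentalTriangle

end WeilEtale

namespace WeilEtale

/-! ### The connecting morphism in terms of the cone -/

section ConnectingMorphism

open DerivedCategory CochainComplex HomComplex Pretriangulated

universe v u₁
variable {A : Type u₁} [Category.{v} A] [Abelian A] {G X Y : CochainComplex A ℤ}

/-- The connecting morphism of a mapping cone. -/
noncomputable def coneToShift (a : G ⟶ X) : mappingCone a ⟶ G⟦(1 : ℤ)⟧ :=
  (mappingCone.triangle a).mor₃

lemma inl_v_coneToShift_f (a : G ⟶ X) (n : ℤ) :
    (mappingCone.inl a).v (n + 1) n (by lia) ≫ (coneToShift a).f n = -(shiftX G n).inv :=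
  mappingCone.inl_v_triangle_mor₃_f a (n + 1) n (by lia)

lemma inr_f_coneToShift_f (a : G ⟶ X) (n : ℤ) :
    (mappingCone.inr a).f n ≫ (coneToShift a).f n = 0 :=
  mappingCone.inr_f_triangle_mor₃_f a n

/-- The homotopy is `snd` of the first cone followed by `inl` of the second. -/
lemma nonempty_homotopy_toCone (a : G ⟶ X) (d : X ⟶ Y) (w : a ≫ d = 0) :
    Nonempty (Homotopy (mappingCone.desc a 0 d (by simp [w]) ≫ mappingCone.inr d)
      (coneToShift a ≫ toCone a d w)) := by
  refine ⟨(Cochain.equivHomotopy _ _).symm ⟨(mappingCone.snd a).comp (mappingCone.inl d)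
    (zero_add (-1)), ?_⟩⟩
  rw [δ_zero_cochain_comp _ _ _ (neg_add_cancel 1), mappingCone.δ_inl, mappingCone.δ_snd]
  ext n
  have h : (-(mappingCone.fst a).1.comp (Cochain.ofHom a) (add_zero 1)).comp (mappingCone.inl d)
      (add_neg_cancel 1) = -(mappingCone.fst a).1.comp ((Cochain.ofHom a).comp (mappingCone.inl d)
        (zero_add (-1))) (add_neg_cancel 1) := by
    rw [Cochain.neg_comp, Cochain.comp_assoc_of_second_is_zero_cochain]
  rw [h, Cochain.add_v, Cochain.add_v, Cochain.units_smul_v, Cochain.neg_v,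
    Cochain.comp_v _ _ (add_neg_cancel 1) n (n + 1) n rfl (by lia), Cochain.ofHom_v, Cochain.ofHom_v,
    Cochain.zero_cochain_comp_v, Cochain.zero_cochain_comp_v, Cochain.ofHom_v, Cochain.ofHom_v,
    HomologicalComplex.comp_f, HomologicalComplex.comp_f, HomologicalComplex.comp_f,
    Int.negOnePow_neg, Int.negOnePow_one, Units.neg_smul, one_smul, neg_neg,
    mappingCone.ext_from_iff _ (n + 1) n rfl]
  constructor
  · rw [mappingCone.inl_v_desc_f_assoc, Preadditive.comp_add, Preadditive.comp_add,
      reassoc_of% inl_v_coneToShift_f, toCone_f]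
    simp [-shiftFunctor_obj_X']
  · rw [mappingCone.inr_f_desc_f_assoc, Preadditive.comp_add, Preadditive.comp_add,
      reassoc_of% inr_f_coneToShift_f]
    simp [-shiftFunctor_obj_X']

variable [HasDerivedCategory.{w₁} A]

/-- The connecting morphism arises by inverting the quasi-isomorphism from the cone of `a` to `Y`;
after composition with it, only the preceding homotopy is needed. -/
lemma triangleOfSESδ_toCone {a : G ⟶ X} {d : X ⟶ Y} {w : a ≫ d = 0}
    (hS : (ShortComplex.mk a d w).ShortExact) :
    triangleOfSESδ hS ≫ (Q.commShiftIso (1 : ℤ)).inv.app G ≫ Q.map (toCone a d w) =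
      Q.map (mappingCone.inr d) := by
  have hq := quasiIso_desc hS
  have h₁ : Q.map (mappingCone.desc a 0 d (by simp [w])) ≫ triangleOfSESδ hS =
      Q.map (coneToShift a) ≫ (Q.commShiftIso (1 : ℤ)).hom.app G :=
    descShortComplex_triangleOfSESδ hS
  have h₂ : Q.map (mappingCone.desc a 0 d (by simp [w])) ≫ Q.map (mappingCone.inr d) =
      Q.map (coneToShift a) ≫ Q.map (toCone a d w) := by
    rw [← Functor.map_comp, ← Functor.map_comp]
    exact Q_map_eq_of_homotopy _ (nonempty_homotopy_toCone a d w).some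
  rw [← cancel_epi (Q.map (mappingCone.desc a 0 d (by simp [w]))), h₂, ← Category.assoc, h₁,
    Category.assoc, Iso.hom_inv_id_app_assoc]

end ConnectingMorphism

end WeilEtale

namespace WeilEtale

/-! ### Cup product with `e` -/

section CupProduct

open DerivedCategory CochainComplex Pretriangulated

variable {k : Type u} [Field k] [Fintype k] {S : Scheme.{u}} {s : S ⟶ Spec (.of k)} {E : Type u}
  [SmallCategory E] {ι : E ⥤ Over S} {K : Type u} [Field K] [Algebra k K] [IsAlgClosure k K]
variable [hE : IsEtaleFamily s ι]
variable [HasDerivedCategory.{w₁} (WeilSheaf s ι K)] [HasDerivedCategory.{w₂} (EtaleSheaf ι)]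

/-- The morphism from the sequence of `F ⊗ N` to the sequence of `coind F`. -/
noncomputable def tensorNSequenceHom (F : CochainComplex (WeilSheaf s ι K) ℤ) :
    tensorNComplexSequence s ι K F ⟶ ShortComplex.mk _ _ (toCoindComplex_coindDiffComplex F) where
  τ₁ := 𝟙 F
  τ₂ := (NatTrans.mapHomologicalComplex (tensorNToCoind s ι K) (ComplexShape.up ℤ)).app F
  τ₃ := -toCoindComplex F
  comm₁₂ := (Category.id_comp _).trans (HomologicalComplex.hom_ext _ _ fun i ↦
    (toTensorN_tensorNToCoind (F.X i)).symm)
  comm₂₃ := HomologicalComplex.hom_ext _ _ fun i ↦ tensorNToCoind_coindDiff (F.X i)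

/-- Naturality of the connecting morphism for `tensorNSequenceHom`, which is the identity on the sub
and `-toCoind` on the quotient. -/
lemma cupE_eq (F : CochainComplex (WeilSheaf s ι K) ℤ) :
    cupE s ι K F = Q.map (-toCoindComplex F) ≫ triangleOfSESδ (toCoindComplex_shortExact F) := by
  have h := triangleOfSESδ_naturality (tensorNComplexSequence_shortExact s ι K F)
    (toCoindComplex_shortExact F) (tensorNSequenceHom F)
  have h₁ : (Q.map (tensorNSequenceHom F).τ₁)⟦(1 : ℤ)⟧' = 𝟙 ((Q.obj F)⟦(1 : ℤ)⟧) :=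
    (congrArg _ (Q.map_id F)).trans ((CategoryTheory.shiftFunctor _ (1 : ℤ)).map_id _)
  exact (Category.comp_id _).symm.trans ((congrArg (cupE s ι K F ≫ ·) h₁.symm).trans h)

/-- The two consecutive maps of the coinduction triangle in the middle of the composite compose to
zero. -/
lemma cupE_comp_shift (F : CochainComplex (WeilSheaf s ι K) ℤ) :
    cupE s ι K F ≫ (cupE s ι K F)⟦(1 : ℤ)⟧' = 0 := by
  have h : triangleOfSESδ (toCoindComplex_shortExact F) ≫ (Q.map (toCoindComplex F))⟦(1 : ℤ)⟧' = 0 :=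
    comp_distTriang_mor_zero₃₁ _ (triangleOfSES_distinguished (toCoindComplex_shortExact F))
  rw [cupE_eq, Functor.map_neg, Functor.map_comp, Functor.map_neg, Category.assoc,
    Preadditive.comp_neg_assoc, h, neg_zero, zero_comp, comp_zero]

/-- The inclusion of `coind F` in the mapping cone of `coindDiff`. -/
noncomputable def coindConeInr (F : CochainComplex (WeilSheaf s ι K) ℤ) :
    (coindComplex s ι K).obj F ⟶ (coindCone s ι K).obj F :=
  mappingCone.inr _

lemma cupE_toCoindCone (F : CochainComplex (WeilSheaf s ι K) ℤ) :
    cupE s ι K F ≫ (Q.commShiftIso (1 : ℤ)).inv.app F ≫ Q.map (toCoindCone F) =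
      Q.map (-(toCoindComplex F ≫ coindConeInr F)) := by
  have h : triangleOfSESδ (toCoindComplex_shortExact F) ≫ (Q.commShiftIso (1 : ℤ)).inv.app F ≫
      Q.map (toCoindCone F) = Q.map (coindConeInr F) :=
    triangleOfSESδ_toCone (toCoindComplex_shortExact F)
  rw [cupE_eq, ← Preadditive.neg_comp, Functor.map_comp, ← h]
  exact Category.assoc _ _ _

variable (R : TotalRightDerivedFunctor (gammaPush s ι K))

lemma gammaPush_map_coindConeInr (F : CochainComplex (WeilSheaf s ι K) ℤ) :
    (gammaPushComplex s ι K).map (coindConeInr F) ≫ (gammaCoindConeIso F).hom =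
      mappingCone.inr ((gammaPushComplex s ι K).map ((coindDiffComplex s ι K).app F)) :=
  mappingCone.map_inr _ _

lemma unit_derivedCupE_derivedIso (F : CochainComplex (WeilSheaf s ι K) ℤ) :
    R.unit.app F ≫ derivedCupE R F ≫ (derivedIso R F).hom =
      Q.map (-((gammaPushComplex s ι K).map (toCoindComplex F) ≫
        mappingCone.inr ((gammaPushComplex s ι K).map ((coindDiffComplex s ι K).app F)))) := by
  let x : F ⟶ (coindCone s ι K).obj F := -(toCoindComplex F ≫ coindConeInr F)
  have h₁ : derivedCupE R F ≫ (R.shiftIso (toCoindCone F)).hom =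
      R.functor.map (Q.map x) ≫ inv (R.unit.app ((coindCone s ι K).obj F)) := by
    rw [← cupE_toCoindCone]
    simp [derivedCupE, TotalRightDerivedFunctor.shiftIso]
  have h₂ : Q.map ((gammaPushComplex s ι K).map x) ≫ R.unit.app ((coindCone s ι K).obj F) =
      R.unit.app F ≫ R.functor.map (Q.map x) := R.unit.naturality x
  have h₃ : (derivedIso R F).hom = (R.shiftIso (toCoindCone F)).hom ≫
    Q.map (gammaCoindConeIso F).hom := rfl
  have h₄ : (gammaPushComplex s ι K).map x ≫ (gammaCoindConeIso F).hom =
      -((gammaPushComplex s ι K).map (toCoindComplex F) ≫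
        mappingCone.inr ((gammaPushComplex s ι K).map ((coindDiffComplex s ι K).app F))) := by
    rw [← gammaPush_map_coindConeInr, Functor.map_neg, Functor.map_comp, Preadditive.neg_comp,
      Category.assoc]
  rw [h₃, reassoc_of% h₁, ← reassoc_of% h₂, IsIso.hom_inv_id_assoc, ← Functor.map_comp, h₄]

/-- Restricted to `G`, the cup product lands in the part `inr` of the cone, where the projection to
`G ⊗ ℚ` is explicit. By `toCoindTerm_ofCoindTerm` the result is minus the canonical map. -/
lemma derivedUnit_derivedCupE (G : CochainComplex (EtaleSheaf ι) ℤ) :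
    derivedUnit R G ≫ derivedCupE R (gammaPullComplex s ι K G) ≫
      (derivedIso R (gammaPullComplex s ι K G)).hom ≫ Q.map (ofCoindCone G) =
      Q.map (-(toCoindTerm s ι K G ≫ ofCoindTerm s ι K G)) := by
  have h := unit_derivedCupE_derivedIso R (gammaPullComplex s ι K G)
  rw [derivedUnit, Category.assoc, reassoc_of% h, ← Functor.map_comp, ← Functor.map_comp,
    Preadditive.neg_comp, Category.assoc, inr_ofCoindCone, Preadditive.comp_neg, toCoindTerm,
    Category.assoc]

end CupProduct

end WeilEtale

namespace WeilEtale

/-! ### Complexes with torsion or rational cohomology -/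

section Conclusions

open DerivedCategory CochainComplex Pretriangulated

variable {k : Type u} [Field k] [Fintype k] {S : Scheme.{u}} {s : S ⟶ Spec (.of k)} {E : Type u}
  [SmallCategory E] {ι : E ⥤ Over S} {K : Type u} [Field K] [Algebra k K] [IsAlgClosure k K]
variable [hE : IsEtaleFamily s ι]

/-- Tensoring with `ℚ` commutes with homology, so only the homology sheaf, and not the terms of the
complex, has to be rational. -/
lemma isIso_homologyMap_toTensorQ {C : Type u} [SmallCategory C] {J : GrothendieckTopology C}
    (T : ShortComplex (Sheaf J AddCommGrpCat.{u})) (hT : IsRationalSheaf J T.homology) :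
    IsIso (ShortComplex.homologyMap (T.mapNatTrans (toTensorQ J))) := by
  have h : IsIso ((toTensorQ J).app T.homology) := hT.uniquelyDivisible.isIso
  have h' : ShortComplex.homologyMap (T.mapNatTrans (toTensorQ J)) =
      (T.mapHomologyIso (𝟭 _)).hom ≫ (toTensorQ J).app T.homology ≫
        (T.mapHomologyIso (tensorQ J)).inv := by
    rw [NatTrans.app_homology]
    simp only [Category.assoc, Iso.hom_inv_id, Category.comp_id]
    exact (Iso.hom_inv_id_assoc _ _).symm
  rw [h']
  infer_instance

lemma quasiIso_toCoindTerm_ofCoindTerm (G : CochainComplex (EtaleSheaf ι) ℤ)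
    (hG : ∀ i, IsRationalSheaf _ (G.homology i)) :
    QuasiIso (toCoindTerm s ι K G ≫ ofCoindTerm s ι K G) := by
  refine ⟨fun i ↦ ?_⟩
  rw [quasiIsoAt_iff_isIso_homologyMap]
  have h : (HomologicalComplex.shortComplexFunctor _ _ i).map
      (toCoindTerm s ι K G ≫ ofCoindTerm s ι K G) = (G.sc i).mapNatTrans (toTensorQ _) := by
    ext1 <;> exact toCoindTerm_ofCoindTerm s ι K G _
  change IsIso (ShortComplex.homologyMap ((HomologicalComplex.shortComplexFunctor _ _ i).map
      (toCoindTerm s ι K G ≫ ofCoindTerm s ι K G)))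
  rw [h]
  exact isIso_homologyMap_toTensorQ _ (hG i)

lemma isZero_Q_obj_tensorQComplex [HasDerivedCategory.{w₂} (EtaleSheaf ι)]
    (G : CochainComplex (EtaleSheaf ι) ℤ) (hG : ∀ i, IsTorsionSheaf _ (G.homology i)) :
    IsZero (Q.obj ((tensorQComplex ι).obj G)) := by
  have h (i : ℤ) : IsZero (((tensorQComplex ι).obj G).homology i) :=
    ((hG i).isZero).of_iso ((G.sc i).mapHomologyIso (tensorQ (etaleTopology ι)))
  obtain ⟨Z, hZ⟩ : ∃ Z : CochainComplex (EtaleSheaf ι) ℤ, IsZero Z := ⟨_, isZero_zero _⟩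
  have hq : QuasiIso (0 : (tensorQComplex ι).obj G ⟶ Z) := by
    refine ⟨fun i ↦ ?_⟩
    rw [quasiIsoAt_iff_isIso_homologyMap]
    exact (h i).isIso ((HomologicalComplex.homologyFunctor _ _ i).map_isZero hZ) _
  exact (Q.map_isZero hZ).of_iso (asIso (Q.map (0 : (tensorQComplex ι).obj G ⟶ Z)))

variable [HasDerivedCategory.{w₁} (WeilSheaf s ι K)] [HasDerivedCategory.{w₂} (EtaleSheaf ι)]
  (R : TotalRightDerivedFunctor (gammaPush s ι K))

/-- Additivity is not part of the structure of `R`; but a zero morphism factors through a zero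
complex, which is adapted and so is sent to a zero object. -/
lemma derivedFunctor_map_zero {X Y : DerivedCategory (WeilSheaf s ι K)} :
    R.functor.map (0 : X ⟶ Y) = 0 := by
  obtain ⟨Z, hZ⟩ : ∃ Z : CochainComplex (WeilSheaf s ι K) ℤ, IsZero Z := ⟨_, isZero_zero _⟩
  have hZ' : frobEpi s ι K Z := fun i ↦ by
    have h := (HomologicalComplex.eval _ _ i ⋙ barPush s ι K).map_isZero hZ
    exact ⟨fun _ _ _ ↦ h.eq_of_src _ _⟩
  have := (coindResolution s ι K).isIso_unit_app R hZ'
  have h : IsZero (R.functor.obj (Q.obj Z)) :=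
    ((gammaPushComplex s ι K ⋙ Q).map_isZero hZ).of_iso (asIso (R.unit.app Z)).symm
  rw [← comp_zero (X := X) (Y := Q.obj Z) (f := 0), Functor.map_comp, h.eq_of_tgt (R.functor.map _) 0,
    zero_comp]

lemma derivedCupE_comp_shift (F : CochainComplex (WeilSheaf s ι K) ℤ) :
    derivedCupE R F ≫ (derivedCupE R F)⟦(1 : ℤ)⟧' = 0 := by
  have h := R.functor.commShiftIso_hom_naturality (cupE s ι K F) (1 : ℤ)
  rw [derivedCupE, Functor.map_comp, Category.assoc, ← reassoc_of% h, ← Functor.map_comp_assoc,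
    cupE_comp_shift, derivedFunctor_map_zero, zero_comp]

lemma exists_derivedUnit_triangle (G : CochainComplex (EtaleSheaf ι) ℤ) :
    ∃ p δ, Triangle.mk (derivedUnit R G) (p : _ ⟶ (Q.obj ((tensorQComplex ι).obj G))⟦(-1 : ℤ)⟧) δ ∈
      distTriang (DerivedCategory (EtaleSheaf ι)) := by
  obtain ⟨δ, hδ⟩ := exists_derivedUnit_shift_triangle R G
  exact ⟨_, exists_desuspension hδ⟩

lemma isIso_derivedUnit (G : CochainComplex (EtaleSheaf ι) ℤ)
    (hG : ∀ i, IsTorsionSheaf _ (G.homology i)) : IsIso (derivedUnit R G) := by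
  obtain ⟨p, δ, hδ⟩ := exists_derivedUnit_triangle R G
  exact (Triangle.isZero₃_iff_isIso₁ _ hδ).1
    ((CategoryTheory.shiftFunctor _ (-1 : ℤ)).map_isZero (isZero_Q_obj_tensorQComplex G hG))

lemma exists_derivedIso_biprod (G : CochainComplex (EtaleSheaf ι) ℤ)
    (hG : ∀ i, IsRationalSheaf _ (G.homology i)) :
    ∃ Φ : R.functor.obj (Q.obj (gammaPullComplex s ι K G)) ≅ Q.obj G ⊞ (Q.obj G)⟦(-1 : ℤ)⟧,
      derivedUnit R G ≫ Φ.hom = biprod.inl ∧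
      derivedCupE R (gammaPullComplex s ι K G) ≫ Φ.hom⟦(1 : ℤ)⟧' =
        Φ.hom ≫ biprod.fst ≫ (shiftNegShift (Q.obj G) (1 : ℤ)).inv ≫
          (biprod.inr : _ ⟶ Q.obj G ⊞ (Q.obj G)⟦(-1 : ℤ)⟧)⟦(1 : ℤ)⟧' := by
  obtain ⟨δ, hδ⟩ := exists_derivedUnit_shift_triangle R G
  refine exists_iso_biprod hδ _ (derivedCupE_comp_shift R _) ?_
  have := quasiIso_toCoindTerm_ofCoindTerm (s := s) (K := K) G hG
  have h : IsIso (Q.map (toCoindTerm s ι K G ≫ ofCoindTerm s ι K G)) := inferInstance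
  rw [derivedUnit_derivedCupE, Functor.map_neg]
  exact ⟨-inv (Q.map (toCoindTerm s ι K G ≫ ofCoindTerm s ι K G)), by simp, by simp⟩

end Conclusions

end WeilEtale

namespace WeilEtale

/-! ### The constant sheaves `ℤ` and `ℚ` -/

section Rational

variable {C : Type u} [SmallCategory C] {J : GrothendieckTopology C}

lemma isRationalSheaf_of_ringHom {G : Sheaf J AddCommGrpCat.{u}} (r : ℚ →+* End G) :
    IsRationalSheaf J G := fun V ↦
  ⟨Module.compHom (G.obj.obj V) (R := AddMonoid.End (G.obj.obj V)) (RingHom.comp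
    { toFun := fun f : End G ↦ (f.hom.app V).hom
      map_one' := rfl
      map_mul' := fun _ _ ↦ rfl
      map_zero' := rfl
      map_add' := fun _ _ ↦ rfl } r)⟩

variable (J) in
/-- A functor of abelian groups with values in sheaves maps `ℚ` to a sheaf of vector spaces. -/
lemma isRationalSheaf_functor_obj (T : AddCommGrpCat.{u} ⥤ Sheaf J AddCommGrpCat.{u})
    [T.Additive] : IsRationalSheaf J (T.obj (.of (ULift.{u} ℚ))) := by
  let r : ℚ →+* End (AddCommGrpCat.of (ULift.{u} ℚ)) :=
    { toFun := fun x ↦ AddCommGrpCat.ofHom (AddMonoidHom.mk' (fun y ↦ ⟨x * y.down⟩)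
        fun _ _ ↦ ULift.ext _ _ (mul_add _ _ _))
      map_one' := AddCommGrpCat.hom_ext (AddMonoidHom.ext fun y ↦ ULift.ext _ _ (one_mul _))
      map_mul' := fun a b ↦ AddCommGrpCat.hom_ext (AddMonoidHom.ext fun y ↦ ULift.ext _ _ (mul_assoc _ _ _))
      map_zero' := AddCommGrpCat.hom_ext (AddMonoidHom.ext fun y ↦ ULift.ext _ _ (zero_mul _))
      map_add' := fun a b ↦ AddCommGrpCat.hom_ext (AddMonoidHom.ext fun y ↦ ULift.ext _ _ (add_mul _ _ _)) }
  exact isRationalSheaf_of_ringHom (RingHom.comp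
    { toFun := fun f : End (AddCommGrpCat.of (ULift.{u} ℚ)) ↦ (T.map f : End (T.obj _))
      map_one' := T.map_id _
      map_mul' := fun f g ↦ T.map_comp g f
      map_zero' := T.map_zero _ _
      map_add' := fun f g ↦ T.map_add } r)

instance : (constantSheaf J AddCommGrpCat.{u}).Additive := by
  have : (Functor.const Cᵒᵖ (C := AddCommGrpCat.{u})).Additive := ⟨by intros; rfl⟩
  have : (presheafToSheaf J AddCommGrpCat.{u}).Additive := inferInstance
  unfold constantSheaf
  infer_instance

lemma isRationalSheaf_homology_single_constQ (i : ℤ) :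
    IsRationalSheaf J (((HomologicalComplex.single _ (ComplexShape.up ℤ) 0).obj
      (constQ J)).homology i) :=
  isRationalSheaf_functor_obj J (constantSheaf J AddCommGrpCat.{u} ⋙
    HomologicalComplex.single _ (ComplexShape.up ℤ) 0 ⋙
      HomologicalComplex.homologyFunctor _ (ComplexShape.up ℤ) i)

end Rational

section Constant

open DerivedCategory Pretriangulated

variable {k : Type u} [Field k] [Fintype k] {S : Scheme.{u}} {s : S ⟶ Spec (.of k)} {E : Type u}
  [SmallCategory E] {ι : E ⥤ Over S} {K : Type u} [Field K] [Algebra k K] [IsAlgClosure k K]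
variable [hE : IsEtaleFamily s ι]

variable (s ι K) in
lemma nonempty_gammaPush_constZ_iso :
    Nonempty ((gammaPush s ι K).obj (constZ (weilTopology s ι K)) ≅ constZ (etaleTopology ι)) := by
  obtain ⟨e⟩ := nonempty_gammaPull_constantSheaf_iso (s := s) (ι := ι) (K := K) (.of (ULift.{u} ℤ))
  exact ⟨(gammaPush s ι K).mapIso e.symm ≪≫
    (asIso ((gammaAdj s ι K).unit.app (constZ (etaleTopology ι)))).symm⟩

/-- The complex `γ^* G` for a sheaf `G`. -/
noncomputable def gammaPullSingleIso (G : EtaleSheaf ι) :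
    gammaPullComplex s ι K ((HomologicalComplex.single _ _ 0).obj G) ≅
      (HomologicalComplex.single _ _ 0).obj ((gammaPull s ι K).obj G) :=
  (HomologicalComplex.singleMapHomologicalComplex (gammaPull s ι K) (ComplexShape.up ℤ) 0).app G

variable [HasDerivedCategory.{w₁} (WeilSheaf s ι K)] [HasDerivedCategory.{w₂} (EtaleSheaf ι)]
  (R : TotalRightDerivedFunctor (gammaPush s ι K))

lemma nonempty_derived_constQ_iso :
    Nonempty (R.functor.obj
      ((singleFunctor (WeilSheaf s ι K) 0).obj (constQ (weilTopology s ι K))) ≅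
        (singleFunctor (EtaleSheaf ι) 0).obj (constQ (etaleTopology ι)) ⊞
          ((singleFunctor (EtaleSheaf ι) 0).obj (constQ (etaleTopology ι)))⟦(-1 : ℤ)⟧) := by
  obtain ⟨e⟩ := nonempty_gammaPull_constantSheaf_iso (s := s) (ι := ι) (K := K) (.of (ULift.{u} ℚ))
  obtain ⟨Φ, -⟩ := exists_derivedIso_biprod R
    ((HomologicalComplex.single _ (ComplexShape.up ℤ) 0).obj (constQ (etaleTopology ι)))
    isRationalSheaf_homology_single_constQ
  exact ⟨R.functor.mapIso (Q.mapIso ((HomologicalComplex.single _ _ 0).mapIso e.symm ≪≫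
    (gammaPullSingleIso _).symm)) ≪≫ Φ⟩

lemma isZero_homology_single (G : EtaleSheaf ι) (i : ℤ) (hi : i ≠ 0) :
    IsZero ((homologyFunctor (EtaleSheaf ι) i).obj
      (Q.obj ((HomologicalComplex.single _ (ComplexShape.up ℤ) 0).obj G))) :=
  (HomologicalComplex.isZero_single_obj_homology _ _ G i hi).of_iso
    ((homologyFunctorFactors _ i).app _)

/-- Long exact sequence of the triangle: a sheaf in degree `0` has no cohomology in degrees `1` and
`2`, so the first cohomology is that of the third term, which is `G ⊗ ℚ` placed in degree `1`. -/
lemma nonempty_homology_derived_iso (G : EtaleSheaf ι) :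
    Nonempty ((homologyFunctor (EtaleSheaf ι) 1).obj (R.functor.obj (Q.obj
      (gammaPullComplex s ι K ((HomologicalComplex.single _ (ComplexShape.up ℤ) 0).obj G)))) ≅
        (tensorQ (etaleTopology ι)).obj G) := by
  obtain ⟨p, δ, hT⟩ := exists_derivedUnit_triangle R
    ((HomologicalComplex.single _ (ComplexShape.up ℤ) 0).obj G)
  have h₁ : Mono ((homologyFunctor (EtaleSheaf ι) 1).map p) :=
    (HomologySequence.mono_homologyMap_mor₂_iff _ hT 1).2
      ((isZero_homology_single G 1 (by lia)).eq_of_src _ _)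
  have h₂ : Epi ((homologyFunctor (EtaleSheaf ι) 1).map p) :=
    (HomologySequence.epi_homologyMap_mor₂_iff _ hT 1 2 (by lia)).2
      ((isZero_homology_single G 2 (by lia)).eq_of_tgt _ _)
  have : IsIso ((homologyFunctor (EtaleSheaf ι) 1).map p) := isIso_of_mono_of_epi _
  let e : (tensorQComplex ι).obj ((HomologicalComplex.single _ (ComplexShape.up ℤ) 0).obj G) ≅
      (HomologicalComplex.single _ (ComplexShape.up ℤ) 0).obj ((tensorQ (etaleTopology ι)).obj G) :=
    (HomologicalComplex.singleMapHomologicalComplex (tensorQ (etaleTopology ι))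
      (ComplexShape.up ℤ) 0).app G
  exact ⟨asIso ((homologyFunctor (EtaleSheaf ι) 1).map p) ≪≫
    ((homologyFunctor (EtaleSheaf ι) 0).shiftIso (-1 : ℤ) 1 0 (by lia)).app _ ≪≫
    (homologyFunctorFactors (EtaleSheaf ι) 0).app _ ≪≫
    (HomologicalComplex.homologyFunctor _ _ 0).mapIso e ≪≫
    HomologicalComplex.singleObjHomologySelfIso _ _ _⟩

lemma nonempty_homology_derived_constZ_iso :
    Nonempty ((homologyFunctor (EtaleSheaf ι) 1).obj (R.functor.obj
      ((singleFunctor (WeilSheaf s ι K) 0).obj (constZ (weilTopology s ι K)))) ≅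
        constQ (etaleTopology ι)) := by
  obtain ⟨e⟩ := nonempty_gammaPull_constantSheaf_iso (s := s) (ι := ι) (K := K) (.of (ULift.{u} ℤ))
  obtain ⟨e₁⟩ := nonempty_homology_derived_iso R (constZ (etaleTopology ι))
  obtain ⟨e₂⟩ := nonempty_tensorQ_constZ_iso (etaleTopology ι)
  exact ⟨(homologyFunctor (EtaleSheaf ι) 1).mapIso (R.functor.mapIso (Q.mapIso
    ((HomologicalComplex.single _ _ 0).mapIso e.symm ≪≫ (gammaPullSingleIso _).symm))) ≪≫ e₁ ≪≫ e₂⟩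

end Constant

end WeilEtale

theorem mainTheorem6 {k : Type u} [Field k] [Fintype k] {S : Scheme.{u}} (s : S ⟶ Spec (.of k))
    {E : Type u} [SmallCategory E] (ι : E ⥤ Over S) [IsEtaleFamily s ι]
    (K : Type u) [Field K] [Algebra k K] [IsAlgClosure k K]
    [HasDerivedCategory.{w₁} (WeilSheaf s ι K)] [HasDerivedCategory.{w₂} (EtaleSheaf ι)] :
    Nonempty ((gammaPush s ι K).obj (constZ (weilTopology s ι K)) ≅ constZ (etaleTopology ι)) ∧
    Nonempty (TotalRightDerivedFunctor (gammaPush s ι K)) ∧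
    ∀ R : TotalRightDerivedFunctor (gammaPush s ι K),
      Nonempty ((homologyFunctor (EtaleSheaf ι) 1).obj (R.functor.obj
        ((singleFunctor (WeilSheaf s ι K) 0).obj (constZ (weilTopology s ι K)))) ≅
          constQ (etaleTopology ι)) ∧
      Nonempty (R.functor.obj
        ((singleFunctor (WeilSheaf s ι K) 0).obj (constQ (weilTopology s ι K))) ≅
          (singleFunctor (EtaleSheaf ι) 0).obj (constQ (etaleTopology ι)) ⊞
            ((singleFunctor (EtaleSheaf ι) 0).obj (constQ (etaleTopology ι)))⟦(-1 : ℤ)⟧) ∧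
      ∀ G : CochainComplex (EtaleSheaf ι) ℤ,
        (∃ p δ, Triangle.mk (derivedUnit R G)
          (p : _ ⟶ (Q.obj (((tensorQ (etaleTopology ι)).mapHomologicalComplex _).obj G))⟦(-1 : ℤ)⟧)
            δ ∈ distTriang (DerivedCategory (EtaleSheaf ι))) ∧
        ((∀ i, IsTorsionSheaf _ (G.homology i)) → IsIso (derivedUnit R G)) ∧
        ((∀ i, IsRationalSheaf _ (G.homology i)) →
          ∃ Φ : R.functor.obj (Q.obj (gammaPullComplex s ι K G)) ≅ Q.obj G ⊞ (Q.obj G)⟦(-1 : ℤ)⟧,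
            derivedUnit R G ≫ Φ.hom = biprod.inl ∧
            derivedCupE R (gammaPullComplex s ι K G) ≫ Φ.hom⟦(1 : ℤ)⟧' =
              Φ.hom ≫ biprod.fst ≫ (shiftNegShift (Q.obj G) (1 : ℤ)).inv ≫
                (biprod.inr : _ ⟶ Q.obj G ⊞ (Q.obj G)⟦(-1 : ℤ)⟧)⟦(1 : ℤ)⟧') := by
  refine ⟨nonempty_gammaPush_constZ_iso s ι K,
    (coindResolution s ι K).nonempty_totalRightDerivedFunctor, fun R ↦
      ⟨nonempty_homology_derived_constZ_iso R, nonempty_derived_constQ_iso R, fun G ↦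
        ⟨exists_derivedUnit_triangle R G, isIso_derivedUnit R G, exists_derivedIso_biprod R G⟩⟩⟩
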